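/- **Theorem (pseudolocality of abstract Helmholtz operators).** *Setting.* Let $\mathcal H$ be a complex Hilbert space with inner product $(\cdot,\cdot)$ (linear in the first argument). For every $k>0$ let $\mathcal H=\mathcal H^0_k\supset\mathcal H^1_k\supset\mathcal H^2_k\supset\cdots$ be Hilbert spaces with dense inclusions, $\|u\|_{\mathcal H^m_k}\le\|u\|_{\mathcal H^n_k}$ for $m\le n$, and $\mathcal H_k^0=\mathcal H$ with equal norms; let $a_k$ be a sesquilinear form on $\mathcal H^1_k$, $a_k^*(u,v):=\overline{a_k(v,u)}$, $\operatorname{Re}a_k:=\frac12(a_k+a_k^*)$; and let $\mathcal Z_k$ be a closed subspace of $\mathcal H^1_k$ that is dense in $\mathcal H$. All constants below may depend on $k_0>0$ (and on the indices shown) but not on $k\ge k_0$. Assume: 1. (continuity) for all $k_0>0$ there is $C_0$ with $|a_k(u,v)|\le C_0\|u\|_{\mathcal H_k^1}\|v\|_{\mathcal H_k^1}$ for all $k\ge k_0$ and $u,v\in\mathcal H^1_k$; 2. (Gårding) for all $k_0>0$ there are $c_{\rm Ga}(k_0)>0$ and $C_{\rm Ga}(k_0)>0$ with $\operatorname{Re}(a_k(u,u))\ge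 c_{\rm Ga}(k_0)\|u\|^2_{\mathcal H^1_k}-C_{\rm Ga}(k_0)\|u\|^2_{\mathcal H}$ for all $k\ge k_0$, $u\in\mathcal H^1_k$; 3. (domain symmetry) for $b=a_k$, $a_k^*$, $\operatorname{Re}a_k$ the sets $\{u\in\mathcal Z_k:\sup_{v\in\mathcal Z_k,\|v\|_{\mathcal H}=1}|b(u,v)|<\infty\}$ are equal and contained in $\mathcal H^2_k$. Their common value is denoted $\mathcal Z_k^2$. Define $P_k,P_k^*,\mathcal P_k:\mathcal Z_k^2\to\mathcal H$ by $(P_ku,v)=a_k(u,v)$ and $(P_k^*u,v)=\overline{a_k(v,u)}$ for all $v\in\mathcal Z_k$, and $\mathcal P_k=\frac12(P_k+P_k^*)$; the operator $\mathcal P_k$ is self-adjoint. Put $\mathcal Z^0_k=\mathcal H$, $\mathcal Z^1_k=\mathcal Z_k$ (with the $\mathcal H^1_k$ norm) and, for $n\ge2$, $\mathcal Z^n_k=\mathcal Z^2_k\cap\mathcal H^n_k$ with $\|u\|^2_{\mathcal Z^n_k}=\|(\mathcal P_k+C_{\rm Ga}(k_0)+1)u\|^2_{\mathcal H}+\|u\|^2_{\mathcal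 H^n_k}$ for $k\ge k_0$. Assume further: 4. (operator continuity) for all $k_0>0$, $n\ge0$ there is $C$ such that, for all $k\ge k_0$, $P_k$ and $P_k^*$ map $\mathcal Z_k^{n+2}$ to $\mathcal H_k^n$ with $\|P_ku\|_{\mathcal H^n_k}+\|P^*_ku\|_{\mathcal H^n_k}\le C\|u\|_{\mathcal Z^{n+2}_k}$; 5. (elliptic regularity) let $Q\in\{P_k,P_k^*,\mathcal P_k\}$ and $n\ge0$. For $u\in\mathcal H$ define the antilinear form $Qu$ on $\mathcal Z_k^2$ by $\langle Qu,v\rangle=(u,Q^*v)$, where $Q^*=P_k^*,P_k,\mathcal P_k$ respectively. If $Qu\in\mathcal H^n_k$ (that is, $\langle Qu,v\rangle=(w,v)$ for all $v\in\mathcal Z_k^2$ and some $w\in\mathcal H_k^n$, and then $Qu:=w$), then $u\in\mathcal Z^{n+2}_k$ and $\|u\|_{\mathcal Z^{n+2}_k}\le C_{\rm ell}(k_0,n)(\|u\|_{\mathcal H}+\|Qu\|_{\mathcal H^n_k})$ for all $k\ge k_0$. *Order notation.* For $n\ge0$ let $\mathcal W^n_k=\mathcal Z^n_k$, $\mathcal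 Y^n_k=\mathcal H^n_k$; for $n\ge1$ let $\mathcal W_k^{-n}$ and $\mathcal Y_k^{-n}$ be the antiduals of $\mathcal H_k^n$ and $\mathcal Z_k^n$; an element $u$ of $\mathcal H$ is identified with the form $v\mapsto(u,v)$. Put $\mathcal W_k^\infty=\bigcap_n\mathcal W_k^n$ and $\mathcal Y_k^\infty=\bigcap_n\mathcal Y_k^n$. Let $\mathcal X,\mathcal X'\in\{\mathcal W,\mathcal Y\}$, let $b_k$ be real numbers, and let $m\in\mathbb Z$. A family of linear operators $L=L_k:\mathcal X_k^\infty\to\mathcal X_k'^\infty$ is $O_m(b;\mathcal X\to\mathcal X')$ if for all $k_0>0$ and $j\in\mathbb Z$ there is $C>0$ such that for all $k\ge k_0$ the operator $L$ extends to a continuous linear operator $\mathcal X_k^j\to\mathcal X_k'^{\,j-m}$ with $\|Lu\|_{\mathcal X_k'^{j-m}}\le C\,b_k\|u\|_{\mathcal X^j_k}$ for all $u\in\mathcal X_k^j$. For real numbers $(\eta_k)_{k>0}$, $O_m(\eta^{-\infty})$ means $O_m(\eta^{-N})$ for all $N\in\mathbb N$, and $O_{-\infty}(\eta^{-\infty})$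 means $O_m(\eta^{-\infty})$ for all $m\in\mathbb Z$. *Separated operators.* Write $\operatorname{ad}_RX=RX-XR$. A spatial cutoff (of order $0$, with parameter $\eta$) is a family of operators $R=R_k$, mapping $\mathcal W_k^\infty$ to itself, such that $R=O_0(1;\mathcal Y\to\mathcal Y)$ and, for all $N\in\mathbb N$ and $Q\in\{P_k,P_k^*,\mathcal P_k\}$, $\operatorname{ad}_R^NQ$ and $\operatorname{ad}_{R^*}^NQ$ are $O_{2-N}(\eta^{-N};\mathcal W\to\mathcal Y)$. Families $A,B\in O_0(1;\mathcal W\to\mathcal W)\cap O_0(1;\mathcal Y\to\mathcal Y)$ are separated if, for some spatial cutoff $R$, both $A(I-R)$ and $RB$ lie in $O_0(\eta^{-\infty};\mathcal Y\to\mathcal Y)\cap O_0(\eta^{-\infty};\mathcal W\to\mathcal W)$. *Elliptic perturbation.* For $k_0>0$ let $\psi^\sharp\in C_c^\infty(\mathbb R)$ be real-valued with $\psi^\sharp(x)\ge\frac12(-x+C_{\rm Ga}(k_0))$ for all $x\in\sigma(\mathcal P_k)$ and all $k\ge k_0$, and let $P_k^\sharp=P_k+\psi^\sharp(\mathcal P_k)$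 for $k\ge k_0$. *Conclusion.* Let $A,B$ be separated, let $f\in\mathcal S(\mathbb R)$, and let $Q$ be one of $P_k,P_k^*,\mathcal P_k$. Then $$A f(\mathcal P_k)B=O_{-\infty}(\eta^{-\infty};\mathcal Y\to\mathcal W),\qquad AQB=O_2(\eta^{-\infty};\mathcal W\to\mathcal Y),$$ and, for every $k_0>0$ and every $\psi^\sharp$ as above, $P_k^\sharp:\mathcal Z_k^2\to\mathcal H$ is bijective for all $k\ge k_0$ and $$A(P_k^\sharp)^{-1}B=O_{-2}(\eta^{-\infty};\mathcal Y\to\mathcal W),$$ where the bounds in the last relation are for $k\ge k_0$, with the $k_0$ to which $\psi^\sharp$ belongs. -/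

import Mathlib

open scoped ContDiff SchwartzMap ComplexConjugate

universe u

noncomputable section

/-! ### Unbounded operators: resolvent, spectrum, functional calculus -/

section Unbounded

variable {H : Type u} [NormedAddCommGroup H] [InnerProductSpace ℂ H]

/-- The value of an unbounded operator, extended by the junk value `0` outside its domain. -/
def LinearPMap.ap (Q : H →ₗ.[ℂ] H) (u : H) : H := by
  classical exact if h : u ∈ Q.domain then Q ⟨u, h⟩ else 0

/-- `T` is the bounded everywhere defined two-sided inverse of `Q - z`. -/
def LinearPMap.IsResolventAt (Q : H →ₗ.[ℂ] H) (z : ℂ) (T : H →L[ℂ] H) : Prop :=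
  (∀ u : H, ∃ h : T u ∈ Q.domain, Q ⟨T u, h⟩ - z • T u = u) ∧
    ∀ v : Q.domain, T (Q v - z • (v : H)) = v

/-- The spectrum of an unbounded operator. -/
def LinearPMap.spec (Q : H →ₗ.[ℂ] H) : Set ℂ := {z | ¬ ∃ T, Q.IsResolventAt z T}

/-- The resolvent `(Q - i)⁻¹` (junk value `0` if `i` lies in the spectrum). -/
def LinearPMap.resolventI (Q : H →ₗ.[ℂ] H) : H →L[ℂ] H := by
  classical exact if h : ∃ T, Q.IsResolventAt Complex.I T then h.choose else 0

/-- The functional calculus `f(Q)` of an unbounded self-adjoint operator `Q`, for continuous `f`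
vanishing at infinity. The substitution `t = (x - i)⁻¹` turns functions of `x ∈ ℝ` into functions
of the bounded normal operator `(Q - i)⁻¹`: for `t = (x - i)⁻¹` one has `x = Re t⁻¹`, and `t = 0`
corresponds to `x = ∞`, where `f` vanishes. The right-hand side is the continuous functional
calculus of bounded normal operators. -/
def LinearPMap.funCalc [CompleteSpace H] (Q : H →ₗ.[ℂ] H) (f : ℝ → ℂ) : H →L[ℂ] H := by
  classical exact cfc (fun t : ℂ => if t = 0 then 0 else f (t⁻¹).re) Q.resolventI

/-- The iterated commutator `ad_R^N X`, where `ad_R X = R X - X R`. -/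
def adPow (R X : H → H) : ℕ → H → H
  | 0 => X
  | N + 1 => fun u => R (adPow R X N u) - adPow R X N (R u)

end Unbounded

/-! ### The abstract setting at one value of the parameter `k` -/

/-- For one value of `k`: a decreasing sequence of Hilbert spaces `H^n ⊆ H` (given with their
embeddings into `H`), with dense inclusions and increasing norms and `H^0 = H`, a sesquilinear form
`a` on `H^1` (linear in the first, antilinear in the second argument), and a closed subspace `Z` of
`H^1` which is dense in `H`. -/
structure HelmholtzSetting (H : Type u) [NormedAddCommGroup H] [InnerProductSpace ℂ H] where
  Sp : ℕ → Type u
  [normedSp : ∀ n, NormedAddCommGroup (Sp n)]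
  [innerSp : ∀ n, InnerProductSpace ℂ (Sp n)]
  [completeSp : ∀ n, CompleteSpace (Sp n)]
  emb : ∀ n, Sp n →L[ℂ] H
  emb_injective : ∀ n, Function.Injective (emb n)
  emb_zero_surjective : Function.Surjective (emb 0)
  norm_emb_zero : ∀ x : Sp 0, ‖emb 0 x‖ = ‖x‖
  range_emb_anti : ∀ m n, m ≤ n → Set.range (emb n) ⊆ Set.range (emb m)
  norm_mono : ∀ m n, m ≤ n → ∀ (x : Sp m) (y : Sp n), emb m x = emb n y → ‖x‖ ≤ ‖y‖
  dense_incl : ∀ m n, m ≤ n → Dense {x : Sp m | emb m x ∈ Set.range (emb n)}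
  a : Sp 1 →ₗ[ℂ] Sp 1 →ₗ⋆[ℂ] ℂ
  Z : Submodule ℂ (Sp 1)
  isClosed_Z : IsClosed (Z : Set (Sp 1))
  dense_Z : Dense (emb 1 '' (Z : Set (Sp 1)))

attribute [instance] HelmholtzSetting.normedSp HelmholtzSetting.innerSp HelmholtzSetting.completeSp

/-- The three operators `P`, `P*` and `(P + P*) / 2`. -/
inductive OpKind
  | P
  | Pstar
  | Re

/-- The formal adjoint. -/
def OpKind.adj : OpKind → OpKind
  | P => Pstar
  | Pstar => P
  | Re => Re

namespace HelmholtzSetting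

variable {H : Type u} [NormedAddCommGroup H] [InnerProductSpace ℂ H] (S : HelmholtzSetting H)

/-- The adjoint form `(u, v) ↦ conj (a(v, u))`. -/
def aStar : S.Sp 1 →ₗ[ℂ] S.Sp 1 →ₗ⋆[ℂ] ℂ :=
  LinearMap.mk₂'ₛₗ (RingHom.id ℂ) (starRingEnd ℂ) (fun u v => conj (S.a v u))
    (fun _ _ _ => by simp) (fun _ _ _ => by simp) (fun _ _ _ => by simp) (fun _ _ _ => by simp)

/-- The Hermitian part of the form `a`. -/
def aRe : S.Sp 1 →ₗ[ℂ] S.Sp 1 →ₗ⋆[ℂ] ℂ := (1 / 2 : ℂ) • (S.a + S.aStar)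

variable (b : S.Sp 1 →ₗ[ℂ] S.Sp 1 →ₗ⋆[ℂ] ℂ)

/-- The elements `u ∈ Z` with `sup {|b(u,v)| : v ∈ Z, ‖v‖_H = 1} < ∞`, as a subspace of `H^1`. -/
def formDomainAux : Submodule ℂ (S.Sp 1) where
  carrier := {x | x ∈ S.Z ∧ ∃ C : ℝ, ∀ v ∈ S.Z, ‖S.emb 1 v‖ = 1 → ‖b x v‖ ≤ C}
  zero_mem' := ⟨S.Z.zero_mem, 0, by simp⟩
  add_mem' := by
    rintro x y ⟨hx, C, hC⟩ ⟨hy, D, hD⟩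
    refine ⟨S.Z.add_mem hx hy, C + D, fun v hv h1 => ?_⟩
    rw [map_add, LinearMap.add_apply]
    exact (norm_add_le _ _).trans (add_le_add (hC v hv h1) (hD v hv h1))
  smul_mem' := by
    rintro c x ⟨hx, C, hC⟩
    refine ⟨S.Z.smul_mem c hx, ‖c‖ * C, fun v hv h1 => ?_⟩
    rw [map_smul, LinearMap.smul_apply, norm_smul]
    exact mul_le_mul_of_nonneg_left (hC v hv h1) (norm_nonneg c)

/-- `{u ∈ Z : sup {|b(u,v)| : v ∈ Z, ‖v‖_H = 1} < ∞}`, as a subspace of `H`. -/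
def formDomain : Submodule ℂ H := (S.formDomainAux b).map (S.emb 1 : S.Sp 1 →ₗ[ℂ] H)

theorem rep_unique {w w' : H}
    (h : ∀ v ∈ S.Z, (inner ℂ (S.emb 1 v) w : ℂ) = inner ℂ (S.emb 1 v) w') : w = w' := by
  refine S.dense_Z.eq_of_inner_right (𝕜 := ℂ) ?_
  rintro _ ⟨v, hv, rfl⟩
  exact h v hv

theorem exists_rep [CompleteSpace H] {x : S.Sp 1} (hx : x ∈ S.formDomainAux b) :
    ∃ w : H, ∀ v ∈ S.Z, (inner ℂ (S.emb 1 v) w : ℂ) = b x v := by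
  obtain ⟨-, C, hC⟩ := hx
  have hb : ∀ v ∈ S.Z, ‖b x v‖ ≤ C * ‖S.emb 1 v‖ := by
    intro v hv
    by_cases h0 : S.emb 1 v = 0
    · have : v = 0 := S.emb_injective 1 (by rw [h0, map_zero])
      simp [this]
    · have hn : ‖S.emb 1 v‖ ≠ 0 := norm_ne_zero_iff.2 h0
      have h := hC ((‖S.emb 1 v‖⁻¹ : ℂ) • v) (S.Z.smul_mem _ hv)
        (by rw [map_smul, norm_smul]; simp [hn])
      rw [LinearMap.map_smulₛₗ, norm_smul] at h
      simp only [RCLike.norm_conj, norm_inv, Complex.norm_real, norm_norm] at h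
      rwa [inv_mul_le_iff₀ (by positivity), mul_comm] at h
  let e := S.Z.equivMapOfInjective (S.emb 1 : S.Sp 1 →ₗ[ℂ] H) (S.emb_injective 1)
  have he : ∀ y, S.emb 1 (e.symm y : S.Sp 1) = (y : H) := fun y => by
    have := congrArg Subtype.val (e.apply_symm_apply y)
    rwa [Submodule.coe_equivMapOfInjective_apply] at this
  let φ : S.Z.map (S.emb 1 : S.Sp 1 →ₗ[ℂ] H) →ₗ[ℂ] ℂ :=
    { toFun := fun y => conj (b x (e.symm y : S.Sp 1))
      map_add' := fun y z => by simp
      map_smul' := fun c y => by simp }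
  let φc := φ.mkContinuous C (fun y => by
    have := hb (e.symm y : S.Sp 1) (e.symm y).2
    rw [he] at this
    simpa [φ] using this)
  obtain ⟨g, hg, -⟩ := exists_extension_norm_eq _ φc
  refine ⟨(InnerProductSpace.toDual ℂ H).symm g, fun v hv => ?_⟩
  have h1 := hg (e ⟨v, hv⟩)
  have h2 : φc (e ⟨v, hv⟩) = conj (b x v) := by simp [φc, φ]
  have h3 : ((e ⟨v, hv⟩ : S.Z.map (S.emb 1 : S.Sp 1 →ₗ[ℂ] H)) : H) = S.emb 1 v := by simp [e]
  rw [h2, h3] at h1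
  rw [← inner_conj_symm, InnerProductSpace.toDual_symm_apply, h1, Complex.conj_conj]

theorem exists_formOp [CompleteSpace H] (u : S.formDomain b) :
    ∃ w : H, ∃ x ∈ S.Z, S.emb 1 x = u ∧ ∀ v ∈ S.Z, (inner ℂ (S.emb 1 v) w : ℂ) = b x v := by
  obtain ⟨_, x, hx, rfl⟩ := u
  obtain ⟨w, hw⟩ := S.exists_rep b hx
  exact ⟨w, x, hx.1, rfl, hw⟩

/-- The operator in `H` associated with the form `b` on `Z`: for `u` in `formDomain b`, the image
`w` of `u` is the unique element of `H` with `(w, v)_H = b(u, v)` for all `v ∈ Z`. (In Mathlib the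
inner product is linear in its second argument, so `(w, v)_H` is `inner ℂ v w`.) -/
def formOp [CompleteSpace H] : H →ₗ.[ℂ] H where
  domain := S.formDomain b
  toFun :=
    { toFun := fun u => (S.exists_formOp b u).choose
      map_add' := fun u u' => by
        obtain ⟨x, -, hx, h⟩ := (S.exists_formOp b u).choose_spec
        obtain ⟨x', -, hx', h'⟩ := (S.exists_formOp b u').choose_spec
        obtain ⟨y, -, hy, h''⟩ := (S.exists_formOp b (u + u')).choose_spec
        have : y = x + x' := S.emb_injective 1 (by rw [hy, map_add, hx, hx']; rfl)
        refine S.rep_unique fun v hv => ?_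
        rw [h'' v hv, inner_add_right, h v hv, h' v hv, this, map_add, LinearMap.add_apply]
      map_smul' := fun c u => by
        obtain ⟨x, -, hx, h⟩ := (S.exists_formOp b u).choose_spec
        obtain ⟨y, -, hy, h''⟩ := (S.exists_formOp b (c • u)).choose_spec
        have : y = c • x := S.emb_injective 1 (by rw [hy, map_smul, hx]; rfl)
        refine S.rep_unique fun v hv => ?_
        rw [h'' v hv, RingHom.id_apply, inner_smul_right, h v hv, this, map_smul,
          LinearMap.smul_apply, smul_eq_mul] }

/-- The domains of the three forms coincide and are contained in `H^2`; the common domain is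
`Z^2`. -/
def DomainSymmetry : Prop :=
  S.formDomain S.aStar = S.formDomain S.a ∧ S.formDomain S.aRe = S.formDomain S.a ∧
    (S.formDomain S.a : Set H) ⊆ Set.range (S.emb 2)

/-- `P`, `P*`, and `𝒫 = (P + P*) / 2`; the domain of each is `Z^2` under `DomainSymmetry`. -/
def op [CompleteSpace H] : OpKind → (H →ₗ.[ℂ] H)
  | .P => S.formOp S.a
  | .Pstar => S.formOp S.aStar
  | .Re => (1 / 2 : ℂ) • (S.formOp S.a + S.formOp S.aStar)

variable [CompleteSpace H]

/-! ### The spaces `Z^n` -/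

/-- `Z^2 ∩ H^n` with norm `‖u‖² = ‖(𝒫 + c + 1) u‖_H² + ‖u‖_{H^n}²`, realized as the space of pairs
`((𝒫 + c + 1) u, u)` in the Hilbert space `H × H^n`. -/
def ZGraph (c : ℝ) (n : ℕ) : Submodule ℂ (WithLp 2 (H × S.Sp n)) where
  carrier := {p | ∃ h : S.emb n p.snd ∈ (S.op .Re).domain,
    p.fst = S.op .Re ⟨S.emb n p.snd, h⟩ + ((c + 1 : ℝ) : ℂ) • S.emb n p.snd}
  zero_mem' := by
    refine ⟨by simp, ?_⟩
    have : (⟨S.emb n (0 : WithLp 2 (H × S.Sp n)).snd, by simp⟩ : (S.op .Re).domain) = 0 :=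
      Subtype.ext (by simp)
    rw [this]; simp
  add_mem' := by
    rintro p q ⟨hp, ep⟩ ⟨hq, eq⟩
    have hs : S.emb n (p + q).snd = S.emb n p.snd + S.emb n q.snd := by simp
    refine ⟨hs ▸ Submodule.add_mem _ hp hq, ?_⟩
    have : (⟨S.emb n (p + q).snd, hs ▸ Submodule.add_mem _ hp hq⟩ : (S.op .Re).domain)
      = ⟨_, hp⟩ + ⟨_, hq⟩ := Subtype.ext hs
    rw [this, LinearPMap.map_add, WithLp.add_fst, ep, eq, hs, smul_add]
    abel
  smul_mem' := by
    rintro z p ⟨hp, ep⟩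
    have hs : S.emb n (z • p).snd = z • S.emb n p.snd := by simp
    refine ⟨hs ▸ Submodule.smul_mem _ z hp, ?_⟩
    have : (⟨S.emb n (z • p).snd, hs ▸ Submodule.smul_mem _ z hp⟩ : (S.op .Re).domain)
      = z • ⟨_, hp⟩ := Subtype.ext hs
    rw [this, LinearPMap.map_smul, WithLp.smul_fst, ep, hs, smul_add, smul_comm z]

/-- The spaces `Z^0 = H`, `Z^1 = Z`, `Z^n = Z^2 ∩ H^n` for `n ≥ 2`. -/
def ZSp (c : ℝ) : ℕ → Type u
  | 0 => H
  | 1 => S.Z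
  | n + 2 => S.ZGraph c (n + 2)

instance instZNormed (c : ℝ) : ∀ n, NormedAddCommGroup (S.ZSp c n)
  | 0 => inferInstanceAs (NormedAddCommGroup H)
  | 1 => inferInstanceAs (NormedAddCommGroup S.Z)
  | n + 2 => inferInstanceAs (NormedAddCommGroup (S.ZGraph c (n + 2)))

instance instZInner (c : ℝ) : ∀ n, InnerProductSpace ℂ (S.ZSp c n)
  | 0 => inferInstanceAs (InnerProductSpace ℂ H)
  | 1 => inferInstanceAs (InnerProductSpace ℂ S.Z)
  | n + 2 => inferInstanceAs (InnerProductSpace ℂ (S.ZGraph c (n + 2)))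

/-- The embedding of `Z^n` into `H`. -/
def zEmb (c : ℝ) : ∀ n, S.ZSp c n → H
  | 0 => fun u => u
  | 1 => fun u => S.emb 1 u.1
  | n + 2 => fun u => S.emb (n + 2) u.1.snd

end HelmholtzSetting

/-! ### Scales of spaces indexed by `ℤ` and the order notation -/

/-- A family of normed spaces indexed by `ℤ`, with the relation `rep j u x`: the element `x` of the
`j`-th space is identified with the element `u` of `H`. -/
structure SpaceScale (H : Type u) where
  Sp : ℤ → Type u
  [normed : ∀ j, NormedAddCommGroup (Sp j)]
  [normedSpace : ∀ j, NormedSpace ℂ (Sp j)]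
  rep : ∀ j, H → Sp j → Prop

attribute [instance] SpaceScale.normed SpaceScale.normedSpace

/-- The intersection of all the spaces of a scale (inside `H`). -/
def SpaceScale.inf {H : Type u} (X : SpaceScale H) : Set H := {u | ∀ j, ∃ x, X.rep j u x}

namespace HelmholtzSetting

variable {H : Type u} [NormedAddCommGroup H] [InnerProductSpace ℂ H] [CompleteSpace H]
  (S : HelmholtzSetting H) (c : ℝ)

/-- `W^n = Z^n` for `n ≥ 0`, and `W^{-n}` is the antidual of `H^n`. -/
def WSp : ℤ → Type u
  | .ofNat n => S.ZSp c n
  | .negSucc n => S.Sp (n + 1) →L⋆[ℂ] ℂ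

/-- `Y^n = H^n` for `n ≥ 0`, and `Y^{-n}` is the antidual of `Z^n`. -/
def YSp : ℤ → Type u
  | .ofNat n => S.Sp n
  | .negSucc n => S.ZSp c (n + 1) →L⋆[ℂ] ℂ

instance instWNormed : ∀ j, NormedAddCommGroup (S.WSp c j)
  | .ofNat n => inferInstanceAs (NormedAddCommGroup (S.ZSp c n))
  | .negSucc n => inferInstanceAs (NormedAddCommGroup (S.Sp (n + 1) →L⋆[ℂ] ℂ))

instance instWNormedSpace : ∀ j, NormedSpace ℂ (S.WSp c j)
  | .ofNat n => inferInstanceAs (NormedSpace ℂ (S.ZSp c n))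
  | .negSucc n => inferInstanceAs (NormedSpace ℂ (S.Sp (n + 1) →L⋆[ℂ] ℂ))

instance instYNormed : ∀ j, NormedAddCommGroup (S.YSp c j)
  | .ofNat n => inferInstanceAs (NormedAddCommGroup (S.Sp n))
  | .negSucc n => inferInstanceAs (NormedAddCommGroup (S.ZSp c (n + 1) →L⋆[ℂ] ℂ))

instance instYNormedSpace : ∀ j, NormedSpace ℂ (S.YSp c j)
  | .ofNat n => inferInstanceAs (NormedSpace ℂ (S.Sp n))
  | .negSucc n => inferInstanceAs (NormedSpace ℂ (S.ZSp c (n + 1) →L⋆[ℂ] ℂ))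

/-- The identification of elements of `H` with elements of `W^j`; an element `u` of `H` acts as the
antilinear form `v ↦ (u, v)_H`. -/
def WRep : ∀ j, H → S.WSp c j → Prop
  | .ofNat n => fun u x => S.zEmb c n x = u
  | .negSucc n => fun u (x : S.Sp (n + 1) →L⋆[ℂ] ℂ) => ∀ v, x v = inner ℂ (S.emb (n + 1) v) u

/-- The identification of elements of `H` with elements of `Y^j`. -/
def YRep : ∀ j, H → S.YSp c j → Prop
  | .ofNat n => fun u x => S.emb n x = u
  | .negSucc n => fun u (x : S.ZSp c (n + 1) →L⋆[ℂ] ℂ) =>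
      ∀ v, x v = inner ℂ (S.zEmb c (n + 1) v) u

/-- The scale `W` ("with boundary conditions"). -/
def W : SpaceScale H where
  Sp := S.WSp c
  rep := S.WRep c

/-- The scale `Y` ("without boundary conditions"). -/
def Y : SpaceScale H where
  Sp := S.YSp c
  rep := S.YRep c

end HelmholtzSetting

section Order

variable {H : Type u}

/-- The bounds of the order notation for one value of `k₀`: for all `k ≥ k₀`, `L k` maps `X^∞` to
`X'^∞`, and for all `j ∈ ℤ` it extends to a linear map `X^j → X'^{j-m}` of norm at most
`C(k₀, j) b(k)`. Only the values of `L k` on `X^∞` matter. -/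
def IsOrderFrom (k₀ : ℝ) (X X' : ℝ → SpaceScale H) (m : ℤ) (b : ℝ → ℝ) (L : ℝ → H → H) : Prop :=
  (∀ k ≥ k₀, Set.MapsTo (L k) (X k).inf (X' k).inf) ∧
  ∀ j : ℤ, ∃ C > 0, ∀ k ≥ k₀, ∃ T : (X k).Sp j →L[ℂ] (X' k).Sp (j - m),
    (∀ u ∈ (X k).inf, ∀ x, (X k).rep j u x → (X' k).rep (j - m) (L k u) (T x)) ∧
    ∀ x, ‖T x‖ ≤ C * b k * ‖x‖

/-- `L = O_m(b; X → X')`. The norms of the scales may depend on `k₀`. -/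
def IsOrder (X X' : ℝ → ℝ → SpaceScale H) (m : ℤ) (b : ℝ → ℝ) (L : ℝ → H → H) : Prop :=
  ∀ k₀ > 0, IsOrderFrom k₀ (X k₀) (X' k₀) m b L

/-- `L = O_m(η^{-∞}; X → X')`. -/
def IsOrderInf (X X' : ℝ → ℝ → SpaceScale H) (m : ℤ) (η : ℝ → ℝ) (L : ℝ → H → H) : Prop :=
  ∀ N : ℕ, IsOrder X X' m (fun k => η k ^ (-N : ℤ)) L

end Order

/-! ### The family indexed by `k > 0` -/

section Family

variable {H : Type u} [NormedAddCommGroup H] [InnerProductSpace ℂ H]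
  (S : ℝ → HelmholtzSetting H)

/-- `k`-uniform continuity of the forms. -/
def UniformContinuity : Prop :=
  ∀ k₀ > 0, ∃ C₀ > 0, ∀ k ≥ k₀, ∀ u v : (S k).Sp 1, ‖(S k).a u v‖ ≤ C₀ * ‖u‖ * ‖v‖

/-- The Gårding inequality with constants `c_Ga(k₀)` and `C_Ga(k₀)`. -/
def GardingInequality (CGa : ℝ → ℝ) : Prop :=
  ∀ k₀ > 0, 0 < CGa k₀ ∧ ∃ cGa > 0, ∀ k ≥ k₀, ∀ u : (S k).Sp 1,
    cGa * ‖u‖ ^ 2 - CGa k₀ * ‖(S k).emb 1 u‖ ^ 2 ≤ ((S k).a u u).re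

variable [CompleteSpace H]

/-- The scale `W_k^n`; for `k ≥ k₀` the norm of `Z_k^2` uses the constant `C_Ga(k₀)`. -/
def scaleW (CGa : ℝ → ℝ) (k₀ k : ℝ) : SpaceScale H := (S k).W (CGa k₀)

/-- The scale `Y_k^n`. -/
def scaleY (CGa : ℝ → ℝ) (k₀ k : ℝ) : SpaceScale H := (S k).Y (CGa k₀)

/-- `P_k` and `P_k^*` map `Z_k^{n+2}` to `H_k^n` with `k`-uniform bounds. -/
def OperatorContinuity (CGa : ℝ → ℝ) : Prop :=
  ∀ k₀ > 0, ∀ n : ℕ, ∃ C > 0, ∀ k ≥ k₀, ∀ u : (S k).ZSp (CGa k₀) (n + 2),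
    ∃ w w' : (S k).Sp n,
      (S k).emb n w = ((S k).op .P).ap ((S k).zEmb (CGa k₀) (n + 2) u) ∧
      (S k).emb n w' = ((S k).op .Pstar).ap ((S k).zEmb (CGa k₀) (n + 2) u) ∧
      ‖w‖ + ‖w'‖ ≤ C * ‖u‖

/-- Elliptic regularity. For `u ∈ H`, the element `Q u` of the antidual of `Z^2` is defined by
`⟨Q u, v⟩ = (u, Q^* v)_H`; if it is given by an element `w` of `H^n`, then `u ∈ Z^{n+2}`, with a
`k`-uniform bound. -/
def EllipticRegularity (CGa : ℝ → ℝ) : Prop :=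
  ∀ q : OpKind, ∀ k₀ > 0, ∀ n : ℕ, ∃ C > 0, ∀ k ≥ k₀, ∀ (u : H) (w : (S k).Sp n),
    (∀ v : ((S k).op q.adj).domain,
      (inner ℂ ((S k).op q.adj v) u : ℂ) = inner ℂ (v : H) ((S k).emb n w)) →
    ∃ u' : (S k).ZSp (CGa k₀) (n + 2),
      (S k).zEmb (CGa k₀) (n + 2) u' = u ∧ ‖u'‖ ≤ C * (‖u‖ + ‖w‖)

/-- Spatial cutoffs (of order `0`) with parameter `η`. The commutators `ad_R Q` are defined
on `W_k^∞` since `R` maps `W_k^∞` to itself. -/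
structure IsSpatialCutoff (CGa η : ℝ → ℝ) (R : ℝ → H →L[ℂ] H) : Prop where
  mapsTo_W : ∀ k > 0, Set.MapsTo (R k) (scaleW S CGa k k).inf (scaleW S CGa k k).inf
  order : IsOrder (scaleY S CGa) (scaleY S CGa) 0 (fun _ => 1) (fun k => R k)
  ad : ∀ (q : OpKind) (N : ℕ), IsOrder (scaleW S CGa) (scaleY S CGa) (2 - N)
    (fun k => η k ^ (-N : ℤ)) (fun k => adPow (R k) ((S k).op q).ap N)
  ad_adjoint : ∀ (q : OpKind) (N : ℕ), IsOrder (scaleW S CGa) (scaleY S CGa) (2 - N)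
    (fun k => η k ^ (-N : ℤ))
    (fun k => adPow (ContinuousLinearMap.adjoint (R k)) ((S k).op q).ap N)

/-- `A = O_0(1; W → W) ∩ O_0(1; Y → Y)`. -/
def IsOrderZero (CGa : ℝ → ℝ) (A : ℝ → H →L[ℂ] H) : Prop :=
  IsOrder (scaleW S CGa) (scaleW S CGa) 0 (fun _ => 1) (fun k => A k) ∧
    IsOrder (scaleY S CGa) (scaleY S CGa) 0 (fun _ => 1) (fun k => A k)

/-- `A = O_0(η^{-∞}; Y → Y) ∩ O_0(η^{-∞}; W → W)`. -/
def IsNegligible (CGa η : ℝ → ℝ) (A : ℝ → H →L[ℂ] H) : Prop :=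
  IsOrderInf (scaleY S CGa) (scaleY S CGa) 0 η (fun k => A k) ∧
    IsOrderInf (scaleW S CGa) (scaleW S CGa) 0 η (fun k => A k)

/-- `A` and `B` are separated (by some spatial cutoff `R`). -/
def AreSeparated (CGa η : ℝ → ℝ) (A B : ℝ → H →L[ℂ] H) : Prop :=
  IsOrderZero S CGa A ∧ IsOrderZero S CGa B ∧ ∃ R : ℝ → H →L[ℂ] H,
    IsSpatialCutoff S CGa η R ∧
    IsNegligible S CGa η (fun k => A k ∘L (ContinuousLinearMap.id ℂ H - R k)) ∧
    IsNegligible S CGa η (fun k => R k ∘L B k)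

/-- The admissible functions `ψ^♯` for `k ≥ k₀`. -/
structure IsAdmissible (CGa : ℝ → ℝ) (k₀ : ℝ) (ψ : ℝ → ℝ) : Prop where
  smooth : ContDiff ℝ ∞ ψ
  compact : HasCompactSupport ψ
  lower : ∀ k ≥ k₀, ∀ x : ℝ, (x : ℂ) ∈ ((S k).op .Re).spec → (-x + CGa k₀) / 2 ≤ ψ x

/-- The elliptic perturbation `P^♯ = P + ψ(𝒫)`, as a map `Z^2 → H`. -/
def HelmholtzSetting.PSharp (S : HelmholtzSetting H) (ψ : ℝ → ℝ) (u : (S.op .P).domain) : H :=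
  S.op .P u + (S.op .Re).funCalc (fun x => (ψ x : ℂ)) u

/-- The inverse `(P^♯)⁻¹ : H → Z^2`, viewed in `H` (meaningful if `P^♯ : Z^2 → H` is bijective). -/
def HelmholtzSetting.PSharpInv (S : HelmholtzSetting H) (ψ : ℝ → ℝ) (u : H) : H :=
  ((Function.invFun (S.PSharp ψ) u : (S.op .P).domain) : H)

end Family

end

/-! ### Iterated commutators -/

section AdPow

variable {H : Type u} [NormedAddCommGroup H]

/-! Let X be an operator whose iterated commutators with the cutoff R behave as for a
pseudodifferential operator: ad_R^n X has order m - n and size η^{-n}. From A X B = A(1-R)XB +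
AX(RB) + A(ad_R X)B the first two terms are negligible by separation and the third is a term of the
same kind with one more factor η^{-1}. Iterating N times gives A X B = O_m(η^{-N}); this is
`CommBd.separated`. It remains to prove such commutator bounds (`CommBd`) for X = Q, f(𝒫) and
(P^♯)⁻¹. For Q they are part of the definition of a cutoff.

For an inverse G of Q + K they follow from ad_R G = -G (ad_R (Q + K)) G by induction
(`CommBd.inverse`), once G has order -2 from Y to W. That order comes from elliptic regularity on
H^n with n ≥ 0, from Lax-Milgram on the antidual of Z, and from transposing the adjoint inverse on
the lower spaces (`UniformFamily.ordBd_inverse`). It applies to N = (𝒫 - i)⁻¹ and to its adjoint.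

For f(𝒫) the tool is a Fourier series instead of an almost analytic extension. The Cayley transform
U = 1 + 2iN is unitary, and x = cot(πθ) turns (x - i)^M f(x) into a smooth function on the circle,
so f(𝒫) = Σ c_n U^n N^M with rapidly decreasing c_n. On each space of the Y scale, U^n and its
iterated commutators grow only polynomially in n (`CommBd.one_add_smul_pow`): on H by unitarity,
elsewhere by moving through the scale with N. The series therefore converges with all its
commutators, and M is arbitrary, so f(𝒫) has every order.

Finally the lower bound on ψ^♯ on the spectrum of 𝒫 gives ψ^♯(𝒫) ≥ (C_Ga - 𝒫)/2 as forms on Z^2.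
Together with Gårding and the density of Z^2 in Z, this makes the form of P^♯ coercive
(`coercive_funCalc`), and P^♯ is covered by the argument for inverses with K = ψ^♯(𝒫).

All bounds are stated over an arbitrary index set, so that uniformity in k and polynomial growth in
n are treated alike. -/

theorem adPow_succ_eq (R X : H → H) (n : ℕ) :
    adPow R X (n + 1) = adPow R (fun u => R (X u) - X (R u)) n := by
  induction n with
  | zero => rfl
  | succ n ih =>
    funext u
    rw [adPow, ih]
    rfl

theorem adPow_congr {R X X' : H → H} {s : Set H} (hR : Set.MapsTo R s s) (h : Set.EqOn X X' s)
    (n : ℕ) : Set.EqOn (adPow R X n) (adPow R X' n) s := by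
  induction n with
  | zero => exact h
  | succ n ih =>
    intro u hu
    simp only [adPow]
    rw [ih hu, ih (hR hu)]

variable [InnerProductSpace ℂ H]

theorem adPow_add (R : H →L[ℂ] H) (X X' : H → H) (n : ℕ) :
    adPow R (fun u => X u + X' u) n = fun u => adPow R X n u + adPow R X' n u := by
  induction n with
  | zero => rfl
  | succ n ih =>
    funext u
    simp only [adPow, ih, map_add]
    abel

theorem adPow_smul (R : H →L[ℂ] H) (c : ℂ) (X : H → H) (n : ℕ) :
    adPow R (fun u => c • X u) n = fun u => c • adPow R X n u := by
  induction n with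
  | zero => rfl
  | succ n ih =>
    funext u
    simp only [adPow, ih, map_smul, smul_sub]

theorem adPow_sum {α : Type*} (R : H →L[ℂ] H) (s : Finset α) (X : α → H → H) (n : ℕ) :
    adPow R (fun u => ∑ a ∈ s, X a u) n = fun u => ∑ a ∈ s, adPow R (X a) n u := by
  induction n with
  | zero => rfl
  | succ n ih =>
    funext u
    simp only [adPow, ih, map_sum, Finset.sum_sub_distrib]

theorem hasSum_adPow {α : Type*} (R : H →L[ℂ] H) {X : α → H → H} {X' : H → H}
    (h : ∀ u, HasSum (fun a => X a u) (X' u)) (n : ℕ) (u : H) :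
    HasSum (fun a => adPow R (X a) n u) (adPow R X' n u) := by
  induction n generalizing u with
  | zero => exact h u
  | succ n ih => exact ((ih u).mapL R).sub (ih (R u))

/-- The commutator with a scalar operator vanishes. -/
theorem adPow_smul_id (R : H →L[ℂ] H) (c : ℂ) (n : ℕ) :
    adPow R (fun u => c • u) (n + 1) = fun _ => 0 := by
  induction n with
  | zero => funext u; simp [adPow]
  | succ n ih => funext u; rw [adPow, ih]; simp

end AdPow

/-! ### Operators of finite order between families of scales -/

/-- The identification relation of the scale is linear, separates the elements of `H` at level `0`
and is closed, and the spaces are complete. -/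
structure SpaceScale.Regular {H : Type u} [NormedAddCommGroup H] [InnerProductSpace ℂ H]
    (X : SpaceScale H) : Prop where
  zero : ∀ j, X.rep j 0 0
  add : ∀ j u v x y, X.rep j u x → X.rep j v y → X.rep j (u + v) (x + y)
  smul : ∀ j (c : ℂ) u x, X.rep j u x → X.rep j (c • u) (c • x)
  unique : ∀ u v x, X.rep 0 u x → X.rep 0 v x → u = v
  closed : ∀ j (u : ℕ → H) (x : ℕ → X.Sp j) U V, (∀ n, X.rep j (u n) (x n)) →
    Filter.Tendsto u Filter.atTop (nhds U) → Filter.Tendsto x Filter.atTop (nhds V) → X.rep j U V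
  complete : ∀ j, CompleteSpace (X.Sp j)

/-- For an arbitrary index set: `L i` extends, for all `j`, to an operator `X^j → X'^{j-m}` of norm
at most `C w(i)^M h(i)^p`, where `C` and `M` depend on `j` only. -/
def OrdBd {H : Type u} {ι : Type*} (X X' : ι → SpaceScale H) (w h : ι → ℝ) (m : ℤ) (p : ℕ)
    (L : ι → H → H) : Prop :=
  ∀ j j' : ℤ, j' + m = j → ∃ C : ℝ, 0 ≤ C ∧ ∃ M : ℕ, ∀ i, ∃ T : (X i).Sp j →L[ℂ] (X' i).Sp j',
    (∀ u ∈ (X i).inf, ∀ x, (X i).rep j u x → (X' i).rep j' (L i u) (T x)) ∧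
    ‖T‖ ≤ C * w i ^ M * h i ^ p

namespace OrdBd

variable {H : Type u} {ι ι' : Type*} {X X' X'' : ι → SpaceScale H} {w h : ι → ℝ} {m m' : ℤ}
  {p p' : ℕ} {L L' : ι → H → H}

theorem congr (hL : OrdBd X X' w h m p L) (e : ∀ i, Set.EqOn (L i) (L' i) (X i).inf) :
    OrdBd X X' w h m p L' := by
  intro j j' hj
  obtain ⟨C, hC, M, hT⟩ := hL j j' hj
  refine ⟨C, hC, M, fun i => ?_⟩
  obtain ⟨T, h1, h2⟩ := hT i
  exact ⟨T, fun u hu x hx => e i hu ▸ h1 u hu x hx, h2⟩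

theorem mapsTo (hL : OrdBd X X' w h m p L) (i : ι) : Set.MapsTo (L i) (X i).inf (X' i).inf := by
  intro u hu j'
  obtain ⟨C, hC, M, hT⟩ := hL (j' + m) j' rfl
  obtain ⟨T, h1, h2⟩ := hT i
  obtain ⟨x, hx⟩ := hu (j' + m)
  exact ⟨_, h1 u hu x hx⟩

theorem comap (hL : OrdBd X X' w h m p L) (g : ι' → ι) {w' : ι' → ℝ} (hw : ∀ i, 1 ≤ w i)
    (hh : ∀ i, 0 ≤ h i) (hw' : ∀ i, w (g i) ≤ w' i) :
    OrdBd (fun i => X (g i)) (fun i => X' (g i)) w' (fun i => h (g i)) m p (fun i => L (g i)) := by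
  intro j j' hj
  obtain ⟨C, hC, M, hT⟩ := hL j j' hj
  refine ⟨C, hC, M, fun i => ?_⟩
  obtain ⟨T, h1, h2⟩ := hT (g i)
  refine ⟨T, h1, h2.trans ?_⟩
  have := hh (g i)
  have := hw (g i)
  have := hw' i
  gcongr

theorem comp (hw : ∀ i, 1 ≤ w i) (hh : ∀ i, 0 ≤ h i) (hL : OrdBd X' X'' w h m p L)
    (hL' : OrdBd X X' w h m' p' L') :
    OrdBd X X'' w h (m + m') (p + p') (fun i u => L i (L' i u)) := by
  intro j j' hj
  obtain ⟨C, hC, M, hT⟩ := hL (j' + m) j' rfl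
  obtain ⟨C', hC', M', hT'⟩ := hL' j (j' + m) (by rw [← hj, add_assoc])
  refine ⟨C * C', mul_nonneg hC hC', M + M', fun i => ?_⟩
  obtain ⟨T, h1, h2⟩ := hT i
  obtain ⟨T', h1', h2'⟩ := hT' i
  refine ⟨T ∘L T', fun u hu x hx => h1 _ (hL'.mapsTo i hu) _ (h1' u hu x hx), ?_⟩
  have := hh i
  have := hw i
  calc ‖T ∘L T'‖ ≤ ‖T‖ * ‖T'‖ := T.opNorm_comp_le T'
    _ ≤ (C * w i ^ M * h i ^ p) * (C' * w i ^ M' * h i ^ p') := by gcongr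
    _ = _ := by ring

theorem cast (hL : OrdBd X X' w h m p L) (hm : m = m') (hp : p = p') : OrdBd X X' w h m' p' L := by
  subst hm hp; exact hL

variable [NormedAddCommGroup H] [InnerProductSpace ℂ H]

/-- `L i` is a bare function. Its linearity on X^∞ is recovered from the linear extension X^m →
X'^0, because an element of X'^0 determines the element of H that it represents. -/
theorem map_add (hX : ∀ i, (X i).Regular) (hX' : ∀ i, (X' i).Regular)
    (hL : OrdBd X X' w h m p L) (i : ι) {u v : H} (hu : u ∈ (X i).inf) (hv : v ∈ (X i).inf) :
    u + v ∈ (X i).inf ∧ L i (u + v) = L i u + L i v := by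
  have huv : u + v ∈ (X i).inf := fun j => by
    obtain ⟨x, hx⟩ := hu j
    obtain ⟨y, hy⟩ := hv j
    exact ⟨_, (hX i).add j u v x y hx hy⟩
  refine ⟨huv, ?_⟩
  obtain ⟨C, hC, M, hT⟩ := hL m 0 (by simp)
  obtain ⟨T, h1, h2⟩ := hT i
  obtain ⟨x, hx⟩ := hu m
  obtain ⟨y, hy⟩ := hv m
  have a1 := h1 _ huv _ ((hX i).add m u v x y hx hy)
  have a2 := (hX' i).add 0 _ _ _ _ (h1 u hu x hx) (h1 v hv y hy)
  rw [_root_.map_add] at a1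
  exact (hX' i).unique _ _ _ a1 a2

theorem map_smul (hX : ∀ i, (X i).Regular) (hX' : ∀ i, (X' i).Regular)
    (hL : OrdBd X X' w h m p L) (i : ι) (c : ℂ) {u : H} (hu : u ∈ (X i).inf) :
    c • u ∈ (X i).inf ∧ L i (c • u) = c • L i u := by
  have huv : c • u ∈ (X i).inf := fun j => by
    obtain ⟨x, hx⟩ := hu j
    exact ⟨_, (hX i).smul j c u x hx⟩
  refine ⟨huv, ?_⟩
  obtain ⟨C, hC, M, hT⟩ := hL m 0 (by simp)
  obtain ⟨T, h1, h2⟩ := hT i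
  obtain ⟨x, hx⟩ := hu m
  have a1 := h1 _ huv _ ((hX i).smul m c u x hx)
  have a2 := (hX' i).smul 0 c _ _ (h1 u hu x hx)
  rw [_root_.map_smul] at a1
  exact (hX' i).unique _ _ _ a1 a2

theorem map_sub (hX : ∀ i, (X i).Regular) (hX' : ∀ i, (X' i).Regular)
    (hL : OrdBd X X' w h m p L) (i : ι) {u v : H} (hu : u ∈ (X i).inf) (hv : v ∈ (X i).inf) :
    u - v ∈ (X i).inf ∧ L i (u - v) = L i u - L i v := by
  have h1 := hL.map_smul hX hX' i (-1) hv
  have h2 := hL.map_add hX hX' i hu h1.1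
  rw [h1.2] at h2
  simpa [← sub_eq_add_neg] using h2

theorem smul (hX' : ∀ i, (X' i).Regular) (c : ℂ) (hL : OrdBd X X' w h m p L) :
    OrdBd X X' w h m p (fun i u => c • L i u) := by
  intro j j' hj
  obtain ⟨C, hC, M, hT⟩ := hL j j' hj
  refine ⟨‖c‖ * C, by positivity, M, fun i => ?_⟩
  obtain ⟨T, h1, h2⟩ := hT i
  refine ⟨c • T, fun u hu x hx => (hX' i).smul _ _ _ _ (h1 u hu x hx), ?_⟩
  rw [norm_smul]
  calc ‖c‖ * ‖T‖ ≤ ‖c‖ * (C * w i ^ M * h i ^ p) := by gcongr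
    _ = _ := by ring

theorem add (hw : ∀ i, 1 ≤ w i) (hh : ∀ i, 0 ≤ h i)
    (hX' : ∀ i, (X' i).Regular) (hL : OrdBd X X' w h m p L) (hL' : OrdBd X X' w h m p L') :
    OrdBd X X' w h m p (fun i u => L i u + L' i u) := by
  intro j j' hj
  obtain ⟨C, hC, M, hT⟩ := hL j j' hj
  obtain ⟨C', hC', M', hT'⟩ := hL' j j' hj
  refine ⟨C + C', by positivity, M + M', fun i => ?_⟩
  obtain ⟨T, h1, h2⟩ := hT i
  obtain ⟨T', h1', h2'⟩ := hT' i
  refine ⟨T + T', fun u hu x hx => (hX' i).add _ _ _ _ _ (h1 u hu x hx) (h1' u hu x hx), ?_⟩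
  have hi := hh i
  have wi := hw i
  have e1 : w i ^ M ≤ w i ^ (M + M') := pow_le_pow_right₀ wi (by omega)
  have e2 : w i ^ M' ≤ w i ^ (M + M') := pow_le_pow_right₀ wi (by omega)
  calc ‖T + T'‖ ≤ ‖T‖ + ‖T'‖ := norm_add_le _ _
    _ ≤ C * w i ^ (M + M') * h i ^ p + C' * w i ^ (M + M') * h i ^ p := by
      refine add_le_add (h2.trans ?_) (h2'.trans ?_) <;> gcongr
    _ = _ := by ring

theorem zero (hX' : ∀ i, (X' i).Regular) :
    OrdBd X X' w h m p (fun _ _ => 0) := fun _ j' _ =>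
  ⟨0, le_rfl, 0, fun i => ⟨0, fun _ _ _ _ => (hX' i).zero j', by simp⟩⟩

theorem rep_sum {Y : SpaceScale H} (hY : Y.Regular) {α : Type*} (j : ℤ) (s : Finset α) (u : α → H)
    (x : α → Y.Sp j) (h : ∀ a ∈ s, Y.rep j (u a) (x a)) :
    Y.rep j (∑ a ∈ s, u a) (∑ a ∈ s, x a) := by
  classical
  induction s using Finset.induction_on with
  | empty => simpa using hY.zero j
  | insert a s ha ih =>
    rw [Finset.sum_insert ha, Finset.sum_insert ha]
    exact hY.add _ _ _ _ _ (h a (by simp)) (ih fun b hb => h b (by simp [hb]))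

/-- The sum has n terms, each bounded by a power of 1 + n because a + (n - 1 - a) ≤ n; summation
costs one more power of the weight. -/
theorem sum_range {X X' : ι → SpaceScale H} {h : ι → ℝ} {L : ι × ℕ × ℕ → H → H}
    (hh : ∀ i, 0 ≤ h i) (hX' : ∀ i, (X' i).Regular)
    (hL : OrdBd (fun i : ι × ℕ × ℕ => X i.1) (fun i => X' i.1) (fun i => 1 + i.2.1 + i.2.2)
      (fun i => h i.1) m p L) :
    OrdBd (fun i : ι × ℕ => X i.1) (fun i => X' i.1) (fun i => 1 + i.2) (fun i => h i.1) m p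
      (fun i u => ∑ a ∈ Finset.range i.2, L (i.1, a, i.2 - 1 - a) u) := by
  intro j j' hj
  obtain ⟨C, hC, M, hT⟩ := hL j j' hj
  have hT' : ∀ (i : ι) (a b : ℕ), ∃ T : (X i).Sp j →L[ℂ] (X' i).Sp j',
    (∀ u ∈ (X i).inf, ∀ x, (X i).rep j u x → (X' i).rep j' (L (i, a, b) u) (T x)) ∧
    ‖T‖ ≤ C * (1 + a + b) ^ M * h i ^ p := fun i a b => hT (i, a, b)
  choose T h1 h2 using hT'
  refine ⟨C, hC, M + 1, fun i => ⟨∑ a ∈ Finset.range i.2, T i.1 a (i.2 - 1 - a),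
    fun u hu x hx => ?_, ?_⟩⟩
  · rw [sum_apply]
    exact rep_sum (hX' i.1) _ _ _ _ fun a _ => h1 i.1 a (i.2 - 1 - a) u hu x hx
  · have hi := hh i.1
    calc ‖∑ a ∈ Finset.range i.2, T i.1 a (i.2 - 1 - a)‖
        ≤ ∑ a ∈ Finset.range i.2, C * (1 + (i.2 : ℝ)) ^ M * h i.1 ^ p := by
          refine norm_sum_le_of_le _ fun a ha => (h2 i.1 a (i.2 - 1 - a)).trans ?_
          have ha' : a < i.2 := Finset.mem_range.1 ha
          have : (a : ℝ) + ((i.2 - 1 - a : ℕ) : ℝ) ≤ i.2 := by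
            exact_mod_cast (by omega : a + (i.2 - 1 - a) ≤ i.2)
          have e : 1 + (a : ℝ) + ((i.2 - 1 - a : ℕ) : ℝ) ≤ 1 + i.2 := by linarith
          gcongr
      _ = C * ((1 + (i.2 : ℝ)) ^ M * i.2) * h i.1 ^ p := by simp; ring
      _ ≤ C * (1 + (i.2 : ℝ)) ^ (M + 1) * h i.1 ^ p := by
          rw [pow_succ]
          gcongr
          linarith

/-- Rapid decay of the coefficients absorbs any polynomial weight, whatever its degree at level j.
The extended series converges in operator norm, and closedness of the identification relation shows
that its sum represents the sum taken in H. -/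
theorem tsum {X X' : ι → SpaceScale H} {h : ι → ℝ} {L : ι × ℕ → H → H} {L' : ι → H → H}
    (hh : ∀ i, 0 ≤ h i) (hX' : ∀ i, (X' i).Regular)
    (hL : OrdBd (fun i : ι × ℕ => X i.1) (fun i => X' i.1) (fun i => 1 + i.2)
      (fun i => h i.1) m p L) {c : ℕ → ℂ}
    (hc : ∀ M : ℕ, Summable fun n => ‖c n‖ * (1 + (n : ℝ)) ^ M)
    (hL' : ∀ i u, HasSum (fun n => c n • L (i, n) u) (L' i u)) :
    OrdBd X X' (fun _ => 1) h m p L' := by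
  intro j j' hj
  obtain ⟨C, hC, M, hT⟩ := hL j j' hj
  have hT' : ∀ (i : ι) (n : ℕ), ∃ T : (X i).Sp j →L[ℂ] (X' i).Sp j',
    (∀ u ∈ (X i).inf, ∀ x, (X i).rep j u x → (X' i).rep j' (L (i, n) u) (T x)) ∧
    ‖T‖ ≤ C * (1 + n) ^ M * h i ^ p := fun i n => hT (i, n)
  choose T h1 h2 using hT'
  refine ⟨C * ∑' n, ‖c n‖ * (1 + (n : ℝ)) ^ M,
    mul_nonneg hC (tsum_nonneg fun n => by positivity), 0, fun i => ?_⟩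
  have := (hX' i).complete j'
  have hi := hh i
  have hb : ∀ n, ‖c n • T i n‖ ≤ C * (‖c n‖ * (1 + (n : ℝ)) ^ M) * h i ^ p := fun n => by
    rw [norm_smul]
    calc _ ≤ ‖c n‖ * (C * (1 + (n : ℝ)) ^ M * h i ^ p) := by gcongr; exact h2 i n
      _ = _ := by ring
  have hs : HasSum (fun n => C * (‖c n‖ * (1 + (n : ℝ)) ^ M) * h i ^ p)
      (C * (∑' n, ‖c n‖ * (1 + (n : ℝ)) ^ M) * h i ^ p) :=
    ((hc M).hasSum.mul_left C).mul_right _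
  have hsum : Summable fun n => c n • T i n := Summable.of_norm_bounded hs.summable hb
  refine ⟨∑' n, c n • T i n, fun u hu x hx => ?_, ?_⟩
  · have e1 := (hL' i u).tendsto_sum_nat
    have e2 : HasSum (fun n => (c n • T i n) x) ((∑' n, c n • T i n) x) :=
      hsum.hasSum.mapL (ContinuousLinearMap.apply ℂ _ x)
    exact (hX' i).closed j' _ _ _ _ (fun n => rep_sum (hX' i) _ _ _ _ fun a _ =>
      (hX' i).smul _ _ _ _ (h1 i a u hu x hx)) e1 e2.tendsto_sum_nat
  · rw [one_pow, mul_one]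
    exact tsum_of_norm_bounded hs hb

end OrdBd

/-- All iterated commutators with `R` of length at most `N` have the order and the size that are
typical of pseudodifferential operators: `ad_R^n L` is of order `m - n`, with bound `h^(p + n)`. -/
def CommBd {H : Type u} [NormedAddCommGroup H] [InnerProductSpace ℂ H] {ι : Type*} (N : ℕ)
    (R : ι → H →L[ℂ] H) (X X' : ι → SpaceScale H) (w h : ι → ℝ) (m : ℤ) (p : ℕ)
    (L : ι → H → H) : Prop :=
  ∀ n ≤ N, OrdBd X X' w h (m - n) (p + n) (fun i => adPow (R i) (L i) n)

namespace CommBd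

variable {H : Type u} [NormedAddCommGroup H] [InnerProductSpace ℂ H] {ι ι' : Type*} {N : ℕ}
  {R : ι → H →L[ℂ] H} {X X' X'' : ι → SpaceScale H} {w h : ι → ℝ} {m m' : ℤ}
  {p p' : ℕ} {L L' : ι → H → H}

theorem ordBd (hL : CommBd N R X X' w h m p L) : OrdBd X X' w h m p L :=
  (hL 0 (Nat.zero_le _)).cast (by simp) rfl

theorem of_ordBd (hL : OrdBd X X' w h m p L) : CommBd 0 R X X' w h m p L := by
  intro n hn
  obtain rfl : n = 0 := by omega
  exact hL.cast (by simp) rfl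

theorem mono_length {N' : ℕ} (hN : N' ≤ N) (hL : CommBd N R X X' w h m p L) :
    CommBd N' R X X' w h m p L := fun n hn => hL n (hn.trans hN)

theorem cast (hL : CommBd N R X X' w h m p L) (hm : m = m') (hp : p = p') :
    CommBd N R X X' w h m' p' L := by
  subst hm hp; exact hL

theorem comm (hL : CommBd (N + 1) R X X' w h m p L) :
    CommBd N R X X' w h (m - 1) (p + 1) (fun i u => R i (L i u) - L i (R i u)) := by
  intro n hn
  have := hL (n + 1) (by omega)
  simp only [adPow_succ_eq] at this
  exact this.cast (by push_cast; ring) (by ring)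

/-- Together with `comm` this makes the length of the commutators accessible to induction: ad_R L is
treated as a new operator, of order one lower and with one more factor h, rather than taking one
more commutator on the outside. -/
theorem of_comm (hL : OrdBd X X' w h m p L)
    (hc : CommBd N R X X' w h (m - 1) (p + 1) (fun i u => R i (L i u) - L i (R i u))) :
    CommBd (N + 1) R X X' w h m p L := by
  intro n hn
  cases n with
  | zero => exact hL.cast (by simp) rfl
  | succ n =>
    have := hc n (by omega)
    simp only [adPow_succ_eq]
    exact this.cast (by push_cast; ring) (by ring)

theorem congr (hR : ∀ i, Set.MapsTo (R i) (X i).inf (X i).inf)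
    (hL : CommBd N R X X' w h m p L) (e : ∀ i, Set.EqOn (L i) (L' i) (X i).inf) :
    CommBd N R X X' w h m p L' := fun n hn =>
  (hL n hn).congr fun i => adPow_congr (hR i) (e i) n

theorem smul (hX' : ∀ i, (X' i).Regular) (c : ℂ) (hL : CommBd N R X X' w h m p L) :
    CommBd N R X X' w h m p (fun i u => c • L i u) := fun n hn => by
  have := (hL n hn).smul hX' c
  simpa only [adPow_smul] using this

theorem add (hw : ∀ i, 1 ≤ w i) (hh : ∀ i, 0 ≤ h i)
    (hX' : ∀ i, (X' i).Regular) (hL : CommBd N R X X' w h m p L)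
    (hL' : CommBd N R X X' w h m p L') :
    CommBd N R X X' w h m p (fun i u => L i u + L' i u) := fun n hn => by
  have := (hL n hn).add hw hh hX' (hL' n hn)
  simpa only [adPow_add] using this

theorem comap (hL : CommBd N R X X' w h m p L) (g : ι' → ι) {w' : ι' → ℝ} (hw : ∀ i, 1 ≤ w i)
    (hh : ∀ i, 0 ≤ h i) (hw' : ∀ i, w (g i) ≤ w' i) :
    CommBd N (fun i => R (g i)) (fun i => X (g i)) (fun i => X' (g i)) w' (fun i => h (g i)) m p
      (fun i => L (g i)) :=
  fun n hn => (hL n hn).comap g hw hh hw'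

/-- Only the Leibniz rule ad(LL') = (ad L)L' + L(ad L') is needed. Each summand contains one
commutator already taken, so the induction hypothesis applies to both; no binomial expansion
appears. -/
theorem comp (hw : ∀ i, 1 ≤ w i) (hh : ∀ i, 0 ≤ h i)
    (hX' : ∀ i, (X' i).Regular) (hX'' : ∀ i, (X'' i).Regular)
    (hR : ∀ i, Set.MapsTo (R i) (X i).inf (X i).inf)
    (hR' : ∀ i, Set.MapsTo (R i) (X' i).inf (X' i).inf)
    (hL : CommBd N R X' X'' w h m p L) (hL' : CommBd N R X X' w h m' p' L') :
    CommBd N R X X'' w h (m + m') (p + p') (fun i u => L i (L' i u)) := by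
  induction N generalizing m m' p p' L L' with
  | zero => exact of_ordBd (hL.ordBd.comp hw hh hL'.ordBd)
  | succ N ih =>
    refine of_comm (hL.ordBd.comp hw hh hL'.ordBd) ?_
    have h1 := ih hL.comm (hL'.mono_length (Nat.le_succ N))
    have h2 := ih (hL.mono_length (Nat.le_succ N)) hL'.comm
    refine ((h1.cast (by ring) (by ring)).add hw hh hX''
      (h2.cast (by ring) (by ring))).congr hR fun i u hu => ?_
    have e := (hL.ordBd.map_sub hX' hX'' i (hR' i (hL'.ordBd.mapsTo i hu))
      (hL'.ordBd.mapsTo i (hR i hu))).2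
    simp only [e]
    abel

/-- Raising the order along an inclusion. -/
theorem mono (hw : ∀ i, 1 ≤ w i) (hh : ∀ i, 0 ≤ h i)
    (hX' : OrdBd X' X'' w h (m' - m) 0 (fun _ u => u)) (hL : CommBd N R X X' w h m p L) :
    CommBd N R X X'' w h m' p L := fun n hn =>
  (hX'.comp hw hh (hL n hn)).cast (by ring) (by simp)

theorem sum_range {X X' : ι → SpaceScale H} {h : ι → ℝ} {L : ι × ℕ × ℕ → H → H}
    (hh : ∀ i, 0 ≤ h i) (hX' : ∀ i, (X' i).Regular)
    (hL : CommBd N (fun i : ι × ℕ × ℕ => R i.1) (fun i : ι × ℕ × ℕ => X i.1) (fun i => X' i.1)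
      (fun i => 1 + i.2.1 + i.2.2) (fun i => h i.1) m p L) :
    CommBd N (fun i : ι × ℕ => R i.1) (fun i : ι × ℕ => X i.1) (fun i => X' i.1)
      (fun i => 1 + i.2) (fun i => h i.1) m p
      (fun i u => ∑ a ∈ Finset.range i.2, L (i.1, a, i.2 - 1 - a) u) := fun n hn => by
  have := (hL n hn).sum_range hh hX'
  simpa only [adPow_sum] using this

theorem tsum {X X' : ι → SpaceScale H} {h : ι → ℝ} {L : ι × ℕ → H → H} {L' : ι → H → H}
    (hh : ∀ i, 0 ≤ h i) (hX' : ∀ i, (X' i).Regular)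
    (hL : CommBd N (fun i : ι × ℕ => R i.1) (fun i : ι × ℕ => X i.1) (fun i => X' i.1)
      (fun i => 1 + i.2) (fun i => h i.1) m p L) {c : ℕ → ℂ}
    (hc : ∀ M : ℕ, Summable fun n => ‖c n‖ * (1 + (n : ℝ)) ^ M)
    (hL' : ∀ i u, HasSum (fun n => c n • L (i, n) u) (L' i u)) :
    CommBd N R X X' (fun _ => 1) h m p L' := fun n hn =>
  (hL n hn).tsum hh hX' hc fun i u => by
    have := hasSum_adPow (R i) (hL' i) n u
    simpa only [adPow_smul] using this

/-- Commutators of the inverse of an operator, from `ad G = - G (ad E) G`. -/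
theorem inverse {Y W : ι → SpaceScale H} (hw : ∀ i, 1 ≤ w i) (hh : ∀ i, 0 ≤ h i)
    (hY : ∀ i, (Y i).Regular) (hW : ∀ i, (W i).Regular)
    (hRY : ∀ i, Set.MapsTo (R i) (Y i).inf (Y i).inf)
    (hRW : ∀ i, Set.MapsTo (R i) (W i).inf (W i).inf) {E G : ι → H → H}
    (hE : CommBd N R W Y w h m 0 E) (hG : OrdBd Y W w h (-m) 0 G)
    (hEG : ∀ i, ∀ u ∈ (Y i).inf, E i (G i u) = u) (hGE : ∀ i, ∀ u ∈ (W i).inf, G i (E i u) = u) :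
    CommBd N R Y W w h (-m) 0 G := by
  induction N with
  | zero => exact of_ordBd hG
  | succ N ih =>
    refine of_comm hG ?_
    have ih := ih (hE.mono_length (Nat.le_succ N))
    -- Order count for -G (ad E) G: -m + (m - 1) - m = -m - 1. The bounds for G used here are one
    -- commutator shorter than those being proved.
    have h1 := (hE.comm.comp hw hh hW hY hRY hRW ih)
    have h2 := (ih.comp hw hh hY hW hRY hRY h1).smul hW (-1)
    refine (h2.cast (by ring) (by ring)).congr hRY fun i u hu => ?_
    have a1 : G i u ∈ (W i).inf := hG.mapsTo i hu
    have a2 : E i (R i (G i u)) ∈ (Y i).inf := hE.ordBd.mapsTo i (hRW i a1)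
    rw [hEG i u hu, (hG.map_sub hY hW i (hRY i hu) a2).2, hGE i _ (hRW i a1)]
    simp

end CommBd

/-! ### Separated operators -/

section Separation

variable {H : Type u} [NormedAddCommGroup H] [InnerProductSpace ℂ H] {ι : Type*} {N : ℕ}
  {R A B : ι → H →L[ℂ] H} {X X' : ι → SpaceScale H} {w h : ι → ℝ} {m : ℤ} {L : ι → H → H}

/-- If `A (1 - R)` and `R B` are negligible, then so is `A L B`. -/
theorem CommBd.separated (hw : ∀ i, 1 ≤ w i) (hh : ∀ i, 0 ≤ h i) (hX' : ∀ i, (X' i).Regular)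
    (incl : ∀ d : ℕ, OrdBd X' X' w h d 0 fun _ u => u)
    (hL : CommBd N R X X' w h m 0 L)
    (hA : OrdBd X' X' w h 0 0 fun i u => A i u)
    (hA' : ∀ n, OrdBd X' X' w h 0 n fun i u => A i (u - R i u))
    (hB : OrdBd X X w h 0 0 fun i u => B i u)
    (hB' : ∀ n, OrdBd X X w h 0 n fun i u => R i (B i u)) :
    OrdBd X X' w h m N fun i u => A i (L i (B i u)) := by
  -- Downward induction on n, with X = ad_R^n L and AXB = A(1-R)XB + AX(RB) + A(ad_R X)B. Since X
  -- already carries h^n, the separation hypotheses are used with the exponent N - n. The n orders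
  -- gained by X are given up through the inclusion, because only the power of h matters.
  have key : ∀ n ≤ N, OrdBd X X' w h m N fun i u => A i (adPow (R i) (L i) n (B i u)) := by
    intro n hn
    induction hn using Nat.decreasingInduction with
    | self =>
      have h1 := hA.comp hw hh (((incl N).comp hw hh (hL N le_rfl)).comp hw hh hB)
      exact h1.cast (by ring) (by ring)
    | of_succ n hn ih =>
      have h0 := (incl n).comp hw hh (hL n hn.le)
      have h1 := ((hA' (N - n)).comp hw hh (h0.comp hw hh hB)).cast (m' := m) (p' := N)
        (by ring) (by omega)
      have h2 := (hA.comp hw hh (h0.comp hw hh (hB' (N - n)))).cast (m' := m) (p' := N)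
        (by ring) (by omega)
      refine ((h1.add hw hh hX' h2).add hw hh hX' ih).congr fun i u hu => ?_
      simp only [adPow, map_sub]
      abel
  exact key 0 (Nat.zero_le N)

end Separation

/-! ### Powers -/

section Powers

variable {H : Type u} [NormedAddCommGroup H] [InnerProductSpace ℂ H] {ι : Type*}
  {R G : ι → H →L[ℂ] H} {Y : ι → SpaceScale H} {h : ι → ℝ} {c : ℂ}

/-- The operators `U i ^ n` act on the `j`-th spaces with bounds that are polynomial in `n`. -/
def PowBd (Y : ι → SpaceScale H) (U : ι → H →L[ℂ] H) (j : ℤ) : Prop :=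
  ∃ C : ℝ, 0 ≤ C ∧ ∃ M : ℕ, ∀ i, ∀ n : ℕ, ∃ T : (Y i).Sp j →L[ℂ] (Y i).Sp j,
    (∀ u ∈ (Y i).inf, ∀ x, (Y i).rep j u x → (Y i).rep j ((U i ^ n) u) (T x)) ∧
    ‖T‖ ≤ C * (1 + (n : ℝ)) ^ M

/-- Transfers bounds from level j to level j + m: A brings level j + m to level j, the known powers
act there, and B returns. Summing over a < n raises the polynomial degree by one. -/
theorem PowBd.step {U : ι → H →L[ℂ] H} (hY : ∀ i, (Y i).Regular)
    (hinf : ∀ i n, Set.MapsTo (U i ^ n : H →L[ℂ] H) (Y i).inf (Y i).inf)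
    {j j' m : ℤ} (hj : j + m = j') {A B : ι → H → H}
    (hA : OrdBd Y Y (fun _ => 1) h m 0 A) (hB : OrdBd Y Y (fun _ => 1) h (-m) 0 B)
    (hU : ∀ i n, ∀ u ∈ (Y i).inf,
      (U i ^ n) u = u + c • ∑ a ∈ Finset.range n, B i ((U i ^ a) (A i u)))
    (h0 : PowBd Y U j) : PowBd Y U j' := by
  obtain ⟨CA, hCA, MA, hTA⟩ := hA j' j hj
  obtain ⟨CB, hCB, MB, hTB⟩ := hB j j' (by rw [← hj]; ring)
  obtain ⟨C, hC, M, hT⟩ := h0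
  choose TA hA1 hA2 using hTA
  choose TB hB1 hB2 using hTB
  choose T h1 h2 using hT
  refine ⟨1 + ‖c‖ * (CB * C * CA), by positivity, M + 1, fun i n =>
    ⟨ContinuousLinearMap.id ℂ ((Y i).Sp j') + c • ∑ a ∈ Finset.range n, TB i ∘L T i a ∘L TA i,
      fun u hu x hx => ?_, ?_⟩⟩
  · rw [hU i n u hu]
    have : (ContinuousLinearMap.id ℂ ((Y i).Sp j') + c • ∑ a ∈ Finset.range n, TB i ∘L T i a ∘L TA i) x
        = x + c • ∑ a ∈ Finset.range n, TB i (T i a (TA i x)) := by simp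
    rw [this]
    refine (hY i).add _ _ _ _ _ hx ((hY i).smul _ _ _ _ (OrdBd.rep_sum (hY i) _ _ _ _ ?_))
    intro a _
    have e := hA.mapsTo i hu
    exact hB1 i _ (hinf i a e) _ (h1 i a _ e _ (hA1 i u hu x hx))
  · have hA2 := hA2 i
    have hB2 := hB2 i
    simp only [one_pow, mul_one, pow_zero] at hA2 hB2
    have hn : (1 : ℝ) ≤ 1 + n := by simp
    have hs : ‖∑ a ∈ Finset.range n, TB i ∘L T i a ∘L TA i‖
        ≤ ∑ a ∈ Finset.range n, CB * C * CA * (1 + (n : ℝ)) ^ M := by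
      refine norm_sum_le_of_le _ fun a ha => ?_
      have ha' : (a : ℝ) ≤ n := by exact_mod_cast (Finset.mem_range.1 ha).le
      calc ‖TB i ∘L T i a ∘L TA i‖ ≤ ‖TB i‖ * (‖T i a‖ * ‖TA i‖) :=
            ((TB i).opNorm_comp_le _).trans (by gcongr; exact (T i a).opNorm_comp_le _)
        _ ≤ CB * ((C * (1 + (a : ℝ)) ^ M) * CA) := by gcongr; exact h2 i a
        _ ≤ CB * ((C * (1 + (n : ℝ)) ^ M) * CA) := by gcongr
        _ = _ := by ring
    rw [Finset.sum_const, Finset.card_range, nsmul_eq_mul] at hs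
    have hp : (1 : ℝ) ≤ (1 + (n : ℝ)) ^ (M + 1) := one_le_pow₀ hn
    calc _ ≤ ‖ContinuousLinearMap.id ℂ ((Y i).Sp j')‖
          + ‖c‖ * ‖∑ a ∈ Finset.range n, TB i ∘L T i a ∘L TA i‖ :=
          (norm_add_le _ _).trans (by rw [norm_smul])
      _ ≤ 1 * (1 + (n : ℝ)) ^ (M + 1) + ‖c‖ * ((1 + n) * (CB * C * CA * (1 + (n : ℝ)) ^ M)) := by
        gcongr
        · exact ContinuousLinearMap.norm_id_le.trans (by linarith)
        · exact hs.trans (by gcongr; linarith)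
      _ = _ := by ring

theorem one_add_smul_pow_eq {E : Type*} [Ring E] [Algebra ℂ E] (G : E) (n : ℕ) :
    (1 + c • G) ^ n = 1 + c • ∑ a ∈ Finset.range n, G * (1 + c • G) ^ a := by
  induction n with
  | zero => simp
  | succ n ih =>
    rw [Finset.sum_range_succ, smul_add, ← add_assoc, ← ih, pow_succ', add_mul, one_mul,
      smul_mul_assoc]

/-- Starting from level 0, every integer level is reached one unit at a time by the geometric sum
U^n = 1 + c Σ G U^a. Upwards G stands on the left, to regain the regularity given up by the
inclusion; downwards G stands on the right. -/
theorem OrdBd.one_add_smul_pow (hY : ∀ i, (Y i).Regular)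
    (incl : ∀ d : ℕ, OrdBd Y Y (fun _ => 1) h d 0 fun _ u => u)
    (hh : ∀ i, 0 ≤ h i)
    (hG : OrdBd Y Y (fun _ => 1) h (-2) 0 fun i u => G i u)
    (h0 : PowBd Y (fun i => 1 + c • G i) 0) :
    OrdBd (fun i : ι × ℕ => Y i.1) (fun i => Y i.1) (fun i => 1 + i.2) (fun i => h i.1) 0 0
      (fun i u => ((1 + c • G i.1) ^ i.2) u) := by
  have hG1 : OrdBd Y Y (fun _ => 1) h (-1) 0 fun i u => G i u :=
    ((incl 1).comp (fun _ => le_rfl) hh hG).cast (by norm_num) (by simp)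
  have hinf1 : ∀ i, Set.MapsTo (1 + c • G i : H →L[ℂ] H) (Y i).inf (Y i).inf := fun i u hu =>
    (hG.map_add hY hY i hu (hG.map_smul hY hY i c (hG.mapsTo i hu)).1).1
  have hinf : ∀ i n, Set.MapsTo ((1 + c • G i) ^ n : H →L[ℂ] H) (Y i).inf (Y i).inf := by
    intro i n
    induction n with
    | zero => exact fun u hu => hu
    | succ n ih =>
      intro u hu
      rw [pow_succ]
      exact ih (hinf1 i hu)
  have all : ∀ j, PowBd Y (fun i => 1 + c • G i) j := by
    intro j
    induction j using Int.induction_on with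
    | zero => exact h0
    | succ j ih =>
      refine ih.step (c := c) hY hinf rfl (incl 1) hG1 fun i n u hu => ?_
      conv_lhs => rw [one_add_smul_pow_eq]
      simp
    | pred j ih =>
      refine ih.step (c := c) (m := -1) hY hinf rfl hG1 ((incl 1).cast (by simp) rfl)
        fun i n u hu => ?_
      conv_lhs => rw [one_add_smul_pow_eq]
      have : ∀ a, G i * (1 + c • G i) ^ a = (1 + c • G i) ^ a * G i := fun a =>
        (((Commute.one_left _).add_left ((Commute.refl _).smul_left c)).pow_left a).symm
      simp only [this]
      simp
  intro j j' hj
  obtain rfl : j' = j := by simpa using hj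
  obtain ⟨C, hC, M, hT⟩ := all j'
  refine ⟨C, hC, M, fun i => ?_⟩
  obtain ⟨T, h1, h2⟩ := hT i.1 i.2
  exact ⟨T, h1, by simpa using h2⟩

theorem commutator_pow {E : Type*} [Ring E] (R U : E) (n : ℕ) :
    R * U ^ n - U ^ n * R =
      ∑ a ∈ Finset.range n, U ^ a * ((R * U - U * R) * U ^ (n - 1 - a)) := by
  induction n with
  | zero => simp
  | succ n ih =>
    rw [Finset.sum_range_succ]
    have : ∀ a ∈ Finset.range n, U ^ a * ((R * U - U * R) * U ^ (n + 1 - 1 - a))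
        = U ^ a * ((R * U - U * R) * U ^ (n - 1 - a)) * U := by
      intro a ha
      have ha' := Finset.mem_range.1 ha
      rw [show n + 1 - 1 - a = (n - 1 - a) + 1 by omega, pow_succ]
      simp only [mul_assoc]
    rw [Finset.sum_congr rfl this, ← Finset.sum_mul, ← ih]
    simp only [pow_succ, add_tsub_cancel_right, tsub_self, pow_zero, mul_one, mul_sub, sub_mul,
      mul_assoc]
    abel

/-- The iterated commutators of `(1 + c G)^n` are of size polynomial in `n`. -/
theorem CommBd.one_add_smul_pow {N : ℕ} (hY : ∀ i, (Y i).Regular)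
    (incl : ∀ d : ℕ, OrdBd Y Y (fun _ => 1) h d 0 fun _ u => u)
    (hh : ∀ i, 0 ≤ h i) (hR : ∀ i, Set.MapsTo (R i) (Y i).inf (Y i).inf)
    (hG : CommBd N R Y Y (fun _ => 1) h (-2) 0 fun i u => G i u)
    (h0 : PowBd Y (fun i => 1 + c • G i) 0) :
    CommBd N (fun i : ι × ℕ => R i.1) (fun i : ι × ℕ => Y i.1) (fun i => Y i.1)
      (fun i => 1 + i.2) (fun i => h i.1) 0 0 (fun i u => ((1 + c • G i.1) ^ i.2) u) := by
  have hU := OrdBd.one_add_smul_pow hY incl hh hG.ordBd h0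
  induction N with
  | zero => exact of_ordBd hU
  | succ N ih =>
    refine of_comm hU ?_
    have ih := ih (hG.mono_length (Nat.le_succ N))
    have h1 := hG.comm.smul hY c
    -- ad_R G has order -3, but order -1 is all that a commutator of an operator of order 0 needs.
    have h2 := h1.mono (m' := -1) (fun _ => le_rfl) hh ((incl 2).cast (by norm_num) rfl)
    have hw : ∀ i : ι × ℕ × ℕ, (1 : ℝ) ≤ 1 + i.2.1 + i.2.2 := fun i => by
      have : (0 : ℝ) ≤ (i.2.1 : ℝ) + i.2.2 := by positivity
      linarith
    -- In ad_R U^n = Σ U^a (c ad_R G) U^(n-1-a) the exponents of the two powers become separate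
    -- indices, with weight 1 + a + b.
    have h3 := h2.comap (ι' := ι × ℕ × ℕ) Prod.fst (w' := fun i => 1 + i.2.1 + i.2.2)
      (fun _ => le_rfl) hh hw
    have h4 := ih.comap (ι' := ι × ℕ × ℕ) (fun i => (i.1, i.2.1))
      (w' := fun i => 1 + i.2.1 + i.2.2) (fun i => by simp) (fun i => hh i.1) (fun i => by simp)
    have h5 := ih.comap (ι' := ι × ℕ × ℕ) (fun i => (i.1, i.2.2))
      (w' := fun i => 1 + i.2.1 + i.2.2) (fun i => by simp) (fun i => hh i.1) (fun i => by simp)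
    have h6 := h4.comp hw (fun i => hh i.1) (fun i => hY i.1) (fun i => hY i.1) (fun i => hR i.1)
      (fun i => hR i.1) (h3.comp hw (fun i => hh i.1) (fun i => hY i.1) (fun i => hY i.1)
        (fun i => hR i.1) (fun i => hR i.1) h5)
    have h7 := (h6.cast (m' := 0 - 1) (p' := 0 + 1) (by norm_num) (by norm_num)).sum_range hh hY
    refine h7.congr (fun i => hR i.1) fun i u hu => ?_
    have e := DFunLike.congr_fun (commutator_pow (R i.1) (1 + c • G i.1) i.2) u
    rw [sum_apply] at e
    refine Eq.trans (Finset.sum_congr rfl fun a _ => ?_) e.symm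
    set v := ((1 + c • G i.1) ^ (i.2 - 1 - a)) u with hv
    change ((1 + c • G i.1) ^ a) (c • (R i.1 (G i.1 v) - G i.1 (R i.1 v))) =
      ((1 + c • G i.1) ^ a) (R i.1 ((1 + c • G i.1) v) - (1 + c • G i.1) (R i.1 v))
    congr 1
    simp [smul_sub]

end Powers

/-! ### Expansion of Schwartz functions in powers of `(x + i) / (x - i)` -/

open Real in
/-- The transplantation of `f` to the circle by `x = cot (π θ)`, with value `0` at `x = ∞`. -/
noncomputable def circleFun (f : ℝ → ℂ) (θ : ℝ) : ℂ :=
  if sin (π * θ) = 0 then 0 else f (cos (π * θ) / sin (π * θ))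

/-- The operator `-π (1 + x²) d/dx`, which is `d/dθ` for `x = cot (π θ)`. -/
noncomputable def circleDeriv (f : 𝓢(ℝ, ℂ)) : 𝓢(ℝ, ℂ) :=
  SchwartzMap.smulLeftCLM ℂ (fun x : ℝ => -Real.pi * (1 + x ^ 2)) (SchwartzMap.derivCLM ℝ ℂ f)

theorem circleDeriv_apply (f : 𝓢(ℝ, ℂ)) (x : ℝ) :
    circleDeriv f x = (-Real.pi * (1 + x ^ 2)) • deriv f x := by
  rw [circleDeriv, SchwartzMap.smulLeftCLM_apply_apply (by fun_prop)]
  rfl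

theorem circleFun_norm_le (f : 𝓢(ℝ, ℂ)) : ∃ C, 0 ≤ C ∧ ∀ θ, ‖circleFun f θ‖ ≤ C := by
  obtain ⟨C, hC, h⟩ := f.decay 0 0
  refine ⟨C, hC.le, fun θ => ?_⟩
  unfold circleFun
  split_ifs
  · simpa using hC.le
  · simpa using h _

open Real in
-- The derivative is again the transplant of a Schwartz function, so this single statement yields
-- all derivatives on the circle. The point x = ∞ is the only delicate one; there the decay of f
-- decides.
theorem hasDerivAt_circleFun (f : 𝓢(ℝ, ℂ)) (θ : ℝ) :
    HasDerivAt (circleFun f) (circleFun (circleDeriv f) θ) θ := by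
  by_cases hs : sin (π * θ) = 0
  · have h1 : circleFun (circleDeriv f) θ = 0 := by simp [circleFun, hs]
    have h2 : circleFun f θ = 0 := by simp [circleFun, hs]
    obtain ⟨C, hC, hb⟩ := f.decay 2 0
    obtain ⟨C', hC', hb'⟩ := f.decay 0 0
    -- With x = cot(πy), sin²(πy) = 1/(1 + x²). Decay of f of second order thus makes the transplant
    -- quadratically small at a zero of the sine, and its derivative there vanishes.
    have key : ∀ y, ‖circleFun f y‖ ≤ (C + C') * sin (π * y) ^ 2 := by
      intro y
      unfold circleFun
      split_ifs with h
      · simp [h]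
      · have e1 := hb (cos (π * y) / sin (π * y))
        have e2 := hb' (cos (π * y) / sin (π * y))
        simp only [norm_iteratedFDeriv_zero, pow_zero, one_mul, Real.norm_eq_abs, sq_abs,
          div_pow] at e1 e2
        have hpos : 0 < sin (π * y) ^ 2 := by positivity
        rw [div_mul_eq_mul_div, div_le_iff₀ hpos] at e1
        have e3 := mul_le_mul_of_nonneg_right e2 hpos.le
        have e4 := sin_sq_add_cos_sq (π * y)
        set F := ‖f (cos (π * y) / sin (π * y))‖
        calc F = cos (π * y) ^ 2 * F + F * sin (π * y) ^ 2 := by linear_combination (-F) * e4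
          _ ≤ _ := by linarith
    rw [h1, hasDerivAt_iff_isLittleO, h2]
    refine Asymptotics.IsBigO.trans_isLittleO (g := fun y : ℝ => ‖y - θ‖ ^ 2) ?_
      (Asymptotics.isLittleO_pow_sub_sub θ one_lt_two)
    refine Asymptotics.IsBigO.of_bound ((C + C') * π ^ 2) (Filter.Eventually.of_forall fun y => ?_)
    have e : |sin (π * y)| ≤ π * |y - θ| := by
      have := Real.lipschitzWith_sin.dist_le_mul (π * y) (π * θ)
      rw [Real.dist_eq, Real.dist_eq, hs, sub_zero, ← mul_sub, abs_mul, abs_of_pos pi_pos] at this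
      simpa using this
    have e' : sin (π * y) ^ 2 ≤ (π * |y - θ|) ^ 2 := by
      rw [← sq_abs]; gcongr
    calc _ = ‖circleFun f y‖ := by simp
      _ ≤ (C + C') * sin (π * y) ^ 2 := key y
      _ ≤ (C + C') * (π * |y - θ|) ^ 2 := by gcongr
      _ = _ := by rw [Real.norm_of_nonneg (by positivity), Real.norm_eq_abs]; ring
  · have hd : HasDerivAt (fun y => cos (π * y) / sin (π * y))
        (-π * (1 + (cos (π * θ) / sin (π * θ)) ^ 2)) θ := by
      have h0 : HasDerivAt (fun y : ℝ => π * y) π θ := by simpa using (hasDerivAt_id θ).const_mul π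
      refine (h0.cos.div h0.sin hs).congr_deriv ?_
      field_simp
      ring
    have h1 := (f.hasDerivAt (cos (π * θ) / sin (π * θ))).scomp θ hd
    have h2 : circleFun (circleDeriv f) θ = (-π * (1 + (cos (π * θ) / sin (π * θ)) ^ 2)) •
        deriv f (cos (π * θ) / sin (π * θ)) := by
      simp only [circleFun, hs, if_false, circleDeriv_apply]
    rw [h2]
    refine h1.congr_of_eventuallyEq ?_
    have : ∀ᶠ y in nhds θ, sin (π * y) ≠ 0 :=
      (by fun_prop : Continuous fun y => sin (π * y)).continuousAt.eventually_ne hs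
    filter_upwards [this] with y hy
    simp [circleFun, hy]

theorem circleFun_zero_one (f : ℝ → ℂ) : circleFun f 0 = 0 ∧ circleFun f (0 + 1) = 0 := by
  simp [circleFun]

/-- The Fourier coefficients of `circleFun f`. -/
noncomputable def circleCoeff (f : 𝓢(ℝ, ℂ)) (n : ℤ) : ℂ :=
  fourierCoeffOn (lt_add_of_pos_right (0 : ℝ) (one_pos : (0 : ℝ) < 1)) (circleFun f) n

theorem continuous_circleFun (f : 𝓢(ℝ, ℂ)) : Continuous (circleFun f) :=
  continuous_iff_continuousAt.2 fun x => (hasDerivAt_circleFun f x).continuousAt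

theorem circleCoeff_norm_le (f : 𝓢(ℝ, ℂ)) : ∃ C, 0 ≤ C ∧ ∀ n, ‖circleCoeff f n‖ ≤ C := by
  obtain ⟨C, hC, hb⟩ := circleFun_norm_le f
  refine ⟨C, hC, fun n => ?_⟩
  rw [circleCoeff, fourierCoeffOn_eq_integral]
  have := intervalIntegral.norm_integral_le_of_norm_le_const (a := (0 : ℝ)) (b := 0 + 1) (C := C)
    (f := fun x : ℝ => fourier (-n) (x : AddCircle ((0 : ℝ) + 1 - 0)) • circleFun f x)
    (fun x _ => by
      rw [norm_smul, fourier_apply, Circle.norm_coe, one_mul]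
      exact hb x)
  simpa using this

/-- One integration by parts. The boundary terms vanish because both endpoints correspond to x = ∞;
the factor 1/(2π) is discarded. -/
theorem circleCoeff_succ (f : 𝓢(ℝ, ℂ)) {n : ℤ} (hn : n ≠ 0) :
    ‖circleCoeff f n‖ * |(n : ℝ)| ≤ ‖circleCoeff (circleDeriv f) n‖ := by
  have := fourierCoeffOn_of_hasDerivAt (lt_add_of_pos_right (0 : ℝ) (one_pos : (0 : ℝ) < 1)) hn
    (fun x _ => hasDerivAt_circleFun f x)
    ((continuous_circleFun (circleDeriv f)).intervalIntegrable _ _)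
  rw [(circleFun_zero_one f).1, (circleFun_zero_one f).2] at this
  have h2 : circleCoeff f n = 1 / (2 * Real.pi * Complex.I * n) * circleCoeff (circleDeriv f) n := by
    rw [circleCoeff, this, circleCoeff]
    push_cast
    ring
  have hn' : (0 : ℝ) < |(n : ℝ)| := by positivity
  rw [h2]
  simp only [norm_mul, norm_div, norm_one, Complex.norm_I, Complex.norm_real, Complex.norm_intCast,
    Complex.norm_ofNat, Real.norm_eq_abs, abs_of_pos Real.pi_pos]
  have hp : (1 : ℝ) ≤ 2 * Real.pi := by linarith [Real.two_le_pi]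
  have : 1 / (2 * Real.pi * 1 * |(n : ℝ)|) * ‖circleCoeff (circleDeriv f) n‖ * |(n : ℝ)|
      = ‖circleCoeff (circleDeriv f) n‖ / (2 * Real.pi) := by
    field_simp
  rw [this]
  exact div_le_self (norm_nonneg _) hp

theorem circleCoeff_decay (M : ℕ) (f : 𝓢(ℝ, ℂ)) :
    ∃ C, 0 ≤ C ∧ ∀ n, ‖circleCoeff f n‖ * (1 + |(n : ℝ)|) ^ M ≤ C := by
  induction M generalizing f with
  | zero => simpa using circleCoeff_norm_le f
  | succ M ih =>
    obtain ⟨C1, h1, h1'⟩ := ih f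
    obtain ⟨C2, h2, h2'⟩ := ih (circleDeriv f)
    refine ⟨C1 + C2, by positivity, fun n => ?_⟩
    rw [pow_succ, mul_add, mul_one, mul_add]
    refine add_le_add (h1' n) ?_
    rcases eq_or_ne n 0 with rfl | hn
    · simpa using h2
    · calc _ = ‖circleCoeff f n‖ * |(n : ℝ)| * (1 + |(n : ℝ)|) ^ M := by ring
        _ ≤ ‖circleCoeff (circleDeriv f) n‖ * (1 + |(n : ℝ)|) ^ M := by
          gcongr; exact circleCoeff_succ f hn
        _ ≤ C2 := h2' n

/-- Two additional powers of decay provide the summable majorant C/n², valid away from n = 0. -/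
theorem summable_circleCoeff (M : ℕ) (f : 𝓢(ℝ, ℂ)) :
    Summable fun n : ℤ => ‖circleCoeff f n‖ * (1 + |(n : ℝ)|) ^ M := by
  obtain ⟨C, hC, h⟩ := circleCoeff_decay (M + 2) f
  refine Summable.of_norm_bounded_eventually
    ((Real.summable_one_div_int_pow.2 one_lt_two).mul_left C) ?_
  rw [Filter.eventually_cofinite]
  refine (Set.finite_singleton (0 : ℤ)).subset fun n hn => ?_
  by_contra h0
  refine hn ?_
  have h0 : n ≠ 0 := h0
  have hn' : (0 : ℝ) < |(n : ℝ)| := by positivity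
  rw [Real.norm_of_nonneg (by positivity), mul_one_div, le_div_iff₀ (by positivity)]
  refine le_trans ?_ (h n)
  rw [pow_add, ← mul_assoc, ← sq_abs (n : ℝ)]
  gcongr
  linarith

open Real in
theorem hasSum_circleCoeff (f : 𝓢(ℝ, ℂ)) {z : ℂ} (hz : ‖z‖ = 1) :
    HasSum (fun n : ℤ => circleCoeff f n * z ^ n)
      (if z = 1 then 0 else f (Complex.I * (z + 1) / (z - 1)).re) := by
  let G : C(AddCircle (1 : ℝ), ℂ) := ⟨AddCircle.liftIco 1 0 (circleFun f),
    AddCircle.liftIco_continuous (by rw [(circleFun_zero_one f).1, (circleFun_zero_one f).2])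
      (continuous_circleFun f).continuousOn⟩
  have hG : ∀ n, fourierCoeff G n = circleCoeff f n := fun n =>
    fourierCoeff_liftIco_eq (T := 1) (a := 0) (circleFun f) n
  have hs : Summable (fourierCoeff G) := by
    have := (summable_circleCoeff 0 f)
    simp only [pow_zero, mul_one, ← hG] at this
    exact this.of_norm
  obtain ⟨θ, hθ, rfl⟩ : ∃ θ ∈ Set.Ico (0 : ℝ) (0 + 1), Complex.exp (2 * π * Complex.I * θ) = z := by
    refine ⟨Int.fract (Complex.arg z / (2 * π)), ⟨Int.fract_nonneg _, by
      simpa using Int.fract_lt_one (Complex.arg z / (2 * π))⟩, ?_⟩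
    have hz' := Complex.norm_mul_exp_arg_mul_I z
    rw [hz, Complex.ofReal_one, one_mul] at hz'
    conv_rhs => rw [← hz']
    rw [Complex.exp_eq_exp_iff_exists_int]
    refine ⟨-⌊Complex.arg z / (2 * π)⌋, ?_⟩
    rw [Int.fract]
    push_cast
    have : (π : ℂ) ≠ 0 := by exact_mod_cast pi_ne_zero
    field_simp
    ring
  have h1 := has_pointwise_sum_fourier_series_of_summable hs (θ : AddCircle (1 : ℝ))
  have h2 : G (θ : AddCircle (1 : ℝ)) = circleFun f θ := AddCircle.liftIco_coe_apply (f := circleFun f) hθ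
  rw [h2] at h1
  convert h1 using 1
  · funext n
    rw [hG, fourier_coe_apply, smul_eq_mul, ← Complex.exp_int_mul]
    congr 2
    simp
    ring
  -- Half-angle formulas: with α = πθ, z - 1 = 2i e^{iα} sin α and z + 1 = 2 e^{iα} cos α. Hence i(z
  -- + 1)/(z - 1) = cot α, and z = 1 exactly when sin α = 0.
  · have e : Complex.exp (2 * π * Complex.I * θ) - 1 =
        Complex.exp (Complex.I * (π * θ : ℝ)) * (2 * Complex.I * sin (π * θ)) := by
      rw [Complex.ofReal_sin, Complex.sin, show 2 * (π : ℂ) * Complex.I * θ =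
        Complex.I * (π * θ : ℝ) + Complex.I * (π * θ : ℝ) by push_cast; ring, Complex.exp_add]
      have e0 := Complex.exp_add (Complex.I * (π * θ : ℝ)) (-(Complex.I * (π * θ : ℝ)))
      rw [add_neg_cancel, Complex.exp_zero] at e0
      rw [neg_mul, mul_comm ((π * θ : ℝ) : ℂ) Complex.I]
      linear_combination (Complex.I ^ 2) * e0 + (Complex.exp (Complex.I * (π * θ : ℝ)) ^ 2 - 1) * Complex.I_sq
    have e' : Complex.exp (2 * π * Complex.I * θ) + 1 =
        Complex.exp (Complex.I * (π * θ : ℝ)) * (2 * cos (π * θ)) := by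
      rw [Complex.ofReal_cos, Complex.cos, show 2 * (π : ℂ) * Complex.I * θ =
        Complex.I * (π * θ : ℝ) + Complex.I * (π * θ : ℝ) by push_cast; ring, Complex.exp_add]
      have e0 := Complex.exp_add (Complex.I * (π * θ : ℝ)) (-(Complex.I * (π * θ : ℝ)))
      rw [add_neg_cancel, Complex.exp_zero] at e0
      rw [neg_mul, mul_comm ((π * θ : ℝ) : ℂ) Complex.I]
      linear_combination e0
    have hne := Complex.exp_ne_zero (Complex.I * (π * θ : ℝ))
    by_cases h0 : sin (π * θ) = 0
    · rw [if_pos, circleFun, if_pos h0]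
      rw [← sub_eq_zero, e, h0]; simp
    · have h0' : ((sin (π * θ) : ℝ) : ℂ) ≠ 0 := by exact_mod_cast h0
      rw [if_neg, circleFun, if_neg h0, e, e']
      · congr 1
        have : Complex.I * (Complex.exp (Complex.I * (π * θ : ℝ)) * (2 * (cos (π * θ) : ℝ)))
          / (Complex.exp (Complex.I * (π * θ : ℝ)) * (2 * Complex.I * (sin (π * θ) : ℝ)))
          = ((cos (π * θ) / sin (π * θ) : ℝ) : ℂ) := by
          rw [Complex.ofReal_div]
          field_simp
        rw [this, Complex.ofReal_re]
      · rw [← sub_eq_zero, e]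
        exact mul_ne_zero hne (mul_ne_zero (by simp) h0')

/-- For `t = (x - i)⁻¹` the number `(x + i) / (x - i) = 1 + 2 i t` lies on the unit circle. -/
theorem SchwartzMap.exists_hasSum_circle (f : 𝓢(ℝ, ℂ)) (M : ℕ) : ∃ c : ℤ → ℂ,
    (∀ K : ℕ, Summable fun n : ℤ => ‖c n‖ * (1 + |(n : ℝ)|) ^ K) ∧
    ∀ t : ℂ, ‖1 + 2 * Complex.I * t‖ = 1 →
      HasSum (fun n : ℤ => c n * ((1 + 2 * Complex.I * t) ^ n * t ^ M))
        (if t = 0 then 0 else f (t⁻¹).re) := by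
  -- The series is taken for (x - i)^M f, and the factor t^M = (x - i)^{-M} undoes the
  -- multiplication. In the functional calculus t^M becomes the M-th power of the resolvent, the
  -- source of smoothing.
  let g : 𝓢(ℝ, ℂ) := SchwartzMap.smulLeftCLM ℂ (fun x : ℝ => ((x : ℂ) - Complex.I) ^ M) f
  have hT : Function.HasTemperateGrowth (fun x : ℝ => ((x : ℂ) - Complex.I) ^ M) := by
    have : Function.HasTemperateGrowth (fun x : ℝ => (x : ℂ)) :=
      Complex.ofRealCLM.hasTemperateGrowth
    fun_prop
  have hg : ∀ x, g x = ((x : ℂ) - Complex.I) ^ M * f x := fun x =>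
    SchwartzMap.smulLeftCLM_apply_apply hT f x
  refine ⟨circleCoeff g, fun K => summable_circleCoeff K g, fun t ht => ?_⟩
  have h := (hasSum_circleCoeff g ht).mul_right (t ^ M)
  simp only [mul_assoc] at h ⊢
  convert! h using 1
  by_cases h0 : t = 0
  · simp [h0]
  · have hI := Complex.I_ne_zero
    rw [if_neg h0, if_neg (by simp [h0]), hg]
    have e1 : Complex.I * (1 + 2 * (Complex.I * t) + 1) / (1 + 2 * (Complex.I * t) - 1)
        = t⁻¹ + Complex.I := by
      field_simp
      ring
    -- The condition that 1 + 2it has modulus one says exactly, for t ≠ 0, that t⁻¹ = x - i with x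
    -- real.
    have e2 : (t⁻¹).im = -1 := by
      have e3 : Complex.normSq (1 + 2 * (Complex.I * t)) = 1 := by
        rw [← mul_assoc, Complex.normSq_eq_norm_sq, ht, one_pow]
      have e4 : Complex.normSq t ≠ 0 := by simpa using h0
      rw [Complex.inv_im, div_eq_iff e4]
      simp [Complex.normSq_apply] at e3 ⊢
      linarith
    have e5 : (((t⁻¹).re : ℂ) - Complex.I) = t⁻¹ := by
      apply Complex.ext <;> simp [e2]
    rw [e1, Complex.add_re, Complex.I_re, add_zero, e5, mul_right_comm, ← mul_pow,
      inv_mul_cancel₀ h0, one_pow, one_mul]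

/-! ### Antiduals -/

section Antidual

variable {V V' H : Type*} [NormedAddCommGroup V] [NormedSpace ℂ V] [NormedAddCommGroup V']
  [NormedSpace ℂ V'] [NormedAddCommGroup H] [InnerProductSpace ℂ H]

/-- The transpose of a bounded operator, between antidual spaces. -/
noncomputable def antidualMap (T : V →L[ℂ] V') : (V' →L⋆[ℂ] ℂ) →L[ℂ] (V →L⋆[ℂ] ℂ) :=
  LinearMap.mkContinuous
    { toFun := fun x => x.comp T
      map_add' := fun _ _ => rfl
      map_smul' := fun _ _ => rfl } ‖T‖
    fun x => (x.opNorm_comp_le T).trans (mul_comm _ _).le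

@[simp]
theorem norm_antidualMap_le (T : V →L[ℂ] V') : ‖antidualMap T‖ ≤ ‖T‖ :=
  LinearMap.mkContinuous_norm_le _ (norm_nonneg _) _

/-- The antilinear form `v ↦ (u, T v)` defined by an element `u` of a Hilbert space. -/
noncomputable def antidualEmb (T : V →L[ℂ] H) : H →L[ℂ] (V →L⋆[ℂ] ℂ) :=
  LinearMap.mkContinuous₂
    (LinearMap.mk₂'ₛₗ (RingHom.id ℂ) (starRingEnd ℂ) (fun u v => inner ℂ (T v) u)
      (fun _ _ _ => inner_add_right _ _ _) (fun _ _ _ => inner_smul_right _ _ _)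
      (fun _ _ _ => by rw [map_add, inner_add_left])
      (fun _ _ _ => by rw [map_smul, inner_smul_left]; rfl)) ‖T‖
    fun u v => (norm_inner_le_norm _ _).trans (by
      rw [mul_right_comm]; gcongr; exact T.le_opNorm v)

@[simp]
theorem antidualEmb_apply (T : V →L[ℂ] H) (u : H) (v : V) :
    antidualEmb T u v = inner ℂ (T v) u := rfl

theorem norm_antidualEmb_le (T : V →L[ℂ] H) : ‖antidualEmb T‖ ≤ ‖T‖ :=
  LinearMap.mkContinuous₂_norm_le _ (norm_nonneg _) _

end Antidual

namespace HelmholtzSetting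

variable {H : Type u} [NormedAddCommGroup H] [InnerProductSpace ℂ H] (S : HelmholtzSetting H)

/-! ### Inclusions between the spaces `H^n` and `Z^n` -/

theorem exists_incl {m n : ℕ} (hmn : m ≤ n) : ∃ T : S.Sp n →L[ℂ] S.Sp m,
    (∀ x, S.emb m (T x) = S.emb n x) ∧ ‖T‖ ≤ 1 := by
  have h : ∀ x : S.Sp n, ∃ y : S.Sp m, S.emb m y = S.emb n x := fun x =>
    S.range_emb_anti m n hmn ⟨x, rfl⟩
  choose f hf using h
  refine ⟨LinearMap.mkContinuous
    { toFun := f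
      map_add' := fun x y => S.emb_injective m (by simp [hf])
      map_smul' := fun a x => S.emb_injective m (by simp [hf]) } 1
    fun x => by simpa using S.norm_mono m n hmn (f x) x (hf x), hf,
    LinearMap.mkContinuous_norm_le _ zero_le_one _⟩

theorem norm_emb_le {n : ℕ} (x : S.Sp n) : ‖S.emb n x‖ ≤ ‖x‖ := by
  obtain ⟨T, hT, hn⟩ := S.exists_incl (Nat.zero_le n)
  rw [← hT, S.norm_emb_zero]
  simpa using T.le_of_opNorm_le hn x

variable [CompleteSpace H] (c : ℝ)

theorem op_Re_domain_le : (S.op .Re).domain ≤ S.formDomain S.a := fun _ hu => hu.1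

theorem exists_zToSp : ∀ n, ∃ T : S.ZSp c n →L[ℂ] S.Sp n,
    (∀ x, S.emb n (T x) = S.zEmb c n x) ∧ ‖T‖ ≤ 1
  | 0 => by
    have h : ∀ x : H, ∃ y : S.Sp 0, S.emb 0 y = x := S.emb_zero_surjective
    choose f hf using h
    refine ⟨LinearMap.mkContinuous (E := H)
      { toFun := f
        map_add' := fun x y => S.emb_injective 0 (by simp [hf])
        map_smul' := fun a x => S.emb_injective 0 (by
          rw [map_smul, hf]
          exact congrArg (a • ·) (hf x).symm) } 1
      fun x => ?_, hf, LinearMap.mkContinuous_norm_le _ zero_le_one _⟩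
    change ‖f x‖ ≤ _
    rw [← S.norm_emb_zero, hf, one_mul]
  | 1 => ⟨S.Z.subtypeL, fun _ => rfl, S.Z.norm_subtypeL_le⟩
  | n + 2 => by
    refine ⟨(WithLp.sndL 2 ℂ H (S.Sp (n + 2))).comp (S.ZGraph c (n + 2)).subtypeL, fun _ => rfl,
      ContinuousLinearMap.opNorm_le_bound _ zero_le_one fun x => ?_⟩
    rw [one_mul]
    exact WithLp.norm_snd_le H x.1

theorem exists_zEmbL (n : ℕ) : ∃ T : S.ZSp c n →L[ℂ] H, (∀ x, T x = S.zEmb c n x) ∧ ‖T‖ ≤ 1 := by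
  obtain ⟨T, hT, hn⟩ := S.exists_zToSp c n
  refine ⟨(S.emb n).comp T, hT, ContinuousLinearMap.opNorm_le_bound _ zero_le_one fun x => ?_⟩
  exact (S.norm_emb_le _).trans (T.le_of_opNorm_le hn x)

theorem exists_zIncl : ∀ {m n : ℕ}, m ≤ n → ∃ T : S.ZSp c n →L[ℂ] S.ZSp c m,
    (∀ x, S.zEmb c m (T x) = S.zEmb c n x) ∧ ‖T‖ ≤ 1
  | 0, n, _ => S.exists_zEmbL c n
  | 1, 1, _ => ⟨ContinuousLinearMap.id ℂ _, fun _ => rfl, ContinuousLinearMap.norm_id_le⟩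
  | 1, n + 2, h => by
    obtain ⟨T, hT, hn⟩ := S.exists_zToSp c (n + 2)
    obtain ⟨T', hT', hn'⟩ := S.exists_incl h
    have hmem : ∀ x : S.ZSp c (n + 2), T' (T x) ∈ S.Z := by
      intro x
      obtain ⟨hx, -⟩ := x.2
      obtain ⟨y, hy, e⟩ := S.op_Re_domain_le hx
      have : T' (T x) = y := S.emb_injective 1 (by rw [hT', hT]; exact e.symm)
      rw [this]
      exact hy.1
    refine ⟨(T'.comp T).codRestrict S.Z hmem, fun x => ?_, ?_⟩
    · change S.emb 1 (T' (T x)) = _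
      rw [hT', hT]
    · refine ContinuousLinearMap.opNorm_le_bound _ zero_le_one fun x => ?_
      change ‖T' (T x)‖ ≤ 1 * ‖x‖
      have e1 := T'.le_of_opNorm_le hn' (T x)
      have e2 := T.le_of_opNorm_le hn x
      linarith
  | m + 2, n + 2, h => by
    obtain ⟨T', hT', hn'⟩ := S.exists_incl h
    have hmem : ∀ x : S.ZGraph c (n + 2),
        WithLp.toLp 2 (x.1.fst, T' x.1.snd) ∈ S.ZGraph c (m + 2) := by
      intro x
      obtain ⟨hx, e⟩ := x.2
      have e' : S.emb (m + 2) (T' x.1.snd) = S.emb (n + 2) x.1.snd := hT' _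
      have key : ∀ y (hy : y ∈ (S.op .Re).domain), y = S.emb (n + 2) x.1.snd →
          x.1.fst = S.op .Re ⟨y, hy⟩ + ((c + 1 : ℝ) : ℂ) • y := by
        rintro y hy rfl
        exact e
      exact ⟨e' ▸ hx, key _ _ e'⟩
    let L : S.ZGraph c (n + 2) →ₗ[ℂ] S.ZGraph c (m + 2) :=
      { toFun := fun x => ⟨_, hmem x⟩
        map_add' := fun x y => by
          apply Subtype.ext
          apply WithLp.ofLp_injective
          simp
        map_smul' := fun a x => by
          apply Subtype.ext
          apply WithLp.ofLp_injective
          simp }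
    refine ⟨L.mkContinuous 1 fun x => ?_, fun x => hT' _,
      LinearMap.mkContinuous_norm_le _ zero_le_one _⟩
    rw [one_mul]
    change ‖WithLp.toLp 2 (x.1.fst, T' x.1.snd)‖ ≤ ‖x.1‖
    rw [← sq_le_sq₀ (norm_nonneg _) (norm_nonneg _), WithLp.prod_norm_sq_eq_of_L2,
      WithLp.prod_norm_sq_eq_of_L2]
    have := T'.le_of_opNorm_le hn' x.1.snd
    rw [one_mul] at this
    exact add_le_add le_rfl (pow_le_pow_left₀ (norm_nonneg _) this 2)

/-! ### The scales `W` and `Y` -/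

/-- The description on the right does not involve c, so W^∞ is the same set for every choice of k₀;
only the norms change. -/
theorem mem_W_inf {u : H} :
    u ∈ (S.W c).inf ↔ u ∈ (S.op .Re).domain ∧ ∀ n, u ∈ Set.range (S.emb n) := by
  constructor
  · intro h
    constructor
    · obtain ⟨x, hx⟩ := h (.ofNat 2)
      obtain ⟨h1, -⟩ := (x : S.ZGraph c 2).2
      exact (show S.emb 2 (x : S.ZGraph c 2).1.snd = u from hx) ▸ h1
    · intro n
      obtain ⟨x, hx⟩ := h (.ofNat n)
      obtain ⟨T, hT, -⟩ := S.exists_zToSp c n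
      exact ⟨T x, (hT x).trans hx⟩
  · rintro ⟨h1, h2⟩ j
    match j with
    | .ofNat 0 => exact ⟨u, rfl⟩
    | .ofNat 1 =>
      obtain ⟨y, hy, e⟩ := S.op_Re_domain_le h1
      exact ⟨(⟨y, hy.1⟩ : S.Z), e⟩
    | .ofNat (n + 2) =>
      obtain ⟨x, rfl⟩ := h2 (n + 2)
      exact ⟨(⟨WithLp.toLp 2 (S.op .Re ⟨_, h1⟩ + ((c + 1 : ℝ) : ℂ) • S.emb (n + 2) x, x), h1, rfl⟩ :
        S.ZGraph c (n + 2)), rfl⟩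
    | .negSucc n => exact ⟨antidualEmb (S.emb (n + 1)) u, fun v => rfl⟩

theorem exists_incl_Y : ∀ {j j' : ℤ}, j' ≤ j → ∃ T : (S.Y c).Sp j →L[ℂ] (S.Y c).Sp j',
    (∀ u x, (S.Y c).rep j u x → (S.Y c).rep j' u (T x)) ∧ ‖T‖ ≤ 1
  | .ofNat n, .ofNat m, h => by
    obtain ⟨T, hT, hn⟩ := S.exists_incl (Int.ofNat_le.1 h)
    exact ⟨T, fun u x hx => (hT x).trans hx, hn⟩
  | .ofNat n, .negSucc m, _ => by
    obtain ⟨T, hT, hn⟩ := S.exists_zEmbL c (m + 1)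
    refine ⟨(antidualEmb T).comp (S.emb n), fun u x hx v => ?_, ?_⟩
    · rw [← hT, ← (show S.emb n x = u from hx)]
      rfl
    · refine ContinuousLinearMap.opNorm_le_bound _ zero_le_one fun x => ?_
      refine ((antidualEmb T).le_of_opNorm_le ((norm_antidualEmb_le T).trans hn) _).trans ?_
      gcongr
      exact S.norm_emb_le x
  | .negSucc n, .negSucc m, h => by
    obtain ⟨T, hT, hn⟩ := S.exists_zIncl c (m := n + 1) (n := m + 1) (by omega)
    refine ⟨antidualMap T, fun u x hx v => ?_, (norm_antidualMap_le T).trans hn⟩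
    rw [← hT]
    exact hx (T v)
  | .negSucc n, .ofNat m, h => absurd h (by simpa using Int.negSucc_lt_zero n |>.trans_le (Int.natCast_nonneg m))

theorem exists_incl_W : ∀ {j j' : ℤ}, j' ≤ j → ∃ T : (S.W c).Sp j →L[ℂ] (S.W c).Sp j',
    (∀ u x, (S.W c).rep j u x → (S.W c).rep j' u (T x)) ∧ ‖T‖ ≤ 1
  | .ofNat n, .ofNat m, h => by
    obtain ⟨T, hT, hn⟩ := S.exists_zIncl c (Int.ofNat_le.1 h)
    exact ⟨T, fun u x hx => (hT x).trans hx, hn⟩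
  | .ofNat n, .negSucc m, _ => by
    obtain ⟨T, hT, hn⟩ := S.exists_zEmbL c n
    have hm : ‖S.emb (m + 1)‖ ≤ 1 := ContinuousLinearMap.opNorm_le_bound _ zero_le_one fun x => by
      simpa using S.norm_emb_le x
    refine ⟨(antidualEmb (S.emb (m + 1))).comp T, fun u x hx v => ?_, ?_⟩
    · rw [← (hT x).trans hx]
      rfl
    · refine ContinuousLinearMap.opNorm_le_bound _ zero_le_one fun x => ?_
      refine ((antidualEmb _).le_of_opNorm_le ((norm_antidualEmb_le _).trans hm) _).trans ?_
      have := T.le_of_opNorm_le hn x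
      rw [one_mul] at this
      gcongr
      exact this
  | .negSucc n, .negSucc m, h => by
    obtain ⟨T, hT, hn⟩ := S.exists_incl (m := n + 1) (n := m + 1) (by omega)
    refine ⟨antidualMap T, fun u x hx v => ?_, (norm_antidualMap_le T).trans hn⟩
    rw [← hT]
    exact hx (T v)
  | .negSucc n, .ofNat m, h => absurd h (by simpa using Int.negSucc_lt_zero n |>.trans_le (Int.natCast_nonneg m))

theorem exists_incl_WY : ∀ j : ℤ, ∃ T : (S.W c).Sp j →L[ℂ] (S.Y c).Sp j,
    (∀ u x, (S.W c).rep j u x → (S.Y c).rep j u (T x)) ∧ ‖T‖ ≤ 1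
  | .ofNat n => by
    obtain ⟨T, hT, hn⟩ := S.exists_zToSp c n
    exact ⟨T, fun u x hx => (hT x).trans hx, hn⟩
  | .negSucc n => by
    obtain ⟨T, hT, hn⟩ := S.exists_zToSp c (n + 1)
    refine ⟨antidualMap T, fun u x hx v => ?_, (norm_antidualMap_le T).trans hn⟩
    rw [← hT]
    exact hx (T v)

theorem Y_regular : (S.Y c).Regular where
  zero
    | .ofNat n => map_zero (S.emb n)
    | .negSucc n => fun v => (inner_zero_right _).symm
  add
    | .ofNat n => fun u v x y hx hy => by
      rw [← (show S.emb n x = u from hx), ← (show S.emb n y = v from hy)]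
      exact map_add (S.emb n) x y
    | .negSucc n => fun u v x y hx hy w => by
      rw [inner_add_right, ← hx w, ← hy w]
      rfl
  smul
    | .ofNat n => fun a u x hx => by
      rw [← (show S.emb n x = u from hx)]
      exact map_smul (S.emb n) a x
    | .negSucc n => fun a u x hx w => by
      rw [inner_smul_right, ← hx w]
      rfl
  unique := fun u v x (hu : S.emb 0 x = u) (hv : S.emb 0 x = v) => hu.symm.trans hv
  closed
    | .ofNat n => fun u x U V h hu hx => by
      have e := ((S.emb n).continuous.tendsto V).comp hx
      exact tendsto_nhds_unique e (hu.congr fun n => (h n).symm)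
    | .negSucc n => fun u x U V h hu hx w => by
      have e := ((ContinuousLinearMap.apply' ℂ (starRingEnd ℂ) w).continuous.tendsto V).comp hx
      exact tendsto_nhds_unique e ((tendsto_const_nhds.inner hu).congr fun n => (h n w).symm)
  complete
    | .ofNat n => S.completeSp n
    | .negSucc n => inferInstanceAs (CompleteSpace (S.ZSp c (n + 1) →L⋆[ℂ] ℂ))

/-- Closedness of the graphs is what makes Z^n complete for n ≥ 2, as the summation of operator
series with values in Z^n requires. -/
theorem W_regular (hZ : ∀ n, IsClosed (S.ZGraph c n : Set (WithLp 2 (H × S.Sp n)))) :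
    (S.W c).Regular where
  zero
    | .ofNat n => by
      obtain ⟨T, hT, -⟩ := S.exists_zEmbL c n
      exact (hT 0).symm.trans (map_zero T)
    | .negSucc n => fun v => (inner_zero_right _).symm
  add
    | .ofNat n => fun u v x y hx hy => by
      obtain ⟨T, hT, -⟩ := S.exists_zEmbL c n
      rw [← (hT x).trans hx, ← (hT y).trans hy]
      exact (hT _).symm.trans (map_add T x y)
    | .negSucc n => fun u v x y hx hy w => by
      rw [inner_add_right, ← hx w, ← hy w]
      rfl
  smul
    | .ofNat n => fun a u x hx => by
      obtain ⟨T, hT, -⟩ := S.exists_zEmbL c n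
      rw [← (hT x).trans hx]
      exact (hT _).symm.trans (map_smul T a x)
    | .negSucc n => fun a u x hx w => by
      rw [inner_smul_right, ← hx w]
      rfl
  unique := fun u v x (hu : x = u) (hv : x = v) => hu.symm.trans hv
  closed
    | .ofNat n => fun u x U V h hu hx => by
      obtain ⟨T, hT, -⟩ := S.exists_zEmbL c n
      have e := (T.continuous.tendsto V).comp hx
      exact (hT _).symm.trans
        (tendsto_nhds_unique e (hu.congr fun n => ((hT _).trans (h n)).symm))
    | .negSucc n => fun u x U V h hu hx w => by
      have e := ((ContinuousLinearMap.apply' ℂ (starRingEnd ℂ) w).continuous.tendsto V).comp hx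
      exact tendsto_nhds_unique e ((tendsto_const_nhds.inner hu).congr fun n => (h n w).symm)
  complete
    | .ofNat 0 => inferInstanceAs (CompleteSpace H)
    | .ofNat 1 => S.isClosed_Z.completeSpace_coe
    | .ofNat (n + 2) => (hZ (n + 2)).completeSpace_coe
    | .negSucc n => inferInstanceAs (CompleteSpace (S.Sp (n + 1) →L⋆[ℂ] ℂ))

end HelmholtzSetting

/-! ### The Lax-Milgram theorem for complex forms -/

section LaxMilgram

variable {V : Type*} [NormedAddCommGroup V] [InnerProductSpace ℂ V] [CompleteSpace V]

theorem exists_riesz_antidual (φ : V →L⋆[ℂ] ℂ) :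
    ∃ g : V, (∀ v, inner ℂ v g = φ v) ∧ ‖g‖ ≤ ‖φ‖ := by
  let ψ : V →L[ℂ] ℂ := LinearMap.mkContinuous
    { toFun := fun v => conj (φ v)
      map_add' := fun _ _ => by simp
      map_smul' := fun _ _ => by simp } ‖φ‖ fun v => by simpa using φ.le_opNorm v
  have h : ∀ v, inner ℂ v ((InnerProductSpace.toDual ℂ V).symm ψ) = φ v := fun v => by
    rw [← inner_conj_symm, InnerProductSpace.toDual_symm_apply]
    simp [ψ]
  refine ⟨_, h, ?_⟩
  rw [LinearIsometryEquiv.norm_map]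
  exact LinearMap.mkContinuous_norm_le _ (norm_nonneg _) _

/-- The operator of the flipped form is invertible, since its quadratic form is bounded below in
modulus. The equation b x = φ is an equation for its adjoint, which is therefore surjective. -/
theorem lax_milgram (b : V →L[ℂ] V →L⋆[ℂ] ℂ) {c : ℝ} (hc : 0 < c)
    (h : ∀ x, c * ‖x‖ ^ 2 ≤ ‖b x x‖) (φ : V →L⋆[ℂ] ℂ) : ∃ x, b x = φ := by
  let B := InnerProductSpace.continuousLinearMapOfBilin b.flip
  have hB : ∀ v x, inner ℂ (B v) x = b x v := fun v x =>
    InnerProductSpace.continuousLinearMapOfBilin_apply b.flip v x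
  have hu : IsUnit B := B.isUnit_of_forall_le_norm_inner_map (c := ⟨c, hc.le⟩) hc fun x => by
    rw [hB, mul_comm]
    exact h x
  obtain ⟨g, hg, -⟩ := exists_riesz_antidual φ
  obtain ⟨x, hx⟩ := (ContinuousLinearMap.isUnit_iff_bijective.1 hu.star).2 g
  refine ⟨x, ContinuousLinearMap.ext fun v => ?_⟩
  rw [← hB, ← hg, ← hx, ContinuousLinearMap.star_eq_adjoint,
    ContinuousLinearMap.adjoint_inner_right]

end LaxMilgram

theorem LinearPMap.ap_eq {H : Type u} [NormedAddCommGroup H] [InnerProductSpace ℂ H]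
    (Q : H →ₗ.[ℂ] H) {u : H} (hu : u ∈ Q.domain) : Q.ap u = Q ⟨u, hu⟩ := dif_pos hu

namespace HelmholtzSetting

variable {H : Type u} [NormedAddCommGroup H] [InnerProductSpace ℂ H] (S : HelmholtzSetting H)

/-- The form of the operators `P`, `P*` and `𝒫`. -/
noncomputable def form : OpKind → (S.Sp 1 →ₗ[ℂ] S.Sp 1 →ₗ⋆[ℂ] ℂ)
  | .P => S.a
  | .Pstar => S.aStar
  | .Re => S.aRe

theorem aStar_apply (u v : S.Sp 1) : S.aStar u v = conj (S.a v u) := rfl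

theorem aRe_apply (u v : S.Sp 1) : S.aRe u v = (1 / 2 : ℂ) * (S.a u v + conj (S.a v u)) := rfl

theorem form_adj (q : OpKind) (u v : S.Sp 1) : S.form q.adj u v = conj (S.form q v u) := by
  cases q with
  | P => rfl
  | Pstar => simp [form, OpKind.adj, aStar_apply]
  | Re =>
    have : (starRingEnd ℂ) 2 = 2 := Complex.conj_ofNat 2
    simp [form, OpKind.adj, aRe_apply, add_comm, this]

theorem form_self_re (q : OpKind) (u : S.Sp 1) : (S.form q u u).re = (S.a u u).re := by
  cases q with
  | P => rfl
  | Pstar => simp [form, aStar_apply]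
  | Re => simp [form, aRe_apply]; ring

theorem aRe_self_im (u : S.Sp 1) : (S.aRe u u).im = 0 := by
  simp [aRe_apply]

theorem norm_form_le {C₀ : ℝ} (hb : ∀ u v, ‖S.a u v‖ ≤ C₀ * ‖u‖ * ‖v‖) (q : OpKind)
    (u v : S.Sp 1) : ‖S.form q u v‖ ≤ C₀ * ‖u‖ * ‖v‖ := by
  have h1 : ‖S.aStar u v‖ ≤ C₀ * ‖u‖ * ‖v‖ := by
    rw [aStar_apply, RCLike.norm_conj]
    exact (hb v u).trans (by rw [mul_right_comm])
  cases q with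
  | P => exact hb u v
  | Pstar => exact h1
  | Re =>
    have : S.form .Re u v = (1 / 2 : ℂ) * (S.a u v + S.aStar u v) := rfl
    rw [this, norm_mul]
    have h2 := norm_add_le (S.a u v) (S.aStar u v)
    have h3 := hb u v
    norm_num
    linarith

variable [CompleteSpace H] {S}

section Domain

variable (hS : S.DomainSymmetry)
include hS

theorem DomainSymmetry.domain_eq (q : OpKind) : (S.op q).domain = S.formDomain S.a := by
  cases q with
  | P => rfl
  | Pstar => exact hS.1
  | Re =>
    change S.formDomain S.a ⊓ S.formDomain S.aStar = _
    rw [hS.1, inf_idem]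

omit [CompleteSpace H] in
theorem DomainSymmetry.formDomain_form (q : OpKind) :
    S.formDomain (S.form q) = S.formDomain S.a := by
  cases q with
  | P => rfl
  | Pstar => exact hS.1
  | Re => exact hS.2.1

theorem DomainSymmetry.mem (q : OpKind) {u : H} (hu : u ∈ S.formDomain S.a) :
    u ∈ (S.op q).domain := hS.domain_eq q ▸ hu

theorem DomainSymmetry.ap_Re {u : H} (hu : u ∈ S.formDomain S.a) :
    (S.op .Re).ap u = (1 / 2 : ℂ) • ((S.op .P).ap u + (S.op .Pstar).ap u) := by
  rw [LinearPMap.ap_eq _ (hS.mem .Re hu), LinearPMap.ap_eq _ (hS.mem .P hu),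
    LinearPMap.ap_eq _ (hS.mem .Pstar hu)]
  rfl

omit hS in
theorem inner_formOp (b : S.Sp 1 →ₗ[ℂ] S.Sp 1 →ₗ⋆[ℂ] ℂ) (x : S.Sp 1)
    (hx : S.emb 1 x ∈ (S.formOp b).domain) {v : S.Sp 1} (hv : v ∈ S.Z) :
    inner ℂ (S.emb 1 v) ((S.formOp b).ap (S.emb 1 x)) = b x v := by
  obtain ⟨y, -, e, h⟩ := (S.exists_formOp b ⟨_, hx⟩).choose_spec
  have : y = x := S.emb_injective 1 e
  subst this
  rw [LinearPMap.ap_eq _ hx]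
  exact h v hv

theorem DomainSymmetry.inner_ap (q : OpKind) (x : S.Sp 1) (hx : S.emb 1 x ∈ S.formDomain S.a)
    {v : S.Sp 1} (hv : v ∈ S.Z) :
    inner ℂ (S.emb 1 v) ((S.op q).ap (S.emb 1 x)) = S.form q x v := by
  have h1 := inner_formOp S.a x hx hv
  have h2 := inner_formOp S.aStar x (hS.1 ▸ hx : _ ∈ S.formDomain S.aStar) hv
  cases q with
  | P => exact h1
  | Pstar => exact h2
  | Re =>
    rw [hS.ap_Re hx, inner_smul_right, inner_add_right]
    exact congrArg _ (congrArg₂ _ h1 h2)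

omit [CompleteSpace H] hS in
theorem exists_mem_Z {u : H} (hu : u ∈ S.formDomain S.a) : ∃ x ∈ S.Z, S.emb 1 x = u := by
  obtain ⟨x, hx, e⟩ := hu
  exact ⟨x, hx.1, e⟩

/-- A weak solution with right-hand side in H has a form bounded in the H norm, hence lies in the
form domain. For 𝒫, defined as a half-sum of operators, domain symmetry is essential: a bound on the
form of the real part alone must place x in Z^2. -/
theorem DomainSymmetry.ap_eq_of_form (q : OpKind) {x : S.Sp 1} (hx : x ∈ S.Z) {w : H}
    (h : ∀ v ∈ S.Z, S.form q x v = inner ℂ (S.emb 1 v) w) :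
    S.emb 1 x ∈ S.formDomain S.a ∧ (S.op q).ap (S.emb 1 x) = w := by
  have hd : S.emb 1 x ∈ S.formDomain S.a := by
    rw [← hS.formDomain_form q]
    refine ⟨x, ⟨hx, ‖w‖, fun v hv h1 => ?_⟩, rfl⟩
    rw [h v hv]
    refine (norm_inner_le_norm _ _).trans ?_
    rw [h1, one_mul]
  refine ⟨hd, S.rep_unique fun v hv => ?_⟩
  rw [hS.inner_ap q x hd hv, h v hv]

theorem DomainSymmetry.inner_ap_adj (q : OpKind) {u v : H} (hu : u ∈ S.formDomain S.a)
    (hv : v ∈ S.formDomain S.a) :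
    inner ℂ ((S.op q.adj).ap v) u = inner ℂ v ((S.op q).ap u) := by
  obtain ⟨x, hx, rfl⟩ := exists_mem_Z hu
  obtain ⟨y, hy, rfl⟩ := exists_mem_Z hv
  rw [hS.inner_ap q x hu hy, ← inner_conj_symm, hS.inner_ap q.adj y hv hx, S.form_adj,
    Complex.conj_conj]

end Domain

/-! ### Inverses of perturbed operators -/

/-- `G` is the bounded inverse of `Q + K : Z^2 → H`, for `Q` one of `P`, `P*`, `𝒫`. -/
structure IsInv (S : HelmholtzSetting H) (q : OpKind) (K G : H →L[ℂ] H) : Prop where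
  mem : ∀ u, G u ∈ S.formDomain S.a
  right : ∀ u, (S.op q).ap (G u) + K (G u) = u
  left : ∀ v ∈ S.formDomain S.a, G ((S.op q).ap v + K v) = v

theorem IsInv.adjoint_eq (hS : S.DomainSymmetry) {q : OpKind} {K G G' : H →L[ℂ] H}
    (h : S.IsInv q K G) (h' : S.IsInv q.adj (star K) G') : G' = star G := by
  rw [ContinuousLinearMap.star_eq_adjoint, ContinuousLinearMap.eq_adjoint_iff]
  intro x y
  have e1 := h.right y
  have e2 := h'.right x
  calc inner ℂ (G' x) y = inner ℂ (G' x) ((S.op q).ap (G y) + K (G y)) := by rw [e1]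
    _ = inner ℂ ((S.op q.adj).ap (G' x) + star K (G' x)) (G y) := by
      rw [inner_add_right, inner_add_left, hS.inner_ap_adj q (h.mem y) (h'.mem x),
        ContinuousLinearMap.star_eq_adjoint, ContinuousLinearMap.adjoint_inner_left]
    _ = inner ℂ x (G y) := by rw [e2]

/-- Coercivity on `Z` of the form of `Q + K`. -/
def Coercive (S : HelmholtzSetting H) (q : OpKind) (K : H →L[ℂ] H) (c : ℝ) : Prop :=
  0 < c ∧ ∀ x ∈ S.Z, c * ‖x‖ ^ 2 ≤ ‖S.form q x x + inner ℂ (S.emb 1 x) (K (S.emb 1 x))‖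

omit [CompleteSpace H] in
theorem norm_emb_one_le : ‖S.emb 1‖ ≤ 1 :=
  ContinuousLinearMap.opNorm_le_bound _ zero_le_one fun x => by simpa using S.norm_emb_le x

omit [CompleteSpace H] in
theorem exists_formCLM {C₀ : ℝ} (hb : ∀ u v, ‖S.a u v‖ ≤ C₀ * ‖u‖ * ‖v‖) (q : OpKind)
    (K : H →L[ℂ] H) : ∃ b : S.Z →L[ℂ] S.Z →L⋆[ℂ] ℂ, ∀ x v : S.Z,
      b x v = S.form q x v + inner ℂ (S.emb 1 v) (K (S.emb 1 x)) := by
  refine ⟨LinearMap.mkContinuous₂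
    (LinearMap.mk₂'ₛₗ (RingHom.id ℂ) (starRingEnd ℂ)
      (fun x v => S.form q x v + inner ℂ (S.emb 1 v) (K (S.emb 1 x)))
      (fun _ _ _ => by simp; ring)
      (fun _ _ _ => by simp; ring)
      (fun _ _ _ => by simp; ring)
      (fun _ _ _ => by simp; ring)) (C₀ + ‖K‖) fun x v => ?_, fun _ _ => rfl⟩
  have h1 := S.norm_form_le hb q x v
  have h2 : ‖(inner ℂ (S.emb 1 v) (K (S.emb 1 x)) : ℂ)‖ ≤
      ‖(v : S.Sp 1)‖ * (‖K‖ * ‖(x : S.Sp 1)‖) :=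
    (norm_inner_le_norm _ _).trans (by
      gcongr
      · exact S.norm_emb_le _
      · exact (K.le_opNorm _).trans (by gcongr; exact S.norm_emb_le _))
  calc _ ≤ _ := norm_add_le _ _
    _ ≤ _ := add_le_add h1 h2
    _ = _ := by simp only [Submodule.coe_norm]; ring

omit [CompleteSpace H] in
theorem Coercive.exists_solution {C₀ : ℝ} (hb : ∀ u v, ‖S.a u v‖ ≤ C₀ * ‖u‖ * ‖v‖) {q : OpKind}
    {K : H →L[ℂ] H} {c : ℝ} (hc : S.Coercive q K c) (φ : S.Z →L⋆[ℂ] ℂ) :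
    ∃ x : S.Z, (∀ v : S.Z, S.form q x v + inner ℂ (S.emb 1 v) (K (S.emb 1 x)) = φ v) := by
  have : CompleteSpace S.Z := S.isClosed_Z.completeSpace_coe
  obtain ⟨b, h⟩ := exists_formCLM hb q K
  obtain ⟨x, hx⟩ := lax_milgram b hc.1 (fun x => by rw [h]; exact hc.2 x x.2) φ
  exact ⟨x, fun v => by rw [← hx, h]⟩

omit [CompleteSpace H] in
theorem Coercive.norm_le {q : OpKind}
    {K : H →L[ℂ] H} {c : ℝ} (hc : S.Coercive q K c) {φ : S.Z →L⋆[ℂ] ℂ} {x : S.Z}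
    (hx : ∀ v : S.Z, S.form q x v + inner ℂ (S.emb 1 v) (K (S.emb 1 x)) = φ v) :
    ‖x‖ ≤ c⁻¹ * ‖φ‖ := by
  have h1 := hc.2 x x.2
  rw [hx x] at h1
  have h2 := φ.le_opNorm x
  rw [← div_eq_inv_mul, le_div_iff₀ hc.1]
  rcases (norm_nonneg x).eq_or_lt with h0 | h0
  · rw [← h0, zero_mul]; exact norm_nonneg φ
  · have h3 : c * ‖x‖ ^ 2 ≤ ‖φ‖ * ‖x‖ := h1.trans h2
    nlinarith

/-- Lax-Milgram solves the weak equation in Z and `DomainSymmetry.ap_eq_of_form` moves the solution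
into Z^2. Both linearity of the solution map and the left inverse property come from uniqueness,
itself the coercive estimate with right-hand side 0. -/
theorem Coercive.exists_isInv (hS : S.DomainSymmetry) {C₀ : ℝ}
    (hb : ∀ u v, ‖S.a u v‖ ≤ C₀ * ‖u‖ * ‖v‖) {q : OpKind}
    {K : H →L[ℂ] H} {c : ℝ} (hc : S.Coercive q K c) :
    ∃ G : H →L[ℂ] H, S.IsInv q K G ∧ ‖G‖ ≤ c⁻¹ := by
  have hsol : ∀ w : H, ∃ x : S.Z, (∀ v : S.Z, S.form q x v + inner ℂ (S.emb 1 v) (K (S.emb 1 x))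
      = antidualEmb ((S.emb 1).comp S.Z.subtypeL) w v) := fun w => hc.exists_solution hb _
  choose f hf using hsol
  have huniq : ∀ x : S.Z, (∀ v : S.Z, S.form q x v + inner ℂ (S.emb 1 v) (K (S.emb 1 x)) = 0) →
      x = 0 := fun x hx => by
    have := hc.norm_le (φ := 0) (x := x) hx
    have h0 : ‖(0 : S.Z →L⋆[ℂ] ℂ)‖ = 0 := ContinuousLinearMap.opNorm_zero
    exact norm_le_zero_iff.1 (this.trans_eq ((congrArg _ h0).trans (mul_zero _)))
  have hn : ∀ w, ‖f w‖ ≤ c⁻¹ * ‖w‖ := fun w => by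
    have hci : 0 < c := hc.1
    refine (hc.norm_le (hf w)).trans ?_
    gcongr
    refine ((antidualEmb _).le_of_opNorm_le (norm_antidualEmb_le _) w).trans ?_
    refine mul_le_of_le_one_left (norm_nonneg w) ?_
    refine (ContinuousLinearMap.opNorm_comp_le _ _).trans ?_
    exact mul_le_one₀ norm_emb_one_le (norm_nonneg _) S.Z.norm_subtypeL_le
  have hadd : ∀ w w', f (w + w') = f w + f w' := fun w w' => by
    rw [← sub_eq_zero]
    refine huniq _ fun v => ?_
    have h1 := hf (w + w') v
    have h2 := hf w v
    have h3 := hf w' v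
    simp only [antidualEmb_apply, inner_add_right] at h1 h2 h3
    simp only [Submodule.coe_sub, Submodule.coe_add, map_sub, map_add, LinearMap.sub_apply,
      LinearMap.add_apply, inner_sub_right, inner_add_right]
    linear_combination h1 - h2 - h3
  have hsmul : ∀ (a : ℂ) w, f (a • w) = a • f w := fun a w => by
    rw [← sub_eq_zero]
    refine huniq _ fun v => ?_
    have h1 := hf (a • w) v
    have h2 := hf w v
    simp only [antidualEmb_apply, inner_smul_right] at h1 h2
    simp only [Submodule.coe_sub, Submodule.coe_smul, map_sub, map_smul, LinearMap.sub_apply,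
      LinearMap.smul_apply, inner_sub_right, inner_smul_right, smul_eq_mul]
    linear_combination h1 - a * h2
  have hap : ∀ w, S.emb 1 (f w) ∈ S.formDomain S.a ∧
      (S.op q).ap (S.emb 1 (f w)) = w - K (S.emb 1 (f w)) := fun w =>
    hS.ap_eq_of_form q (f w).2 fun v hv => by
      have := hf w ⟨v, hv⟩
      simp only [antidualEmb_apply] at this
      rw [inner_sub_right]
      exact eq_sub_of_add_eq this
  refine ⟨LinearMap.mkContinuous
    { toFun := fun w => S.emb 1 (f w)
      map_add' := fun w w' => by simp [hadd]
      map_smul' := fun a w => by simp [hsmul] } c⁻¹ fun w => (S.norm_emb_le _).trans (hn w),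
    ⟨fun u => (hap u).1, fun u => ?_, fun v hv => ?_⟩,
    LinearMap.mkContinuous_norm_le _ (inv_nonneg.2 hc.1.le) _⟩
  · have := (hap u).2
    change (S.op q).ap (S.emb 1 (f u)) + K (S.emb 1 (f u)) = u
    rw [this, sub_add_cancel]
  · obtain ⟨x, hx, rfl⟩ := exists_mem_Z hv
    change S.emb 1 (f _) = _
    congr 1
    have : f ((S.op q).ap (S.emb 1 x) + K (S.emb 1 x)) - ⟨x, hx⟩ = 0 := huniq _ fun v => by
      have h1 := hf ((S.op q).ap (S.emb 1 x) + K (S.emb 1 x)) v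
      have h2 := hS.inner_ap q x hv v.2
      simp only [antidualEmb_apply, inner_add_right] at h1
      simp only [Submodule.coe_sub, map_sub, LinearMap.sub_apply, inner_sub_right]
      have h3 : inner ℂ (((S.emb 1).comp S.Z.subtypeL) v) ((S.op q).ap (S.emb 1 x))
        = S.form q x v := h2
      have h4 : ((S.emb 1).comp S.Z.subtypeL) v = S.emb 1 v := rfl
      rw [h3, h4] at h1
      linear_combination h1
    rw [sub_eq_zero] at this
    rw [this]

end HelmholtzSetting

/-! ### The functional calculus in terms of the Cayley transform -/

section Cayley

variable {H : Type u} [NormedAddCommGroup H] [InnerProductSpace ℂ H] [CompleteSpace H]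

/-- The Cayley transform `1 + 2 i (Q - i)⁻¹ = (Q + i) (Q - i)⁻¹`, in terms of `N = (Q - i)⁻¹`. -/
noncomputable def cayley (N : H →L[ℂ] H) : H →L[ℂ] H := 1 + (2 * Complex.I) • N

theorem isStarNormal_of_cayley {N : H →L[ℂ] H} (hU : cayley N ∈ unitary (H →L[ℂ] H)) :
    IsStarNormal N := by
  have hN : N = (2 * Complex.I)⁻¹ • (cayley N - 1) := by
    rw [cayley, add_sub_cancel_left, smul_smul, inv_mul_cancel₀ (by simp), one_smul]
  have hc : Commute (star (cayley N)) (cayley N) := hU.1.trans hU.2.symm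
  constructor
  rw [hN, star_smul, star_sub, star_one]
  refine Commute.smul_left (Commute.smul_right ?_ _) _
  exact ((hc.sub_right (Commute.one_right _)).sub_left (Commute.one_left _))

theorem norm_cayley_of_mem_spectrum {N : H →L[ℂ] H} (hU : cayley N ∈ unitary (H →L[ℂ] H)) {t : ℂ}
    (ht : t ∈ spectrum ℂ N) : ‖1 + 2 * Complex.I * t‖ = 1 := by
  have h1 : 1 + 2 * Complex.I * t ∈ spectrum ℂ (cayley N) := by
    have h2 : (2 * Complex.I) * t ∈ spectrum ℂ ((2 * Complex.I) • N) := by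
      have := spectrum.smul_mem_smul_iff (r := Units.mk0 (2 * Complex.I) (by simp)) (s := t) (a := N)
      exact this.2 ht
    have := spectrum.add_mem_add_iff (a := (2 * Complex.I) • N) (r := 1 + 2 * Complex.I * t) (s := 1)
    rw [cayley]
    rw [add_comm (1 : ℂ), spectrum.add_mem_iff] at *
    simpa using h2
  simpa using spectrum.subset_circle_of_unitary hU h1

/-- On the spectrum of N the function 1 + 2it has modulus one, so the series converges uniformly
there and the continuous functional calculus may be applied term by term. Negative powers of a
unitary are powers of its adjoint. Continuity of g on the spectrum is a by-product of the uniform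
convergence. -/
theorem cfc_eq_cayley_series {N : H →L[ℂ] H} (hU : cayley N ∈ unitary (H →L[ℂ] H)) {g : ℂ → ℂ}
    {M : ℕ} {c : ℤ → ℂ} (hc : Summable fun n => ‖c n‖)
    (hg : ∀ t : ℂ, ‖1 + 2 * Complex.I * t‖ = 1 →
      HasSum (fun n : ℤ => c n * ((1 + 2 * Complex.I * t) ^ n * t ^ M)) (g t)) :
    ContinuousOn g (spectrum ℂ N) ∧ ∃ L₁ L₂ : H →L[ℂ] H, cfc g N = L₁ + L₂ ∧
      (∀ u, HasSum (fun n : ℕ => c n • ((cayley N ^ n) ((N ^ M) u))) (L₁ u)) ∧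
      ∀ u, HasSum (fun n : ℕ => (if n = 0 then 0 else c (-n)) •
        ((star (cayley N) ^ n) ((N ^ M) u))) (L₂ u) := by
  have hN := isStarNormal_of_cayley hU
  let φ := cfcHom (R := ℂ) hN
  let X : C(spectrum ℂ N, ℂ) := (ContinuousMap.id ℂ).restrict (spectrum ℂ N)
  let V : C(spectrum ℂ N, ℂ) := 1 + (2 * Complex.I) • X
  -- The term n = 0 is counted with the nonnegative powers, so it is removed here.
  let d : ℕ → ℂ := fun n => if n = 0 then 0 else c (-n)
  have hφX : φ X = N := cfcHom_id hN
  have hφV : φ V = cayley N := by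
    simp only [V, map_add, map_one, map_smul, hφX, cayley]
  have hVt : ∀ t, V t = 1 + 2 * Complex.I * t := fun t => rfl
  have hXt : ∀ t, X t = t := fun t => rfl
  have hV : ∀ t, ‖V t‖ = 1 := fun t => norm_cayley_of_mem_spectrum hU t.2
  have hc1 : Summable fun n : ℕ => ‖c n‖ := hc.comp_injective Nat.cast_injective
  have hc2 : Summable fun n : ℕ => ‖d n‖ := by
    refine Summable.of_nonneg_of_le (fun n => norm_nonneg _) (fun n => ?_)
      (hc.comp_injective (neg_injective.comp (Nat.cast_injective (R := ℤ))))
    simp only [d, Function.comp]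
    split_ifs <;> simp
  have hs1 : Summable fun n : ℕ => c n • (V ^ n * X ^ M) := by
    refine Summable.of_norm_bounded (hc1.mul_right ‖X ^ M‖) fun n => ?_
    rw [norm_smul]
    gcongr
    refine (ContinuousMap.norm_le _ (norm_nonneg _)).2 fun t => ?_
    simp only [ContinuousMap.mul_apply, ContinuousMap.pow_apply, norm_mul, norm_pow, hV, one_pow,
      one_mul]
    simpa using (X ^ M).norm_coe_le_norm t
  have hs2 : Summable fun n : ℕ => d n • (star V ^ n * X ^ M) := by
    refine Summable.of_norm_bounded (hc2.mul_right ‖X ^ M‖) fun n => ?_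
    rw [norm_smul]
    gcongr
    refine (ContinuousMap.norm_le _ (norm_nonneg _)).2 fun t => ?_
    simp only [ContinuousMap.mul_apply, ContinuousMap.pow_apply, norm_mul, norm_pow,
      ContinuousMap.star_apply, norm_star, hV, one_pow, one_mul]
    simpa using (X ^ M).norm_coe_le_norm t
  have hF : ∀ t : spectrum ℂ N, g t = (∑' n : ℕ, c n • (V ^ n * X ^ M)) t +
      (∑' n : ℕ, d n • (star V ^ n * X ^ M)) t := by
    intro t
    have a1 := (ContinuousMap.evalCLM ℂ t).hasSum hs1.hasSum
    have a2 := (ContinuousMap.evalCLM ℂ t).hasSum hs2.hasSum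
    rw [← hasSum_nat_add_iff' 1] at a2
    have h := HasSum.of_nat_of_neg_add_one
      (f := fun n : ℤ => c n * ((1 + 2 * Complex.I * (t : ℂ)) ^ n * (t : ℂ) ^ M))
      (by
        simpa only [ContinuousMap.evalCLM_apply, ContinuousMap.smul_apply, ContinuousMap.mul_apply,
          ContinuousMap.pow_apply, hVt, hXt, smul_eq_mul, zpow_natCast] using a1) (by
        convert! a2 using 1
        funext n
        have hz : star (V t) = (1 + 2 * Complex.I * (t : ℂ))⁻¹ := by
          refine eq_inv_of_mul_eq_one_left ?_
          have := RCLike.conj_mul (V t)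
          rw [hV, RCLike.ofReal_one, one_pow] at this
          exact this
        have hd : d (n + 1) = c (-((n : ℤ) + 1)) := by simp [d]
        simp only [ContinuousMap.evalCLM_apply, ContinuousMap.smul_apply,
          ContinuousMap.mul_apply, ContinuousMap.pow_apply, ContinuousMap.star_apply, hXt, hz, hd,
          smul_eq_mul]
        congr 2
        rw [zpow_neg, inv_pow]
        norm_cast)
    have e := (hg t (norm_cayley_of_mem_spectrum hU t.2)).unique h
    rw [e]
    simp [d]
  have hcont : ContinuousOn g (spectrum ℂ N) := by
    rw [continuousOn_iff_continuous_domRestrict]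
    have : (spectrum ℂ N).domRestrict g = ⇑((∑' n : ℕ, c n • (V ^ n * X ^ M)) +
      ∑' n : ℕ, d n • (star V ^ n * X ^ M)) := funext fun t => hF t
    rw [this]
    exact ContinuousMap.continuous _
  have hφ : Continuous φ := cfcHom_continuous hN
  refine ⟨hcont, φ (∑' n : ℕ, c n • (V ^ n * X ^ M)), φ (∑' n : ℕ, d n • (star V ^ n * X ^ M)),
    ?_, fun u => ?_, fun u => ?_⟩
  · rw [cfc_apply g N hN hcont, ← map_add]
    exact congrArg φ (ContinuousMap.ext fun t => hF t)
  · have := (hs1.hasSum.map φ hφ).mapL (ContinuousLinearMap.apply ℂ H u)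
    simp only [Function.comp_def, map_smul, map_mul, map_pow, hφX, hφV] at this
    exact this
  · have := (hs2.hasSum.map φ hφ).mapL (ContinuousLinearMap.apply ℂ H u)
    simp only [Function.comp_def, map_smul, map_mul, map_pow, map_star, hφX, hφV] at this
    exact this

end Cayley

/-- Needed to extend a coercive estimate from the dense subspace Z^2 to all of Z. -/
theorem continuous_sesquilinear_diag {V : Type*} [NormedAddCommGroup V] [InnerProductSpace ℂ V]
    [CompleteSpace V] (b : V →L[ℂ] V →L⋆[ℂ] ℂ) : Continuous fun x => b x x := by
  have h : ∀ x, b x x = inner ℂ (InnerProductSpace.continuousLinearMapOfBilin b.flip x) x :=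
    fun x => (InnerProductSpace.continuousLinearMapOfBilin_apply b.flip x x).symm
  simp only [h]
  fun_prop

section SmulOne

variable {H : Type u} [NormedAddCommGroup H] [InnerProductSpace ℂ H]

theorem smul_one_clm_apply (z : ℂ) (u : H) : (z • (1 : H →L[ℂ] H)) u = z • u := rfl

theorem neg_smul_one_clm_apply (z : ℂ) (u : H) : (-(z • (1 : H →L[ℂ] H))) u = -(z • u) := rfl

end SmulOne

/-! ### Consequences of the Gårding inequality at one value of the parameter: resolvent, Cayley
transform, density and spectrum. -/

namespace HelmholtzSetting

variable {H : Type u} [NormedAddCommGroup H] [InnerProductSpace ℂ H]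

/-- The quantitative assumptions on the form for one value of `k`. -/
structure FormBounds (S : HelmholtzSetting H) (C₀ cG C : ℝ) : Prop where
  dom : S.DomainSymmetry
  bound : ∀ u v, ‖S.a u v‖ ≤ C₀ * ‖u‖ * ‖v‖
  cG_pos : 0 < cG
  C_pos : 0 < C
  garding : ∀ u : S.Sp 1, cG * ‖u‖ ^ 2 - C * ‖S.emb 1 u‖ ^ 2 ≤ (S.a u u).re

variable [CompleteSpace H] {S : HelmholtzSetting H} {C₀ cG C : ℝ}

theorem isResolventAt_iff (hS : S.DomainSymmetry) {q : OpKind} {z : ℂ} {T : H →L[ℂ] H} :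
    (S.op q).IsResolventAt z T ↔ S.IsInv q (-(z • (1 : H →L[ℂ] H))) T := by
  have hd := hS.domain_eq q
  constructor
  · rintro ⟨h1, h2⟩
    refine ⟨fun u => hd ▸ (h1 u).1, fun u => ?_, fun v hv => ?_⟩
    · obtain ⟨h, e⟩ := h1 u
      rw [LinearPMap.ap_eq _ h, neg_smul_one_clm_apply, ← sub_eq_add_neg]
      exact e
    · rw [LinearPMap.ap_eq _ (hd ▸ hv), neg_smul_one_clm_apply, ← sub_eq_add_neg]
      exact h2 ⟨v, hd ▸ hv⟩
  · rintro ⟨h0, h1, h2⟩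
    refine ⟨fun u => ⟨hd ▸ h0 u, ?_⟩, fun v => ?_⟩
    · rw [sub_eq_add_neg, ← neg_smul_one_clm_apply, ← LinearPMap.ap_eq]
      exact h1 u
    · have := h2 v (hd ▸ v.2)
      rw [LinearPMap.ap_eq _ v.2, neg_smul_one_clm_apply, ← sub_eq_add_neg] at this
      exact this

namespace FormBounds

omit [CompleteSpace H] in
-- The form of 𝒫 is real on the diagonal, so ±i contributes exactly ‖u‖² to the modulus of the
-- imaginary part, while the real part satisfies Gårding. Real part plus C times the modulus of the
-- imaginary part is at least cG ‖x‖² and at most (1 + C)|w|, whence the constant cG / (1 + C).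
theorem coercive_of_im (h : S.FormBounds C₀ cG C) {z : ℂ} (hre : z.re = 0) (him : |z.im| = 1) :
    S.Coercive .Re (z • (1 : H →L[ℂ] H)) (cG / (1 + C)) := by
  have hC := h.C_pos
  refine ⟨div_pos h.cG_pos (by positivity), fun x _ => ?_⟩
  have e : (inner ℂ (S.emb 1 x) ((z • (1 : H →L[ℂ] H)) (S.emb 1 x)) : ℂ)
      = z * ((‖S.emb 1 x‖ ^ 2 : ℝ) : ℂ) := by
    simp [inner_self_eq_norm_sq_to_K]
  rw [e]
  set w := S.form .Re x x + z * ((‖S.emb 1 x‖ ^ 2 : ℝ) : ℂ) with hw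
  have h1 : w.re = (S.a x x).re := by
    rw [hw, Complex.add_re, Complex.re_mul_ofReal, hre, S.form_self_re]; simp
  have h2 : |w.im| = ‖S.emb 1 x‖ ^ 2 := by
    have : (S.form .Re x x).im = 0 := S.aRe_self_im x
    rw [hw, Complex.add_im, Complex.im_mul_ofReal, this, zero_add, abs_mul, him, one_mul,
      abs_of_nonneg (sq_nonneg _)]
  have h3 := Complex.abs_re_le_norm w
  have h4 := Complex.abs_im_le_norm w
  have h5 := h.garding x
  rw [div_mul_eq_mul_div, div_le_iff₀ (by positivity)]
  rw [h2] at h4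
  have h6 := (le_abs_self w.re).trans h3
  have h7 := mul_le_mul_of_nonneg_left h4 hC.le
  rw [h1] at h6
  linarith

theorem isInv_resolventI (h : S.FormBounds C₀ cG C) :
    S.IsInv .Re (-(Complex.I • (1 : H →L[ℂ] H))) (S.op .Re).resolventI := by
  obtain ⟨G, hG, -⟩ := (h.coercive_of_im (z := -Complex.I) (by simp) (by simp)).exists_isInv h.dom
    h.bound
  rw [neg_smul] at hG
  have hex : ∃ T, (S.op .Re).IsResolventAt Complex.I T := ⟨G, (isResolventAt_iff h.dom).2 hG⟩
  rw [← isResolventAt_iff h.dom, LinearPMap.resolventI, dif_pos hex]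
  exact hex.choose_spec

theorem isInv_star_resolventI (h : S.FormBounds C₀ cG C) :
    S.IsInv .Re (Complex.I • (1 : H →L[ℂ] H)) (star (S.op .Re).resolventI) := by
  obtain ⟨G, hG, -⟩ := (h.coercive_of_im (z := Complex.I) (by simp) (by simp)).exists_isInv h.dom
    h.bound
  have e : star (-(Complex.I • (1 : H →L[ℂ] H))) = Complex.I • (1 : H →L[ℂ] H) := by
    rw [star_neg, star_smul, star_one]
    simp
  rw [← IsInv.adjoint_eq (G' := G) h.dom h.isInv_resolventI (by rw [e]; exact hG)]
  exact hG

/-- Here U = (𝒫 + i)N and N* = (𝒫 + i)⁻¹, so N*U = N and, symmetrically, NU* = N*. Unitarity is then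
algebra with U = 1 + 2iN and U* = 1 - 2iN*. -/
theorem cayley_mem_unitary (h : S.FormBounds C₀ cG C) :
    cayley (S.op .Re).resolventI ∈ unitary (H →L[ℂ] H) := by
  have hN := h.isInv_resolventI
  have hN' := h.isInv_star_resolventI
  set N := (S.op .Re).resolventI
  have hs : star (cayley N) = 1 - (2 * Complex.I) • star N := by
    rw [cayley, star_add, star_one, star_smul]
    simp [sub_eq_add_neg]
  have e1 : star N * cayley N = N := by
    ext u
    have := hN'.left (N u) (hN.mem u)
    conv_rhs => rw [← this]
    change star N (cayley N u) = _
    congr 1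
    have e := hN.right u
    rw [neg_smul_one_clm_apply] at e
    change u + (2 * Complex.I) • N u = _ + Complex.I • N u
    linear_combination (norm := module) -e
  have e2 : N * star (cayley N) = star N := by
    ext u
    have := hN.left (star N u) (hN'.mem u)
    conv_rhs => rw [← this]
    change N (star (cayley N) u) = _
    congr 1
    have e := hN'.right u
    rw [smul_one_clm_apply] at e
    rw [hs, neg_smul_one_clm_apply]
    change u - (2 * Complex.I) • star N u = _
    linear_combination (norm := module) -e
  constructor
  · rw [hs, sub_mul, one_mul, smul_mul_assoc, e1, cayley, add_sub_cancel_right]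
  · have : cayley N * star (cayley N) = star (cayley N) + (2 * Complex.I) • star N := by
      nth_rw 1 [cayley]
      rw [add_mul, one_mul, smul_mul_assoc, e2]
    rw [this, hs, sub_add_cancel]

/-- Applying the bounded operator N turns membership in the graph of the unbounded 𝒫 into an
equation between continuous functions. -/
theorem isClosed_ZGraph (h : S.FormBounds C₀ cG C) (c : ℝ) (n : ℕ) :
    IsClosed (S.ZGraph c n : Set (WithLp 2 (H × S.Sp n))) := by
  have hN := h.isInv_resolventI
  set N := (S.op .Re).resolventI
  have e : (S.ZGraph c n : Set (WithLp 2 (H × S.Sp n))) = {p | S.emb n p.snd =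
      N (p.fst - ((c + 1 : ℝ) : ℂ) • S.emb n p.snd - Complex.I • S.emb n p.snd)} := by
    ext p
    simp only [SetLike.mem_coe, Set.mem_ofPred_eq]
    constructor
    · rintro ⟨hd, hp⟩
      have hd' : S.emb n p.snd ∈ S.formDomain S.a := S.op_Re_domain_le hd
      rw [hp, add_sub_cancel_right]
      have := hN.left _ hd'
      rw [LinearPMap.ap_eq _ hd] at this
      conv_lhs => rw [← this]
      simp [sub_eq_add_neg]
    · intro hp
      have hd' : S.emb n p.snd ∈ S.formDomain S.a := hp ▸ hN.mem _
      have hd := h.dom.mem .Re hd'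
      refine ⟨hd, ?_⟩
      have := hN.right (p.fst - ((c + 1 : ℝ) : ℂ) • S.emb n p.snd - Complex.I • S.emb n p.snd)
      rw [← hp, LinearPMap.ap_eq _ hd] at this
      rw [neg_smul_one_clm_apply, ← sub_eq_add_neg, sub_left_inj] at this
      rw [this, sub_add_cancel]
  rw [e]
  refine isClosed_eq ?_ ?_
  · exact (S.emb n).continuous.comp (WithLp.continuous_snd 2 _ _)
  · refine N.continuous.comp (((WithLp.continuous_fst 2 _ _).sub ?_).sub ?_)
    · exact ((S.emb n).continuous.comp (WithLp.continuous_snd 2 _ _)).const_smul _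
    · exact ((S.emb n).continuous.comp (WithLp.continuous_snd 2 _ _)).const_smul _

/-- `Z^2` is dense in `Z`, in the norm of `H^1`. -/
theorem dense_domain (h : S.FormBounds C₀ cG C) :
    Dense {x : S.Z | S.emb 1 x ∈ S.formDomain S.a} := by
  have : CompleteSpace S.Z := S.isClosed_Z.completeSpace_coe
  let D : Submodule ℂ S.Z := (S.formDomain S.a).comap
    ((S.emb 1 : S.Sp 1 →ₗ[ℂ] H).comp S.Z.subtype)
  change Dense (D : Set S.Z)
  rw [Submodule.dense_iff_topologicalClosure_eq_top, Submodule.topologicalClosure_eq_top_iff,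
    Submodule.eq_bot_iff]
  intro v hv
  have hco := h.coercive_of_im (z := Complex.I) (by simp) (by simp)
  -- For v orthogonal to Z^2 in the inner product of H^1, x solves the weak equation (𝒫 + i)x = v.
  -- Testing with Z^2 shows that x is orthogonal in H to the range of 𝒫 - i, which is all of H; so x
  -- = 0 and v = 0.
  obtain ⟨x, hx⟩ := hco.exists_solution h.bound (antidualEmb (ContinuousLinearMap.id ℂ S.Z) v)
  have hx0 : S.emb 1 x = 0 := by
    have key : ∀ u ∈ S.formDomain S.a, inner ℂ ((S.op .Re).ap u - Complex.I • u) (S.emb 1 x) = 0 := by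
      intro u hu
      obtain ⟨y, hy, rfl⟩ := exists_mem_Z hu
      have h1 := hx ⟨y, hy⟩
      have h2 : antidualEmb (ContinuousLinearMap.id ℂ S.Z) v ⟨y, hy⟩ = 0 :=
        hv ⟨y, hy⟩ hu
      have h3 := h.dom.inner_ap .Re y hu x.2
      rw [h2] at h1
      rw [inner_sub_left, ← inner_conj_symm, h3, ← S.form_adj, ← h1]
      simp [OpKind.adj, inner_smul_left]
    have h4 := key _ (h.isInv_resolventI.mem (S.emb 1 x))
    have h5 := h.isInv_resolventI.right (S.emb 1 x)
    rw [neg_smul_one_clm_apply, ← sub_eq_add_neg] at h5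
    rw [h5] at h4
    exact inner_self_eq_zero.1 h4
  have hx1 : (x : S.Sp 1) = 0 := S.emb_injective 1 (by rw [hx0, map_zero])
  have h1 := hx v
  rw [hx1] at h1
  simp only [map_zero, LinearMap.zero_apply, inner_zero_right, add_zero] at h1
  exact inner_self_eq_zero.1 h1.symm

/-- If T were the resolvent of 𝒫 at t⁻¹ + i, the resolvent identity NT = TN = t(T - N) would make
t⁻¹ + t⁻²T an inverse of t - N. -/
theorem mem_spec_of_mem_spectrum (h : S.FormBounds C₀ cG C) {t : ℂ}
    (ht : t ∈ spectrum ℂ (S.op .Re).resolventI) (h0 : t ≠ 0) :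
    t⁻¹ + Complex.I ∈ (S.op .Re).spec := by
  rintro ⟨T, hT⟩
  rw [isResolventAt_iff h.dom] at hT
  have hN := h.isInv_resolventI
  set N := (S.op .Re).resolventI
  have e1 : N * T = t • (T - N) := by
    ext u
    have a1 := hT.right u
    have a2 := hN.left (T u) (hT.mem u)
    have a3 : (S.op .Re).ap (T u) + (-(Complex.I • (1 : H →L[ℂ] H))) (T u) = u + t⁻¹ • T u := by
      rw [neg_smul_one_clm_apply] at a1 ⊢
      linear_combination (norm := module) a1
    rw [a3, map_add, map_smul] at a2
    change N (T u) = t • (T u - N u)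
    conv_rhs => rw [← a2]
    rw [add_sub_cancel_left, smul_smul, mul_inv_cancel₀ h0, one_smul]
  have e2 : T * N = t • (T - N) := by
    ext u
    have a1 := hN.right u
    have a2 := hT.left (N u) (hN.mem u)
    have a3 : (S.op .Re).ap (N u) + (-((t⁻¹ + Complex.I) • (1 : H →L[ℂ] H))) (N u)
        = u - t⁻¹ • N u := by
      rw [neg_smul_one_clm_apply] at a1 ⊢
      linear_combination (norm := module) a1
    rw [a3, map_sub, map_smul] at a2
    change T (N u) = t • (T u - N u)
    conv_rhs => rw [← a2]
    rw [sub_sub_cancel, smul_smul, mul_inv_cancel₀ h0, one_smul]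
  rw [spectrum.mem_iff] at ht
  refine ht ⟨⟨algebraMap ℂ _ t - N, t⁻¹ • 1 + (t⁻¹ ^ 2) • T, ?_, ?_⟩, rfl⟩
  · rw [Algebra.algebraMap_eq_smul_one, sub_mul, mul_add, mul_add]
    simp only [mul_smul_comm, smul_mul_assoc, one_mul, mul_one, e1, smul_smul, smul_sub]
    have b1 : t⁻¹ * t = 1 := inv_mul_cancel₀ h0
    have b2 : t⁻¹ ^ 2 * t = t⁻¹ := by rw [sq, mul_assoc, b1, mul_one]
    rw [b1, b2]
    module
  · rw [Algebra.algebraMap_eq_smul_one, mul_sub, add_mul, add_mul]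
    simp only [mul_smul_comm, smul_mul_assoc, one_mul, mul_one, e2, smul_smul, smul_sub]
    have b1 : t * t⁻¹ = 1 := mul_inv_cancel₀ h0
    have b2 : t⁻¹ ^ 2 * t = t⁻¹ := by rw [sq, mul_assoc, inv_mul_cancel₀ h0, mul_one]
    have b3 : t * t⁻¹ ^ 2 = t⁻¹ := by rw [mul_comm, b2]
    rw [b1, b2, b3]
    module

end FormBounds

end HelmholtzSetting

/-! ### The functional calculus of 𝒫: power series and form inequalities. -/

section FunCalc

variable {H : Type u} [NormedAddCommGroup H] [InnerProductSpace ℂ H] [CompleteSpace H]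

/-- A function of `x ∈ ℝ` in terms of `t = (x - i)⁻¹`. -/
noncomputable def resolventFun (f : ℝ → ℂ) (t : ℂ) : ℂ := if t = 0 then 0 else f (t⁻¹).re

theorem LinearPMap.funCalc_eq (Q : H →ₗ.[ℂ] H) (f : ℝ → ℂ) :
    Q.funCalc f = cfc (resolventFun f) Q.resolventI := by
  rw [LinearPMap.funCalc]
  congr 1

namespace HelmholtzSetting.FormBounds

/-- The coefficients depend on f and M only and are chosen before the setting. This is the source of
uniformity in k for functions of 𝒫. -/
theorem exists_funCalc_series (f : 𝓢(ℝ, ℂ)) (M : ℕ) : ∃ c d : ℕ → ℂ,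
    (∀ K : ℕ, Summable fun n => ‖c n‖ * (1 + (n : ℝ)) ^ K) ∧
    (∀ K : ℕ, Summable fun n => ‖d n‖ * (1 + (n : ℝ)) ^ K) ∧
    ∀ (S : HelmholtzSetting H) (C₀ cG C : ℝ), S.FormBounds C₀ cG C → ∃ L₁ L₂ : H →L[ℂ] H,
      (S.op .Re).funCalc f = L₁ + L₂ ∧
      (∀ u, HasSum (fun n : ℕ => c n • ((cayley (S.op .Re).resolventI ^ n)
        (((S.op .Re).resolventI ^ M) u))) (L₁ u)) ∧
      ∀ u, HasSum (fun n : ℕ => d n • ((star (cayley (S.op .Re).resolventI) ^ n)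
        (((S.op .Re).resolventI ^ M) u))) (L₂ u) := by
  obtain ⟨c, hc, h⟩ := f.exists_hasSum_circle M
  refine ⟨fun n => c n, fun n => if n = 0 then 0 else c (-n), fun K => ?_, fun K => ?_,
    fun S C₀ cG C hS => ?_⟩
  · simpa [Function.comp_def] using (hc K).comp_injective Nat.cast_injective
  · refine Summable.of_nonneg_of_le (fun n => by positivity) (fun n => ?_)
      ((hc K).comp_injective (neg_injective.comp (Nat.cast_injective (R := ℤ))))
    simp only [Function.comp, Int.cast_neg, abs_neg, Int.cast_natCast, Nat.abs_cast]
    split_ifs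
    · simp; positivity
    · exact le_rfl
  · rw [LinearPMap.funCalc_eq]
    exact (cfc_eq_cayley_series hS.cayley_mem_unitary (by simpa using hc 0) h).2

variable {S : HelmholtzSetting H} {C₀ cG C : ℝ}

theorem continuousOn_resolventFun (h : S.FormBounds C₀ cG C) (f : 𝓢(ℝ, ℂ)) :
    ContinuousOn (resolventFun f) (spectrum ℂ (S.op .Re).resolventI) := by
  obtain ⟨c, hc, hs⟩ := f.exists_hasSum_circle 0
  exact (cfc_eq_cayley_series h.cayley_mem_unitary (by simpa using hc 0) hs).1

theorem star_funCalc (S : HelmholtzSetting H) (ψ : ℝ → ℝ) :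
    star ((S.op .Re).funCalc fun x => (ψ x : ℂ)) = (S.op .Re).funCalc fun x => (ψ x : ℂ) := by
  rw [LinearPMap.funCalc_eq, ← cfc_star]
  congr 1
  funext t
  unfold resolventFun
  split_ifs <;> simp

theorem inv_eq_of_mem_spectrum (h : S.FormBounds C₀ cG C) {t : ℂ}
    (ht : t ∈ spectrum ℂ (S.op .Re).resolventI) (h0 : t ≠ 0) :
    t⁻¹ = (t⁻¹).re - Complex.I := by
  have e2 : (t⁻¹).im = -1 := by
    have e3 : Complex.normSq (1 + 2 * (Complex.I * t)) = 1 := by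
      rw [← mul_assoc, Complex.normSq_eq_norm_sq, norm_cayley_of_mem_spectrum h.cayley_mem_unitary ht,
        one_pow]
    have e4 : Complex.normSq t ≠ 0 := by simpa using h0
    rw [Complex.inv_im, div_eq_iff e4]
    simp [Complex.normSq_apply] at e3 ⊢
    linarith
  apply Complex.ext <;> simp [e2]

/-- The spectral inequality ψ(x) + x/2 - C/2 ≥ 0 involves an unbounded function. Writing u = Nw
multiplies it by |t|² = |x - i|⁻², so that only the bounded calculus of N is needed. -/
theorem inner_funCalc_ge (h : S.FormBounds C₀ cG C) (f : 𝓢(ℝ, ℂ)) {ψ : ℝ → ℝ}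
    (hf : ∀ x, f x = ψ x) (hψ : ∀ x : ℝ, (x : ℂ) ∈ (S.op .Re).spec → (-x + C) / 2 ≤ ψ x) {u : H}
    (hu : u ∈ S.formDomain S.a) :
    C / 2 * ‖u‖ ^ 2 - 1 / 2 * (inner ℂ u ((S.op .Re).ap u)).re ≤
      (inner ℂ u ((S.op .Re).funCalc f u)).re := by
  have hN := h.isInv_resolventI
  set N := (S.op .Re).resolventI with hNdef
  have hnormal : IsStarNormal N := isStarNormal_of_cayley h.cayley_mem_unitary
  have hcont := h.continuousOn_resolventFun f
  let φ := cfcHom (R := ℂ) hnormal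
  let X : C(spectrum ℂ N, ℂ) := (ContinuousMap.id ℂ).restrict (spectrum ℂ N)
  let F : C(spectrum ℂ N, ℂ) := ⟨_, hcont.domRestrict⟩
  have hφX : φ X = N := cfcHom_id hnormal
  have hφF : φ F = (S.op .Re).funCalc f := by
    rw [LinearPMap.funCalc_eq, cfc_apply _ _ hnormal hcont]
  -- Since t⁻¹ = x - i, |t|² x = conj t + i|t|²; hence r(t) = |t|² (ψ(x) + x/2 - C/2) for t ≠ 0, and
  -- r(0) = 0. Being nonnegative, r has the form conj s · s and is sent to a positive operator.
  let r : C(spectrum ℂ N, ℂ) := star X * F * X + (1 / 2 : ℂ) • (star X + Complex.I • (star X * X))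
    - ((C / 2 : ℝ) : ℂ) • (star X * X)
  have hr : ∀ t, ∃ y : ℝ, 0 ≤ y ∧ r t = y := by
    rintro ⟨t, ht⟩
    have er : r ⟨t, ht⟩ = conj t * resolventFun f t * t + (1 / 2 : ℂ) *
      (conj t + Complex.I * (conj t * t)) - ((C / 2 : ℝ) : ℂ) * (conj t * t) := rfl
    by_cases h0 : t = 0
    · exact ⟨0, le_rfl, by rw [er, h0]; simp⟩
    · have e1 := h.inv_eq_of_mem_spectrum ht h0
      set x := (t⁻¹).re with hx
      have hspec : (x : ℂ) ∈ (S.op .Re).spec := by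
        have := h.mem_spec_of_mem_spectrum ht h0
        rwa [e1, sub_add_cancel] at this
      refine ⟨‖t‖ ^ 2 * (ψ x + x / 2 - C / 2),
        mul_nonneg (sq_nonneg _) (by linarith [hψ x hspec]), ?_⟩
      have e2 : resolventFun f t = ψ x := by rw [resolventFun, if_neg h0, hf]
      have e3 : conj t * t = ((‖t‖ ^ 2 : ℝ) : ℂ) := by
        rw [Complex.conj_mul']; norm_cast
      have e4 : conj t = ((‖t‖ ^ 2 : ℝ) : ℂ) * (x - Complex.I) := by
        rw [← e1, ← e3, mul_assoc, mul_inv_cancel₀ h0, mul_one]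
      rw [er, e2, mul_right_comm, e3, e4]
      push_cast
      ring
  let s : C(spectrum ℂ N, ℂ) := ⟨fun t => (Real.sqrt (r t).re : ℂ), by fun_prop⟩
  have hs : star s * s = r := by
    ext t
    obtain ⟨y, hy, e⟩ := hr t
    have : s t = (Real.sqrt (r t).re : ℂ) := rfl
    rw [ContinuousMap.mul_apply, ContinuousMap.star_apply, this, e, Complex.ofReal_re]
    change conj (Real.sqrt y : ℂ) * _ = _
    rw [Complex.conj_ofReal, ← Complex.ofReal_mul, Real.mul_self_sqrt hy]
  have hφr : φ r = star N * (S.op .Re).funCalc f * N + (1 / 2 : ℂ) • (star N + Complex.I •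
      (star N * N)) - ((C / 2 : ℝ) : ℂ) • (star N * N) := by
    simp only [r, map_sub, map_add, map_mul, map_smul, map_star, hφX, hφF]
  set w := (S.op .Re).ap u + (-(Complex.I • (1 : H →L[ℂ] H))) u with hw
  have hNw : N w = u := hN.left u hu
  have h1 : 0 ≤ (inner ℂ w (φ r w)).re := by
    rw [← hs, map_mul, map_star, ContinuousLinearMap.star_eq_adjoint]
    change 0 ≤ (inner ℂ w (ContinuousLinearMap.adjoint (φ s) (φ s w))).re
    rw [ContinuousLinearMap.adjoint_inner_right]
    exact inner_self_nonneg (𝕜 := ℂ)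
  have h2 : inner ℂ w (φ r w) = inner ℂ u ((S.op .Re).funCalc f u) + (1 / 2 : ℂ) *
      (inner ℂ u w + Complex.I * inner ℂ u u) - ((C / 2 : ℝ) : ℂ) * inner ℂ u u := by
    rw [hφr, ContinuousLinearMap.star_eq_adjoint]
    change inner ℂ w (ContinuousLinearMap.adjoint N ((S.op .Re).funCalc f (N w)) + (1 / 2 : ℂ) •
      (ContinuousLinearMap.adjoint N w + Complex.I • (ContinuousLinearMap.adjoint N (N w)))
      - ((C / 2 : ℝ) : ℂ) • ContinuousLinearMap.adjoint N (N w)) = _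
    simp only [inner_sub_right, inner_add_right, inner_smul_right,
      ContinuousLinearMap.adjoint_inner_right, hNw]
  have h3 : inner ℂ u w + Complex.I * inner ℂ u u = inner ℂ u ((S.op .Re).ap u) := by
    rw [hw, neg_smul_one_clm_apply, inner_add_right, inner_neg_right, inner_smul_right]
    ring
  have h4 : (inner ℂ u u : ℂ) = ((‖u‖ ^ 2 : ℝ) : ℂ) := by
    rw [inner_self_eq_norm_sq_to_K]; norm_cast
  rw [h2, h3, h4, Complex.sub_re, Complex.add_re, ← Complex.ofReal_mul, Complex.ofReal_re] at h1
  have h5 : ((1 / 2 : ℂ) * inner ℂ u ((S.op .Re).ap u)).re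
      = 1 / 2 * (inner ℂ u ((S.op .Re).ap u)).re := by
    rw [show (1 / 2 : ℂ) = ((1 / 2 : ℝ) : ℂ) by push_cast; rfl, Complex.re_ofReal_mul]
  rw [h5] at h1
  linarith

/-- The form of `P + ψ(𝒫)` (and of its adjoint) is coercive. -/
theorem coercive_funCalc (h : S.FormBounds C₀ cG C) (f : 𝓢(ℝ, ℂ)) {ψ : ℝ → ℝ}
    (hf : ∀ x, f x = ψ x) (hψ : ∀ x : ℝ, (x : ℂ) ∈ (S.op .Re).spec → (-x + C) / 2 ≤ ψ x)
    (q : OpKind) : S.Coercive q ((S.op .Re).funCalc f) (cG / 2) := by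
  have : CompleteSpace S.Z := S.isClosed_Z.completeSpace_coe
  refine ⟨half_pos h.cG_pos, fun x hx => ?_⟩
  obtain ⟨b, hb⟩ := exists_formCLM h.bound q ((S.op .Re).funCalc f)
  -- On Z^2 the perturbation adds at least C/2 ‖u‖² - 1/2 Re a(u,u), leaving half of the Gårding
  -- expression Re a(u,u) + C‖u‖². Density of Z^2 in Z and continuity of the form extend the
  -- estimate.
  have hall : ∀ y : S.Z, cG / 2 * ‖y‖ ^ 2 ≤ (b y y).re := by
    have hc := continuous_sesquilinear_diag b
    have hclosed : IsClosed {y : S.Z | cG / 2 * ‖y‖ ^ 2 ≤ (b y y).re} :=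
      isClosed_le (by fun_prop) (Complex.continuous_re.comp hc)
    intro y
    refine (closure_minimal (fun z hz => ?_) hclosed) (h.dense_domain y)
    have hz : S.emb 1 z ∈ S.formDomain S.a := hz
    have h1 := h.inner_funCalc_ge f hf hψ hz
    have h2 := h.dom.inner_ap .Re z hz z.2
    have h3 := h.garding z
    rw [h2, S.form_self_re] at h1
    change cG / 2 * ‖z‖ ^ 2 ≤ (b z z).re
    rw [hb, Complex.add_re, S.form_self_re]
    have h4 : ‖z‖ = ‖(z : S.Sp 1)‖ := rfl
    rw [h4]
    linarith
  have := hall ⟨x, hx⟩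
  rw [hb] at this
  exact this.trans (Complex.re_le_norm _)

end HelmholtzSetting.FormBounds

end FunCalc

/-! ### Uniform elliptic regularity and the order of inverses. -/

theorem exists_clm {V V' : Type*} [NormedAddCommGroup V] [NormedSpace ℂ V] [NormedAddCommGroup V']
    [NormedSpace ℂ V'] (f : V → V') (hadd : ∀ x y, f (x + y) = f x + f y)
    (hsmul : ∀ (a : ℂ) x, f (a • x) = a • f x) {C : ℝ} (hC : 0 ≤ C) (hn : ∀ x, ‖f x‖ ≤ C * ‖x‖) :
    ∃ T : V →L[ℂ] V', (∀ x, T x = f x) ∧ ‖T‖ ≤ C :=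
  ⟨LinearMap.mkContinuous { toFun := f, map_add' := hadd, map_smul' := hsmul } C hn, fun _ => rfl,
    LinearMap.mkContinuous_norm_le _ hC _⟩

theorem exists_rieszL (V : Type*) [NormedAddCommGroup V] [InnerProductSpace ℂ V]
    [CompleteSpace V] : ∃ T : (V →L⋆[ℂ] ℂ) →L[ℂ] V, (∀ φ v, inner ℂ v (T φ) = φ v) ∧ ‖T‖ ≤ 1 := by
  choose f hf hn using exists_riesz_antidual (V := V)
  refine ⟨LinearMap.mkContinuous
    { toFun := f
      map_add' := fun φ ψ => ext_inner_left ℂ fun v => by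
        rw [inner_add_right, hf, hf, hf]; rfl
      map_smul' := fun a φ => ext_inner_left ℂ fun v => by
        rw [inner_smul_right, hf, hf]; rfl } 1 fun φ => by simpa using hn φ, hf,
    LinearMap.mkContinuous_norm_le _ zero_le_one _⟩

namespace HelmholtzSetting

variable {H : Type u} [NormedAddCommGroup H] [InnerProductSpace ℂ H] [CompleteSpace H]

theorem zEmb_injective (S : HelmholtzSetting H) (c : ℝ) : ∀ n, Function.Injective (S.zEmb c n)
  | 0 => fun _ _ h => h
  | 1 => fun x y h => Subtype.ext (S.emb_injective 1 h)
  | n + 2 => fun x y h => by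
    obtain ⟨⟨p⟩, hp, ep⟩ := x
    obtain ⟨⟨q⟩, hq, eq⟩ := y
    have e : p.2 = q.2 := S.emb_injective (n + 2) h
    obtain ⟨p1, p2⟩ := p
    obtain ⟨q1, q2⟩ := q
    simp only at e ep eq
    subst e
    have : p1 = q1 := ep.trans eq.symm
    subst this
    rfl

variable {ι : Type*}

/-- The assumptions on a family of Helmholtz settings with uniform constants: bounds for the forms
and elliptic regularity. -/
structure UniformFamily (S : ι → HelmholtzSetting H) (C₀ cG c : ℝ) : Prop where
  cG_pos : 0 < cG
  c_pos : 0 < c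
  form : ∀ i, (S i).FormBounds C₀ cG c
  ell : ∀ (q : OpKind) (n : ℕ), ∃ C > 0, ∀ i, ∀ (u : H) (w : (S i).Sp n),
    u ∈ (S i).formDomain (S i).a → ((S i).op q).ap u = (S i).emb n w →
    ∃ u' : (S i).ZSp c (n + 2), (S i).zEmb c (n + 2) u' = u ∧ ‖u'‖ ≤ C * (‖u‖ + ‖w‖)

/-- The operators `K i` are bounded on all spaces `H^n`, uniformly in `i`. -/
def UniformBdd (S : ι → HelmholtzSetting H) (K : ι → H →L[ℂ] H) : Prop :=
  ∀ n : ℕ, ∃ C, 0 ≤ C ∧ ∀ i, ∀ x : (S i).Sp n, ∃ y : (S i).Sp n,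
    (S i).emb n y = K i ((S i).emb n x) ∧ ‖y‖ ≤ C * ‖x‖

/-- The operators `G i` are bounded from `H^n` to `Z^(n+2)`, uniformly in `i`. -/
def UniformSmoothing (S : ι → HelmholtzSetting H) (c : ℝ) (G : ι → H →L[ℂ] H) : Prop :=
  ∀ n : ℕ, ∃ C, 0 ≤ C ∧ ∀ i, ∃ T : (S i).Sp n →L[ℂ] (S i).ZSp c (n + 2),
    (∀ x, (S i).zEmb c (n + 2) (T x) = G i ((S i).emb n x)) ∧ ‖T‖ ≤ C

variable {S : ι → HelmholtzSetting H} {C₀ cG c : ℝ}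

omit [CompleteSpace H] in
theorem UniformBdd.smul_one (z : ℂ) : UniformBdd S fun _ => z • (1 : H →L[ℂ] H) := fun _ =>
  ⟨‖z‖, norm_nonneg z, fun _ x => ⟨z • x, map_smul _ _ _, (norm_smul _ _).le⟩⟩

/-- Bootstrap: u = Gw satisfies Qu = w - Ku. If u is bounded in H^m with m ≤ n, so is the right-hand
side, and elliptic regularity puts u in Z^(m+2). The start m = 0 is the bound of G on H. -/
theorem UniformFamily.uniformSmoothing (hS : UniformFamily S C₀ cG c) {q : OpKind}
    {K G : ι → H →L[ℂ] H} (hG : ∀ i, (S i).IsInv q (K i) (G i)) {CG : ℝ} (hCG : 0 ≤ CG)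
    (hGn : ∀ i, ‖G i‖ ≤ CG) (hK : UniformBdd S K) : UniformSmoothing S c G := by
  intro n
  have step : ∀ m ≤ n, (∃ C, 0 ≤ C ∧ ∀ i, ∀ w : (S i).Sp n, ∃ u : (S i).Sp m,
      (S i).emb m u = G i ((S i).emb n w) ∧ ‖u‖ ≤ C * ‖w‖) →
      ∃ C, 0 ≤ C ∧ ∀ i, ∀ w : (S i).Sp n, ∃ u : (S i).ZSp c (m + 2),
        (S i).zEmb c (m + 2) u = G i ((S i).emb n w) ∧ ‖u‖ ≤ C * ‖w‖ := by
    rintro m hm ⟨C, hC, h⟩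
    obtain ⟨CK, hCK, hK⟩ := hK m
    obtain ⟨CE, hCE, hE⟩ := hS.ell q m
    refine ⟨CE * (CG + (1 + CK * C)), by positivity, fun i w => ?_⟩
    obtain ⟨u, hu, hun⟩ := h i w
    obtain ⟨y, hy, hyn⟩ := hK i u
    obtain ⟨T, hT, hTn⟩ := (S i).exists_incl hm
    obtain ⟨u', hu', hn'⟩ := hE i (G i ((S i).emb n w)) (T w - y) ((hG i).mem _) (by
      rw [map_sub, hT, hy, hu]
      exact eq_sub_of_add_eq ((hG i).right _))
    refine ⟨u', hu', hn'.trans ?_⟩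
    have e1 : ‖G i ((S i).emb n w)‖ ≤ CG * ‖w‖ :=
      ((G i).le_of_opNorm_le (hGn i) _).trans (by gcongr; exact (S i).norm_emb_le w)
    have e2 : ‖T w - y‖ ≤ (1 + CK * C) * ‖w‖ := by
      refine (norm_sub_le _ _).trans ?_
      have a1 := T.le_of_opNorm_le hTn w
      have a2 : ‖y‖ ≤ CK * (C * ‖w‖) := hyn.trans (by gcongr)
      linarith
    calc CE * (‖G i ((S i).emb n w)‖ + ‖T w - y‖) ≤ CE * (CG * ‖w‖ + (1 + CK * C) * ‖w‖) := by
          gcongr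
      _ = _ := by ring
  have all : ∀ m ≤ n, ∃ C, 0 ≤ C ∧ ∀ i, ∀ w : (S i).Sp n, ∃ u : (S i).Sp m,
      (S i).emb m u = G i ((S i).emb n w) ∧ ‖u‖ ≤ C * ‖w‖ := by
    intro m
    induction m with
    | zero =>
      refine fun _ => ⟨CG, hCG, fun i w => ?_⟩
      obtain ⟨u, hu⟩ := (S i).emb_zero_surjective (G i ((S i).emb n w))
      refine ⟨u, hu, ?_⟩
      rw [← (S i).norm_emb_zero, hu]
      exact ((G i).le_of_opNorm_le (hGn i) _).trans (by gcongr; exact (S i).norm_emb_le w)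
    | succ m ih =>
      intro hm
      obtain ⟨C, hC, h⟩ := step m (by omega) (ih (by omega))
      refine ⟨C, hC, fun i w => ?_⟩
      obtain ⟨u, hu, hn⟩ := h i w
      obtain ⟨T, hT, hTn⟩ := (S i).exists_zToSp c (m + 2)
      obtain ⟨T', hT', hTn'⟩ := (S i).exists_incl (show m + 1 ≤ m + 2 by omega)
      refine ⟨T' (T u), by rw [hT', hT, hu], ?_⟩
      have a1 := T'.le_of_opNorm_le hTn' (T u)
      have a2 := T.le_of_opNorm_le hTn u
      linarith
  obtain ⟨C, hC, h⟩ := step n le_rfl (all n le_rfl)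
  refine ⟨C, hC, fun i => ?_⟩
  choose f hf hn using h i
  obtain ⟨E, hE, -⟩ := (S i).exists_zEmbL c (n + 2)
  refine ⟨LinearMap.mkContinuous
    { toFun := f
      map_add' := fun x y => (S i).zEmb_injective c _ (by
        rw [hf, ← hE, map_add, map_add, map_add, hE, hE, hf, hf])
      map_smul' := fun a x => (S i).zEmb_injective c _ (by
        rw [hf, ← hE, map_smul, map_smul, map_smul, hE, hf]; rfl) } C hn, hf,
    LinearMap.mkContinuous_norm_le _ hC _⟩

/-- Extends G to the antidual of Z, with values in Z. This provides the one step Y^{-1} → W^1 that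
neither elliptic regularity nor its transpose gives. -/
theorem Coercive.exists_solution_linear {S : HelmholtzSetting H} {q : OpKind} {K G : H →L[ℂ] H} {c : ℝ}
    (hc : S.Coercive q K c) (hS : S.DomainSymmetry) {C₀ : ℝ}
    (hb : ∀ u v, ‖S.a u v‖ ≤ C₀ * ‖u‖ * ‖v‖) (hG : S.IsInv q K G) :
    ∃ f : (S.Z →L⋆[ℂ] ℂ) → S.Z, (∀ φ ψ, f (φ + ψ) = f φ + f ψ) ∧
      (∀ (a : ℂ) φ, f (a • φ) = a • f φ) ∧ (∀ φ, ‖f φ‖ ≤ c⁻¹ * ‖φ‖) ∧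
      ∀ φ u, (∀ v : S.Z, φ v = inner ℂ (S.emb 1 v) u) → S.emb 1 (f φ) = G u := by
  choose f hf using fun φ => hc.exists_solution hb φ
  have huniq : ∀ x y : S.Z, (∀ v : S.Z, S.form q x v + inner ℂ (S.emb 1 v) (K (S.emb 1 x)) =
      S.form q y v + inner ℂ (S.emb 1 v) (K (S.emb 1 y))) → x = y := fun x y hx => by
    have := hc.norm_le (φ := 0) (x := x - y) fun v => by
      have := hx v
      simp only [Submodule.coe_sub, map_sub, LinearMap.sub_apply, inner_sub_right]
      change _ = (0 : ℂ)
      linear_combination this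
    have h0 : ‖(0 : S.Z →L⋆[ℂ] ℂ)‖ = 0 := ContinuousLinearMap.opNorm_zero
    exact sub_eq_zero.1 (norm_le_zero_iff.1 (this.trans_eq ((congrArg _ h0).trans (mul_zero _))))
  refine ⟨f, fun φ ψ => huniq _ _ fun v => ?_, fun a φ => huniq _ _ fun v => ?_,
    fun φ => hc.norm_le (hf φ), fun φ u hu => ?_⟩
  · rw [hf, add_apply, ← hf φ v, ← hf ψ v]
    simp only [Submodule.coe_add, map_add, LinearMap.add_apply, inner_add_right]
    ring
  · rw [hf, smul_apply, ← hf φ v]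
    simp only [Submodule.coe_smul, map_smul, LinearMap.smul_apply, inner_smul_right,
      smul_eq_mul]
    ring
  have h1 := hS.ap_eq_of_form q (f φ).2 (w := u - K (S.emb 1 (f φ))) fun v hv => by
    have h2 := hf φ ⟨v, hv⟩
    rw [hu] at h2
    rw [inner_sub_right]
    exact eq_sub_of_add_eq h2
  have h3 := hG.left _ h1.1
  rw [h1.2, sub_add_cancel] at h3
  exact h3.symm

/-- The inverse of an elliptic operator is of order `-2` from `Y` to `W`. -/
theorem UniformFamily.ordBd_inverse (hS : UniformFamily S C₀ cG c) {q : OpKind}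
    {K G : ι → H →L[ℂ] H} {c₁ : ℝ} (hc₁ : 0 < c₁) (hco : ∀ i, (S i).Coercive q (K i) c₁)
    (hG : ∀ i, (S i).IsInv q (K i) (G i))
    (hs : UniformSmoothing S c G) (hs' : UniformSmoothing S c fun i => star (G i)) (h : ι → ℝ) :
    OrdBd (fun i => (S i).Y c) (fun i => (S i).W c) (fun _ => 1) h (-2) 0 fun i u => G i u := by
  intro j j' hj
  have ext : ∀ C : ℝ, 0 ≤ C → (∀ i, ∃ T : ((S i).Y c).Sp j →L[ℂ] ((S i).W c).Sp j',
      (∀ u x, ((S i).Y c).rep j u x → ((S i).W c).rep j' (G i u) (T x)) ∧ ‖T‖ ≤ C) →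
      ∃ C : ℝ, 0 ≤ C ∧ ∃ M : ℕ, ∀ i, ∃ T : ((S i).Y c).Sp j →L[ℂ] ((S i).W c).Sp j',
    (∀ u ∈ ((S i).Y c).inf, ∀ x, ((S i).Y c).rep j u x → ((S i).W c).rep j' (G i u) (T x)) ∧
    ‖T‖ ≤ C * 1 ^ M * h i ^ 0 := by
    intro C hC hT
    refine ⟨C, hC, 0, fun i => ?_⟩
    obtain ⟨T, h1, h2⟩ := hT i
    exact ⟨T, fun u _ x hx => h1 u x hx, by simpa using h2⟩
  have hadj : ∀ i u v, inner ℂ (star (G i) v) u = inner ℂ v (G i u) := fun i u v =>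
    (G i).adjoint_inner_left _ _
  -- For j ≥ 0 elliptic regularity applies, and for j = -1 Lax-Milgram. For j ≤ -2 the extension is
  -- the transpose of G* : H^{-j-2} → Z^{-j}. The case j = -2 stands apart because W^0 is H itself,
  -- which requires the Riesz isomorphism.
  match j with
  | .ofNat n =>
    obtain rfl : j' = .ofNat (n + 2) := by
      rw [Int.ofNat_eq_natCast] at hj ⊢; push_cast; omega
    obtain ⟨C, hC, hT⟩ := hs n
    refine ext C hC fun i => ?_
    obtain ⟨T, h1, h2⟩ := hT i
    refine ⟨T, fun u x hx => ?_, h2⟩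
    exact (h1 x).trans (congrArg (G i) hx)
  | .negSucc 0 =>
    obtain rfl : j' = .ofNat 1 := by
      rw [Int.ofNat_eq_natCast]; rw [Int.negSucc_eq] at hj; push_cast at hj ⊢; omega
    refine ext c₁⁻¹ (inv_nonneg.2 hc₁.le) fun i => ?_
    obtain ⟨f, hadd, hsmul, hn, hf⟩ :=
      (hco i).exists_solution_linear (hS.form i).dom (hS.form i).bound (hG i)
    obtain ⟨T, h1, h2⟩ := exists_clm (V := (S i).ZSp c 1 →L⋆[ℂ] ℂ) (V' := (S i).ZSp c 1) f hadd
      hsmul (inv_nonneg.2 hc₁.le) hn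
    exact ⟨T, fun u x hx => (congrArg ((S i).zEmb c 1) (h1 x)).trans (hf x u hx), h2⟩
  | .negSucc 1 =>
    obtain rfl : j' = .ofNat 0 := by
      rw [Int.ofNat_eq_natCast]; rw [Int.negSucc_eq] at hj; push_cast at hj ⊢; omega
    obtain ⟨C, hC, hT⟩ := hs' 0
    refine ext C hC fun i => ?_
    obtain ⟨T, h1, h2⟩ := hT i
    obtain ⟨J, hJ, hJn⟩ := exists_rieszL H
    obtain ⟨E, hE, hEn⟩ := (S i).exists_zToSp c 0
    let T₁ : H →L[ℂ] (S i).ZSp c 2 := T.comp E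
    have hT₁ : ∀ v, (S i).zEmb c 2 (T₁ v) = star (G i) v := fun v =>
      (h1 (E v)).trans (congrArg _ (hE v))
    have hT₁n : ‖T₁‖ ≤ C := by
      refine (T.opNorm_comp_le E).trans ?_
      calc ‖T‖ * ‖E‖ ≤ C * 1 := by gcongr
        _ = C := mul_one C
    refine ⟨J.comp (antidualMap T₁), fun u x hx => ?_, ?_⟩
    · refine ext_inner_left ℂ fun v => ?_
      refine (hJ (antidualMap T₁ x) v).trans ?_
      have e : antidualMap T₁ x v = inner ℂ (star (G i) v) u :=
        (hx (T₁ v)).trans (congrArg (fun y => inner ℂ y u) (hT₁ v))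
      exact e.trans (hadj i u v)
    · refine (J.opNorm_comp_le _).trans ?_
      calc ‖J‖ * ‖antidualMap T₁‖ ≤ 1 * C := by
            gcongr; exact (norm_antidualMap_le T₁).trans hT₁n
        _ = C := one_mul C
  | .negSucc (n + 2) =>
    obtain rfl : j' = .negSucc n := by
      rw [Int.negSucc_eq] at hj ⊢; push_cast at hj; omega
    obtain ⟨C, hC, hT⟩ := hs' (n + 1)
    refine ext C hC fun i => ?_
    obtain ⟨T, h1, h2⟩ := hT i
    refine ⟨antidualMap T, fun u x hx v => ?_, (norm_antidualMap_le T).trans h2⟩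
    have e : antidualMap T x v = inner ℂ (star (G i) ((S i).emb (n + 1) v)) u :=
      (hx (T v)).trans (congrArg (fun y => inner ℂ y u) (h1 v))
    exact e.trans (hadj i u _)

end HelmholtzSetting

/-! ### Uniform commutator bounds for resolvents, functions of 𝒫 and the elliptic perturbation. -/

namespace HelmholtzSetting

variable {H : Type u} [NormedAddCommGroup H] [InnerProductSpace ℂ H] [CompleteSpace H]
  {ι : Type*} {S : ι → HelmholtzSetting H} {C₀ cG c : ℝ}

theorem IsInv.unique {S : HelmholtzSetting H} {q : OpKind} {K G G' : H →L[ℂ] H}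
    (hG : S.IsInv q K G) (hG' : S.IsInv q K G') : G = G' := by
  ext u
  have := hG'.left (G u) (hG.mem u)
  rw [hG.right u] at this
  exact this.symm

theorem ordBd_incl_Y (S : ι → HelmholtzSetting H) (c : ℝ) (h : ι → ℝ) (d : ℕ) :
    OrdBd (fun i => (S i).Y c) (fun i => (S i).Y c) (fun _ => 1) h d 0 fun _ u => u := by
  refine fun j j' hj => ⟨1, zero_le_one, 0, fun i => ?_⟩
  obtain ⟨T, hT, hn⟩ := (S i).exists_incl_Y c (show j' ≤ j by omega)
  exact ⟨T, fun u _ x hx => hT u x hx, by simpa using hn⟩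

theorem ordBd_incl_W (S : ι → HelmholtzSetting H) (c : ℝ) (h : ι → ℝ) (d : ℕ) :
    OrdBd (fun i => (S i).W c) (fun i => (S i).W c) (fun _ => 1) h d 0 fun _ u => u := by
  refine fun j j' hj => ⟨1, zero_le_one, 0, fun i => ?_⟩
  obtain ⟨T, hT, hn⟩ := (S i).exists_incl_W c (show j' ≤ j by omega)
  exact ⟨T, fun u _ x hx => hT u x hx, by simpa using hn⟩

theorem ordBd_incl_WY (S : ι → HelmholtzSetting H) (c : ℝ) (h : ι → ℝ) :
    OrdBd (fun i => (S i).W c) (fun i => (S i).Y c) (fun _ => 1) h 0 0 fun _ u => u := by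
  refine fun j j' hj => ⟨1, zero_le_one, 0, fun i => ?_⟩
  obtain rfl : j' = j := by omega
  obtain ⟨T, hT, hn⟩ := (S i).exists_incl_WY c j'
  exact ⟨T, fun u _ x hx => hT u x hx, by simpa using hn⟩

theorem powBd_of_mem_unitary (S : ι → HelmholtzSetting H) (c : ℝ) {V : ι → H →L[ℂ] H}
    (hV : ∀ i, V i ∈ unitary (H →L[ℂ] H)) : PowBd (fun i => (S i).Y c) V 0 := by
  refine ⟨1, zero_le_one, 0, fun i n => ?_⟩
  obtain ⟨J, hJ, hJn⟩ := (S i).exists_zToSp c 0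
  let J' : H →L[ℂ] (S i).Sp 0 := J
  let T : (S i).Sp 0 →L[ℂ] (S i).Sp 0 := J'.comp ((V i ^ n).comp ((S i).emb 0))
  have hT : ∀ x, (S i).emb 0 (T x) = (V i ^ n) ((S i).emb 0 x) := fun x => hJ _
  refine ⟨T, fun u _ x hx => (hT x).trans (congrArg (V i ^ n) hx), ?_⟩
  refine T.opNorm_le_bound (by positivity) fun x => ?_
  rw [← (S i).norm_emb_zero, hT,
    ContinuousLinearMap.norm_map_of_mem_unitary (pow_mem (hV i) n), (S i).norm_emb_zero]
  simp

namespace UniformFamily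

theorem regular_W (hS : UniformFamily S C₀ cG c) (i : ι) : ((S i).W c).Regular :=
  (S i).W_regular c fun n => (hS.form i).isClosed_ZGraph c n

theorem inv_resolventI (hS : UniformFamily S C₀ cG c) :
    UniformSmoothing S c (fun i => ((S i).op .Re).resolventI) ∧
      UniformSmoothing S c fun i => star ((S i).op .Re).resolventI := by
  have hc : 0 ≤ (cG / (1 + c))⁻¹ := by
    have := hS.cG_pos
    have := hS.c_pos
    positivity
  have hn : ∀ i, ‖((S i).op .Re).resolventI‖ ≤ (cG / (1 + c))⁻¹ := fun i => by
    have h := hS.form i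
    obtain ⟨G, hG, hGn⟩ := (h.coercive_of_im (z := -Complex.I) (by simp) (by simp)).exists_isInv
      h.dom h.bound
    rw [neg_smul] at hG
    rwa [h.isInv_resolventI.unique hG]
  refine ⟨hS.uniformSmoothing (fun i => (hS.form i).isInv_resolventI) hc hn ?_,
    hS.uniformSmoothing (fun i => (hS.form i).isInv_star_resolventI) hc
      (fun i => (norm_star _).trans_le (hn i)) (UniformBdd.smul_one _)⟩
  simpa only [neg_smul] using UniformBdd.smul_one (S := S) (-Complex.I)

end UniformFamily

/-- Uniform commutator bounds for the cutoffs `R i`. -/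
structure CutoffFamily (S : ι → HelmholtzSetting H) (c : ℝ) (h : ι → ℝ) (R : ι → H →L[ℂ] H) :
    Prop where
  nonneg : ∀ i, 0 ≤ h i
  mapsTo_Y : ∀ i, Set.MapsTo (R i) ((S i).Y c).inf ((S i).Y c).inf
  mapsTo_W : ∀ i, Set.MapsTo (R i) ((S i).W c).inf ((S i).W c).inf
  comm : ∀ (q : OpKind) (n : ℕ), CommBd n R (fun i => (S i).W c) (fun i => (S i).Y c)
    (fun _ => 1) h 2 0 fun i => ((S i).op q).ap

namespace CutoffFamily

variable {h : ι → ℝ} {R : ι → H →L[ℂ] H}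

/-- Allows the spectral shift by ±i to be treated as a perturbation K of Q: it has order 2 through
inclusions, and all its proper commutators vanish. -/
theorem commBd_smul_id (hh : ∀ i, 0 ≤ h i) (R : ι → H →L[ℂ] H) (z : ℂ) (n : ℕ) :
    CommBd n R (fun i => (S i).W c) (fun i => (S i).Y c) (fun _ => 1) h 2 0
      fun _ u => z • u := by
  intro k _
  cases k with
  | zero =>
    have h1 := (ordBd_incl_WY S c h).comp (fun _ => le_rfl) hh (ordBd_incl_W S c h 2)
    exact (h1.smul (fun i => (S i).Y_regular c) z).cast (by norm_num) rfl
  | succ k =>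
    simp only [adPow_smul_id]
    exact OrdBd.zero fun i => (S i).Y_regular c

theorem commBd_inverse (hR : CutoffFamily S c h R) (hS : UniformFamily S C₀ cG c) {q : OpKind}
    {K G : ι → H →L[ℂ] H} {c₁ : ℝ} (hc₁ : 0 < c₁) (hco : ∀ i, (S i).Coercive q (K i) c₁)
    (hG : ∀ i, (S i).IsInv q (K i) (G i))
    (hs : UniformSmoothing S c G) (hs' : UniformSmoothing S c fun i => star (G i)) {n : ℕ}
    (hK : CommBd n R (fun i => (S i).W c) (fun i => (S i).Y c) (fun _ => 1) h 2 0 fun i u => K i u) :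
    CommBd n R (fun i => (S i).Y c) (fun i => (S i).W c) (fun _ => 1) h (-2) 0 fun i u => G i u :=
  CommBd.inverse (fun _ => le_rfl) hR.nonneg (fun i => (S i).Y_regular c) hS.regular_W hR.mapsTo_Y
    hR.mapsTo_W ((hR.comm q n).add (fun _ => le_rfl) hR.nonneg (fun i => (S i).Y_regular c) hK)
    (hS.ordBd_inverse hc₁ hco hG hs hs' h) (fun i u _ => (hG i).right u) fun i u hu =>
      (hG i).left u ((S i).op_Re_domain_le (((S i).mem_W_inf c).1 hu).1)

theorem commBd_resolventI (hR : CutoffFamily S c h R) (hS : UniformFamily S C₀ cG c) (n : ℕ) :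
    CommBd n R (fun i => (S i).Y c) (fun i => (S i).W c) (fun _ => 1) h (-2) 0
      (fun i u => ((S i).op .Re).resolventI u) ∧
    CommBd n R (fun i => (S i).Y c) (fun i => (S i).W c) (fun _ => 1) h (-2) 0
      fun i u => star ((S i).op .Re).resolventI u := by
  have hc : 0 < cG / (1 + c) := by
    have := hS.cG_pos
    have := hS.c_pos
    positivity
  obtain ⟨h1, h2⟩ := hS.inv_resolventI
  refine ⟨hR.commBd_inverse hS (K := fun _ => -(Complex.I • (1 : H →L[ℂ] H))) hc (fun i => ?_)
    (fun i => (hS.form i).isInv_resolventI) h1 h2 ?_,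
    hR.commBd_inverse hS (K := fun _ => Complex.I • (1 : H →L[ℂ] H)) hc
    (fun i => (hS.form i).coercive_of_im (by simp) (by simp))
    (fun i => (hS.form i).isInv_star_resolventI) h2 (by simpa only [star_star] using h1)
    (commBd_smul_id hR.nonneg R Complex.I n)⟩
  · rw [← neg_smul]
    exact (hS.form i).coercive_of_im (by simp) (by simp)
  · have := commBd_smul_id (S := S) (c := c) hR.nonneg R (-Complex.I) n
    simpa only [neg_smul_one_clm_apply, neg_smul] using this

/-- Commutator bounds for a power series in a unitary operator `1 + z G`, times a power of the
resolvent. -/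
theorem commBd_series (hR : CutoffFamily S c h R) (hS : UniformFamily S C₀ cG c) {z : ℂ}
    {G : ι → H →L[ℂ] H} {n : ℕ}
    (hG : CommBd n R (fun i => (S i).Y c) (fun i => (S i).Y c) (fun _ => 1) h (-2) 0
      fun i u => G i u) (hV : ∀ i, 1 + z • G i ∈ unitary (H →L[ℂ] H))
    (hGN : ∀ i, Commute (1 + z • G i) ((S i).op .Re).resolventI) (M : ℕ) {a : ℕ → ℂ}
    (ha : ∀ K : ℕ, Summable fun n => ‖a n‖ * (1 + (n : ℝ)) ^ K) {L : ι → H →L[ℂ] H}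
    (hL : ∀ i u, HasSum (fun n => a n • ((1 + z • G i) ^ n)
      ((((S i).op .Re).resolventI ^ (M + 1)) u)) (L i u)) :
    CommBd n R (fun i => (S i).Y c) (fun i => (S i).W c) (fun _ => 1) h (-2 - 2 * M) 0
      fun i u => L i u := by
  have hY : ∀ i, ((S i).Y c).Regular := fun i => (S i).Y_regular c
  have hN := (hR.commBd_resolventI hS n).1
  have hNY : CommBd n R (fun i => (S i).Y c) (fun i => (S i).Y c) (fun _ => 1) h (-2) 0
      fun i u => ((S i).op .Re).resolventI u :=
    hN.mono (fun _ => le_rfl) hR.nonneg ((ordBd_incl_WY S c h).cast (by norm_num) rfl)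
  have hpow : ∀ M : ℕ, CommBd n R (fun i => (S i).Y c) (fun i => (S i).Y c) (fun _ => 1) h
      (-2 * M) 0 fun i u => (((S i).op .Re).resolventI ^ M) u := by
    intro M
    induction M with
    | zero =>
      intro k _
      cases k with
      | zero => exact (ordBd_incl_Y S c h 0).cast (by simp) rfl
      | succ k =>
        have e : ∀ i, adPow (R i) (fun u => (((S i).op .Re).resolventI ^ 0) u) (k + 1) =
            fun _ => 0 := fun i => by
          have e1 := adPow_smul_id (R i) 1 k
          simp only [one_smul] at e1
          exact e1
        simp only [e]
        exact OrdBd.zero hY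
    | succ M ih =>
      refine ((ih.comp (fun _ => le_rfl) hR.nonneg hY hY hR.mapsTo_Y hR.mapsTo_Y hNY).cast
        (by push_cast; ring) rfl).congr hR.mapsTo_Y fun i u _ => ?_
      rw [pow_succ]; rfl
  have hU := hG.one_add_smul_pow hY (ordBd_incl_Y S c h) hR.nonneg hR.mapsTo_Y
    (powBd_of_mem_unitary S c hV)
  have hw : ∀ i : ι × ℕ, (1 : ℝ) ≤ 1 + i.2 := fun i => by simp
  have h1 := hU.comp hw (fun i => hR.nonneg i.1) (fun i => hY i.1) (fun i => hY i.1)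
    (fun i => hR.mapsTo_Y i.1) (fun i => hR.mapsTo_Y i.1)
    ((hpow M).comap Prod.fst (fun _ => le_rfl) hR.nonneg hw)
  -- The powers of the unitary are controlled on the Y scale only. One of the M + 1 resolvents is
  -- commuted to the far left, where it carries Y back to W; the other M supply the remaining order
  -- -2M.
  have h2 := (hN.comap Prod.fst (fun _ => le_rfl) hR.nonneg hw).comp hw (fun i => hR.nonneg i.1)
    (fun i => hY i.1) (fun i => hS.regular_W i.1)
    (fun i => hR.mapsTo_Y i.1) (fun i => hR.mapsTo_Y i.1) h1
  refine CommBd.tsum hR.nonneg hS.regular_W (h2.cast (by ring) rfl) ha fun i u => ?_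
  refine (congrArg (HasSum · (L i u)) (funext fun k => ?_)).mp (hL i u)
  rw [pow_succ']
  exact congrArg (a k • ·) (DFunLike.congr_fun (((hGN i).pow_left k).eq)
    ((((S i).op .Re).resolventI ^ M) u))

/-- Taking (-m)⁺ + 1 resolvent factors yields an order at most m, and the inclusions of the W scale
raise it to m. Nonnegative and negative Fourier modes are the powers of U and of U*, both of the
form 1 + zG with G of order -2. -/
theorem commBd_funCalc (hR : CutoffFamily S c h R) (hS : UniformFamily S C₀ cG c) (f : 𝓢(ℝ, ℂ))
    (m : ℤ) (n : ℕ) : CommBd n R (fun i => (S i).Y c) (fun i => (S i).W c) (fun _ => 1) h m 0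
      fun i u => ((S i).op .Re).funCalc f u := by
  obtain ⟨a, b, ha, hb, hf⟩ := FormBounds.exists_funCalc_series (H := H) f ((-m).toNat + 1)
  choose L₁ L₂ hL h₁ h₂ using fun i => hf (S i) C₀ cG c (hS.form i)
  have es : ∀ N : H →L[ℂ] H, star (cayley N) = 1 + (-(2 * Complex.I)) • star N := fun N => by
    rw [cayley, star_add, star_one, star_smul]
    simp
  have hV : ∀ i, 1 + (2 * Complex.I) • ((S i).op .Re).resolventI ∈ unitary (H →L[ℂ] H) :=
    fun i => (hS.form i).cayley_mem_unitary
  have hnormal : ∀ i, IsStarNormal ((S i).op .Re).resolventI := fun i =>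
    isStarNormal_of_cayley (hV i)
  simp only [es] at h₂
  obtain ⟨hN, hN'⟩ := hR.commBd_resolventI hS n
  have hWY : OrdBd (fun i => (S i).W c) (fun i => (S i).Y c) (fun _ => 1) h (-2 - -2) 0
      fun _ u => u := (ordBd_incl_WY S c h).cast (by norm_num) rfl
  have b₁ := hR.commBd_series hS (hN.mono (fun _ => le_rfl) hR.nonneg hWY) hV
    (fun i => (Commute.one_left _).add_left ((Commute.refl _).smul_left _)) _ ha h₁
  have b₂ := hR.commBd_series hS (hN'.mono (fun _ => le_rfl) hR.nonneg hWY)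
    (fun i => by rw [← es]; exact Unitary.star_mem (hV i))
    (fun i => (Commute.one_left _).add_left ((hnormal i).star_comm_self.smul_left _)) _ hb h₂
  refine ((b₁.add (fun _ => le_rfl) hR.nonneg hS.regular_W b₂).mono (fun _ => le_rfl) hR.nonneg
    ((ordBd_incl_W S c h (m - (-2 - 2 * ((-m).toNat : ℤ))).toNat).cast (by omega) rfl)).congr
    hR.mapsTo_Y fun i u _ => ?_
  rw [hL]; rfl

end CutoffFamily

/-! ### The elliptic perturbation -/

/-- Factors T out of the series on the left, with a bound on the remaining vector by the ℓ¹ norm of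
the coefficients. With T a power of the resolvent, this shows that functions of 𝒫 map H into H^n. -/
theorem exists_eq_of_hasSum_unitary {V T L : H →L[ℂ] H} (hV : V ∈ unitary (H →L[ℂ] H))
    (hVT : Commute V T) {a : ℕ → ℂ} (ha : Summable fun n => ‖a n‖)
    (hL : ∀ u, HasSum (fun n => a n • ((V ^ n) (T u))) (L u)) (u : H) :
    ∃ v, L u = T v ∧ ‖v‖ ≤ (∑' n, ‖a n‖) * ‖u‖ := by
  have hn : ∀ n, ‖a n • (V ^ n) u‖ = ‖a n‖ * ‖u‖ := fun n => by
    rw [norm_smul, ContinuousLinearMap.norm_map_of_mem_unitary (pow_mem hV n)]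
  have hs : Summable fun n => ‖a n • (V ^ n) u‖ := by
    simp only [hn]
    exact ha.mul_right _
  refine ⟨∑' n, a n • (V ^ n) u, ?_, ?_⟩
  · refine (hL u).unique ((congrArg (HasSum · _) (funext fun n => ?_)).mp
      (T.hasSum hs.of_norm.hasSum))
    rw [map_smul]
    exact congrArg (a n • ·) (DFunLike.congr_fun (hVT.pow_left n).eq u).symm
  · refine (norm_tsum_le_tsum_norm hs).trans_eq ?_
    simp only [hn]
    exact ha.tsum_mul_right _

theorem UniformFamily.uniformBdd_funCalc (hS : UniformFamily S C₀ cG c) (f : 𝓢(ℝ, ℂ)) :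
    UniformBdd S fun i => ((S i).op .Re).funCalc f := by
  intro n
  have hpow : ∀ M : ℕ, ∃ C, 0 ≤ C ∧ ∀ i, ∀ u : H, ∃ x : (S i).Sp M,
      (S i).emb M x = (((S i).op .Re).resolventI ^ M) u ∧ ‖x‖ ≤ C * ‖u‖ := by
    intro M
    induction M with
    | zero =>
      refine ⟨1, zero_le_one, fun i u => ?_⟩
      obtain ⟨x, hx⟩ := (S i).emb_zero_surjective u
      exact ⟨x, hx, by rw [← (S i).norm_emb_zero, hx, one_mul]⟩
    | succ M ih =>
      obtain ⟨C, hC, h⟩ := ih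
      obtain ⟨C', hC', h'⟩ := hS.inv_resolventI.1 M
      refine ⟨C' * C, by positivity, fun i u => ?_⟩
      obtain ⟨x, hx, hxn⟩ := h i u
      obtain ⟨T, hT, hTn⟩ := h' i
      obtain ⟨J, hJ, hJn⟩ := (S i).exists_zToSp c (M + 2)
      obtain ⟨J', hJ', hJn'⟩ := (S i).exists_incl (show M + 1 ≤ M + 2 by omega)
      refine ⟨J' (J (T x)), by rw [hJ', hJ, hT, hx, pow_succ']; rfl, ?_⟩
      have a1 := J'.le_of_opNorm_le hJn' (J (T x))
      have a2 := J.le_of_opNorm_le hJn (T x)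
      have a3 := T.le_of_opNorm_le hTn x
      have a4 : C' * ‖x‖ ≤ C' * (C * ‖u‖) := by gcongr
      linarith
  obtain ⟨C, hC, h⟩ := hpow n
  obtain ⟨a, b, ha, hb, hf⟩ := FormBounds.exists_funCalc_series (H := H) f n
  have ha : Summable fun n => ‖a n‖ := by simpa using ha 0
  have hb : Summable fun n => ‖b n‖ := by simpa using hb 0
  refine ⟨C * (∑' n, ‖a n‖ + ∑' n, ‖b n‖),
    mul_nonneg hC (add_nonneg (tsum_nonneg fun _ => norm_nonneg _)
      (tsum_nonneg fun _ => norm_nonneg _)), fun i x => ?_⟩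
  obtain ⟨L₁, L₂, hL, h₁, h₂⟩ := hf (S i) C₀ cG c (hS.form i)
  have hV := (hS.form i).cayley_mem_unitary
  have hnormal := isStarNormal_of_cayley hV
  have c₁ : Commute (cayley ((S i).op .Re).resolventI) ((S i).op .Re).resolventI :=
    (Commute.one_left _).add_left ((Commute.refl _).smul_left _)
  have c₂ : Commute (star (cayley ((S i).op .Re).resolventI)) ((S i).op .Re).resolventI := by
    rw [cayley, star_add, star_one, star_smul]
    exact (Commute.one_left _).add_left (hnormal.star_comm_self.smul_left _)
  obtain ⟨v₁, e₁, n₁⟩ := exists_eq_of_hasSum_unitary hV (c₁.pow_right n) ha h₁ ((S i).emb n x)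
  obtain ⟨v₂, e₂, n₂⟩ := exists_eq_of_hasSum_unitary (Unitary.star_mem hV) (c₂.pow_right n) hb h₂
    ((S i).emb n x)
  obtain ⟨y, hy, hyn⟩ := h i (v₁ + v₂)
  refine ⟨y, ?_, hyn.trans ?_⟩
  · rw [hy, map_add, ← e₁, ← e₂]
    exact (DFunLike.congr_fun hL _).symm
  · rw [mul_assoc]
    refine mul_le_mul_of_nonneg_left ((norm_add_le _ _).trans ?_) hC
    rw [add_mul]
    have hx := (S i).norm_emb_le x
    refine add_le_add (n₁.trans ?_) (n₂.trans ?_) <;> gcongr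

/-- `P + ψ(𝒫)` is invertible, and its inverse satisfies the commutator bounds of an operator of
order `-2`. -/
theorem UniformFamily.exists_inverse_PSharp (hS : UniformFamily S C₀ cG c) (f : 𝓢(ℝ, ℂ))
    {ψ : ℝ → ℝ} (hf : ∀ x, f x = ψ x)
    (hψ : ∀ i, ∀ x : ℝ, (x : ℂ) ∈ ((S i).op .Re).spec → (-x + c) / 2 ≤ ψ x) :
    ∃ G : ι → H →L[ℂ] H, (∀ i, (S i).IsInv .P (((S i).op .Re).funCalc f) (G i)) ∧
      ∀ (h : ι → ℝ) (R : ι → H →L[ℂ] H), CutoffFamily S c h R → ∀ n : ℕ,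
        CommBd n R (fun i => (S i).Y c) (fun i => (S i).W c) (fun _ => 1) h (-2) 0
          fun i u => G i u := by
  have hco : ∀ q i, (S i).Coercive q (((S i).op .Re).funCalc f) (cG / 2) := fun q i =>
    (hS.form i).coercive_funCalc f hf (hψ i) q
  have hc₁ := half_pos hS.cG_pos
  choose G hG hGn using fun i => (hco .P i).exists_isInv (hS.form i).dom (hS.form i).bound
  -- The self-adjointness of ψ(𝒫) identifies the inverse of P* + ψ(𝒫) with the adjoint of G.
  -- Regularity of this adjoint is what the negative part of the scale requires.
  choose G' hG' hGn' using fun i => (hco .Pstar i).exists_isInv (hS.form i).dom (hS.form i).bound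
  have hf' : (f : ℝ → ℂ) = fun x => (ψ x : ℂ) := funext hf
  have e : ∀ i, G' i = star (G i) := fun i => by
    refine (hG i).adjoint_eq (hS.form i).dom ?_
    rw [hf', FormBounds.star_funCalc, ← hf']
    exact hG' i
  have hK := hS.uniformBdd_funCalc f
  have s₁ := hS.uniformSmoothing hG (inv_nonneg.2 hc₁.le) hGn hK
  have s₂ := hS.uniformSmoothing hG' (inv_nonneg.2 hc₁.le) hGn' hK
  rw [show G' = fun i => star (G i) from funext e] at s₂
  refine ⟨G, hG, fun h R hR n => hR.commBd_inverse hS hc₁ (hco .P) hG s₁ s₂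
    fun k hk => ?_⟩
  have hWY := ordBd_incl_WY S c h
  exact ((hWY.comp (fun _ => le_rfl) hR.nonneg (hR.commBd_funCalc hS f 2 n k hk)).comp
    (fun _ => le_rfl) hR.nonneg hWY).cast (by ring) (by ring)

end HelmholtzSetting

/-! ### Passage between the order notation and bounds over an index set. -/

section Conversion

variable {H : Type u} {k₀ : ℝ} {X X' : ℝ → SpaceScale H} {m : ℤ} {b : ℝ → ℝ} {L : ℝ → H → H}

theorem IsOrderFrom.ordBd (hL : IsOrderFrom k₀ X X' m b L) {h : Set.Ici k₀ → ℝ} {p : ℕ}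
    (hh : ∀ i, 0 ≤ h i) (hb : ∀ i : Set.Ici k₀, b i = h i ^ p) :
    OrdBd (fun i : Set.Ici k₀ => X i) (fun i => X' i) (fun _ => 1) h m p fun i => L i := by
  intro j j' hj
  obtain rfl : j' = j - m := by omega
  obtain ⟨C, hC, hT⟩ := hL.2 j
  refine ⟨C, hC.le, 0, fun i => ?_⟩
  obtain ⟨T, h1, h2⟩ := hT i i.2
  have := hh i
  refine ⟨T, h1, T.opNorm_le_bound (by positivity) fun x => ?_⟩
  have := h2 x
  rw [hb] at this
  simpa using this

theorem OrdBd.isOrderFrom {h : Set.Ici k₀ → ℝ} {p : ℕ}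
    (hL : OrdBd (fun i : Set.Ici k₀ => X i) (fun i => X' i) (fun _ => 1) h m p fun i => L i)
    (hh : ∀ i, 0 ≤ h i) (hb : ∀ i : Set.Ici k₀, b i = h i ^ p) : IsOrderFrom k₀ X X' m b L := by
  refine ⟨fun k hk => hL.mapsTo ⟨k, hk⟩, fun j => ?_⟩
  obtain ⟨C, hC, M, hT⟩ := hL j (j - m) (by omega)
  -- `OrdBd` admits C = 0, whereas the order notation demands a positive constant.
  refine ⟨C + 1, by positivity, fun k hk => ?_⟩
  obtain ⟨T, h1, h2⟩ := hT ⟨k, hk⟩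
  refine ⟨T, h1, fun x => (T.le_of_opNorm_le h2 x).trans ?_⟩
  have e := hb ⟨k, hk⟩
  simp only at e
  have := hh ⟨k, hk⟩
  rw [e, one_pow, mul_one]
  gcongr
  linarith

theorem isOrderFrom_of_subsingleton [NormedAddCommGroup H] [InnerProductSpace ℂ H]
    [Subsingleton H] (hX : ∀ k ≥ k₀, ∀ j, Subsingleton ((X k).Sp j))
    (hX' : ∀ k ≥ k₀, ∀ j, (X' k).rep j 0 0) : IsOrderFrom k₀ X X' m b L := by
  refine ⟨fun k hk u _ j => ⟨0, ?_⟩, fun j => ⟨1, one_pos, fun k hk => ⟨0, fun u _ x _ => ?_,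
    fun x => ?_⟩⟩⟩
  · rw [Subsingleton.elim (L k u) 0]
    exact hX' k hk j
  · rw [Subsingleton.elim (L k u) 0]
    exact hX' k hk _
  · have := hX k hk j
    rw [Subsingleton.elim x 0]
    simp

/-- Separated operators on both sides of an operator with commutator bounds. -/
theorem isOrderFrom_of_commBd [NormedAddCommGroup H] [InnerProductSpace ℂ H] {η : ℝ → ℝ}
    (hη : ∀ k ≥ k₀, 0 ≤ η k) (hX' : ∀ k ≥ k₀, (X' k).Regular)
    (incl : ∀ d : ℕ, OrdBd (fun i : Set.Ici k₀ => X' i) (fun i => X' i) (fun _ => 1)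
      (fun i : Set.Ici k₀ => (η i)⁻¹) d 0 fun _ u => u) {A B R : ℝ → H →L[ℂ] H} {N : ℕ}
    (hL : CommBd N (fun i : Set.Ici k₀ => R i) (fun i : Set.Ici k₀ => X i) (fun i => X' i)
      (fun _ => 1) (fun i : Set.Ici k₀ => (η i)⁻¹) m 0 fun i => L i)
    (hA : IsOrderFrom k₀ X' X' 0 (fun _ => 1) fun k => A k)
    (hA' : ∀ n : ℕ, IsOrderFrom k₀ X' X' 0 (fun k => η k ^ (-n : ℤ))
      fun k => A k ∘L (ContinuousLinearMap.id ℂ H - R k))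
    (hB : IsOrderFrom k₀ X X 0 (fun _ => 1) fun k => B k)
    (hB' : ∀ n : ℕ, IsOrderFrom k₀ X X 0 (fun k => η k ^ (-n : ℤ)) fun k => R k ∘L B k) :
    IsOrderFrom k₀ X X' m (fun k => η k ^ (-N : ℤ)) fun k u => A k (L k (B k u)) := by
  have hh : ∀ i : Set.Ici k₀, 0 ≤ (η i)⁻¹ := fun i => inv_nonneg.2 (hη i i.2)
  have hb : ∀ (n : ℕ) (i : Set.Ici k₀), η i ^ (-n : ℤ) = (η i)⁻¹ ^ n := fun n i => by
    rw [zpow_neg, zpow_natCast, inv_pow]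
  have hsep := hL.separated (A := fun i : Set.Ici k₀ => A i) (B := fun i : Set.Ici k₀ => B i)
    (fun _ => le_rfl) hh (fun i => hX' i i.2) incl (hA.ordBd hh fun _ => (pow_zero _).symm)
    (fun n => (hA' n).ordBd hh (hb n)) (hB.ordBd hh fun _ => (pow_zero _).symm)
    fun n => (hB' n).ordBd hh (hb n)
  exact hsep.isOrderFrom hh (hb N)

end Conversion

theorem subsingleton_antidual (V : Type*) [NormedAddCommGroup V] [NormedSpace ℂ V]
    [Subsingleton V] : Subsingleton (V →L⋆[ℂ] ℂ) :=
  ⟨fun x y => ContinuousLinearMap.ext fun v => by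
    rw [Subsingleton.elim v 0, map_zero, map_zero]⟩

/-! ### Assembly for the family indexed by k ≥ k₀. -/

section Family

variable {H : Type u} [NormedAddCommGroup H] [InnerProductSpace ℂ H] [CompleteSpace H]

namespace HelmholtzSetting

omit [CompleteSpace H] in
theorem subsingleton_Sp [Subsingleton H] (S : HelmholtzSetting H) (n : ℕ) :
    Subsingleton (S.Sp n) := (S.emb_injective n).subsingleton

theorem subsingleton_ZSp [Subsingleton H] (S : HelmholtzSetting H) (c : ℝ) (n : ℕ) :
    Subsingleton (S.ZSp c n) := (S.zEmb_injective c n).subsingleton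

theorem subsingleton_Y [Subsingleton H] (S : HelmholtzSetting H) (c : ℝ) :
    ∀ j, Subsingleton ((S.Y c).Sp j)
  | .ofNat n => S.subsingleton_Sp n
  | .negSucc n => by
    have := S.subsingleton_ZSp c (n + 1)
    exact subsingleton_antidual (S.ZSp c (n + 1))

theorem subsingleton_W [Subsingleton H] (S : HelmholtzSetting H) (c : ℝ) :
    ∀ j, Subsingleton ((S.W c).Sp j)
  | .ofNat n => S.subsingleton_ZSp c n
  | .negSucc n => by
    have := S.subsingleton_Sp (n + 1)
    exact subsingleton_antidual (S.Sp (n + 1))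

theorem bijective_PSharp {S : HelmholtzSetting H} {ψ : ℝ → ℝ} {G : H →L[ℂ] H}
    (hG : S.IsInv .P ((S.op .Re).funCalc fun x => (ψ x : ℂ)) G) :
    Function.Bijective (S.PSharp ψ) ∧ S.PSharpInv ψ = G := by
  have e : ∀ u : (S.op .P).domain, S.PSharp ψ u =
      (S.op .P).ap u + (S.op .Re).funCalc (fun x => (ψ x : ℂ)) u := fun u => by
    rw [PSharp, LinearPMap.ap_eq _ u.2]
  have hl : ∀ u : (S.op .P).domain, G (S.PSharp ψ u) = u := fun u => by
    rw [e]
    exact hG.left u u.2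
  have hr : ∀ u : H, S.PSharp ψ ⟨G u, hG.mem u⟩ = u := fun u => by
    rw [e]
    exact hG.right u
  refine ⟨⟨fun u v h => Subtype.ext (by rw [← hl, h, hl]), fun u => ⟨_, hr u⟩⟩, funext fun u => ?_⟩
  have := hl (Function.invFun (S.PSharp ψ) u)
  rw [Function.invFun_eq ⟨_, hr u⟩] at this
  exact this.symm

end HelmholtzSetting

open HelmholtzSetting

variable {S : ℝ → HelmholtzSetting H} {CGa η : ℝ → ℝ}

/-- Elliptic regularity is assumed for weak solutions; for u in Z^2 the symmetry between Q and its
adjoint turns the strong equation into the weak one. -/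
theorem exists_uniformFamily (hcont : UniformContinuity S) (hgar : GardingInequality S CGa)
    (hdom : ∀ k > 0, (S k).DomainSymmetry) (hell : EllipticRegularity S CGa) {k₀ : ℝ}
    (hk₀ : 0 < k₀) :
    ∃ C₀ cG, UniformFamily (fun i : Set.Ici k₀ => S i) C₀ cG (CGa k₀) := by
  obtain ⟨C₀, -, hC₀⟩ := hcont k₀ hk₀
  obtain ⟨hC, cG, hcG, hG⟩ := hgar k₀ hk₀
  have hd : ∀ i : Set.Ici k₀, (S i).DomainSymmetry := fun i => hdom i (hk₀.trans_le i.2)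
  refine ⟨C₀, cG, hcG, hC, fun i => ⟨hd i, hC₀ i i.2, hcG, hC, hG i i.2⟩, fun q n => ?_⟩
  obtain ⟨C, hC, h⟩ := hell q k₀ hk₀ n
  refine ⟨C, hC, fun i u w hu e => h i i.2 u w fun v => ?_⟩
  rw [← LinearPMap.ap_eq _ v.2, ← e]
  exact (hd i).inner_ap_adj q hu ((hd i).domain_eq q.adj ▸ v.2)

theorem IsSpatialCutoff.cutoffFamily {R : ℝ → H →L[ℂ] H} (hR : IsSpatialCutoff S CGa η R)
    (hη : ∀ k > 0, 0 ≤ η k) {k₀ : ℝ} (hk₀ : 0 < k₀) :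
    CutoffFamily (fun i : Set.Ici k₀ => S i) (CGa k₀)
      (fun i : Set.Ici k₀ => (η i)⁻¹) fun i => R i where
  nonneg i := inv_nonneg.2 (hη i (hk₀.trans_le i.2))
  mapsTo_Y i := (hR.order k₀ hk₀).1 i i.2
  mapsTo_W i u hu := by
    -- The cutoff preserves W^∞ built with the constant C_Ga(k), while C_Ga(k₀) is needed here; the
    -- set is the same.
    rw [mem_W_inf] at hu ⊢
    exact ((S i).mem_W_inf _).1 (hR.mapsTo_W i (hk₀.trans_le i.2) (((S i).mem_W_inf _).2 hu))
  comm q _ n _ := ((hR.ad q n k₀ hk₀).ordBd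
    (fun i => inv_nonneg.2 (hη i (hk₀.trans_le i.2)))
    fun i => by rw [zpow_neg, zpow_natCast, inv_pow]).cast rfl (zero_add n).symm

/-- No sign is assumed for η, but the bound C η⁻¹‖v‖ on the first commutator must be nonnegative at
some v ≠ 0. When H is trivial this fails, and every order bound holds trivially instead. -/
theorem IsSpatialCutoff.nonneg [Nontrivial H] {R : ℝ → H →L[ℂ] H}
    (hR : IsSpatialCutoff S CGa η R) {k : ℝ} (hk : 0 < k) : 0 ≤ η k := by
  obtain ⟨C, hC, hT⟩ := (hR.ad .P 1 k hk).2 0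
  obtain ⟨T, -, hT⟩ := hT k le_rfl
  obtain ⟨v, hv⟩ := exists_ne (0 : H)
  have h1 : 0 ≤ C * η k ^ (-(1 : ℕ) : ℤ) * ‖v‖ := (norm_nonneg _).trans (hT v)
  have h2 := nonneg_of_mul_nonneg_left h1 (norm_pos_iff.2 hv)
  have h3 := nonneg_of_mul_nonneg_right h2 hC
  simpa using h3

end Family

theorem theorem5 {H : Type u} [NormedAddCommGroup H] [InnerProductSpace ℂ H] [CompleteSpace H]
    (S : ℝ → HelmholtzSetting H) (CGa : ℝ → ℝ)
    (hcont : UniformContinuity S)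
    (hgar : GardingInequality S CGa)
    (hdom : ∀ k > 0, (S k).DomainSymmetry)
    (hop : OperatorContinuity S CGa)
    (hell : EllipticRegularity S CGa)
    (η : ℝ → ℝ) (A B : ℝ → H →L[ℂ] H) (hsep : AreSeparated S CGa η A B)
    (f : 𝓢(ℝ, ℂ)) :
    (∀ m : ℤ, IsOrderInf (scaleY S CGa) (scaleW S CGa) m η
      (fun k u => A k (((S k).op .Re).funCalc f (B k u)))) ∧
    (∀ q : OpKind, IsOrderInf (scaleW S CGa) (scaleY S CGa) 2 η
      (fun k u => A k (((S k).op q).ap (B k u)))) ∧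
    (∀ k₀ > 0, ∀ ψ : ℝ → ℝ, IsAdmissible S CGa k₀ ψ →
      (∀ k ≥ k₀, Function.Bijective ((S k).PSharp ψ)) ∧
      ∀ N : ℕ, IsOrderFrom k₀ (scaleY S CGa k₀) (scaleW S CGa k₀) (-2)
        (fun k => η k ^ (-N : ℤ)) (fun k u => A k ((S k).PSharpInv ψ (B k u)))) := by
  obtain ⟨hA, hB, R, hR, hAR, hRB⟩ := hsep
  have hfam := fun k₀ hk₀ => exists_uniformFamily hcont hgar hdom hell (k₀ := k₀) hk₀
  have hregW : ∀ k₀ > 0, ∀ k ≥ k₀, (scaleW S CGa k₀ k).Regular := fun k₀ hk₀ k hk => by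
    obtain ⟨C₀, cG, hS⟩ := hfam k₀ hk₀
    exact hS.regular_W ⟨k, hk⟩
  have hregY : ∀ k₀ k, (scaleY S CGa k₀ k).Regular := fun k₀ k => (S k).Y_regular _
  -- Common form of the two conclusions from Y to W: on the left A and A(1-R) act in the target
  -- scale W, on the right B and RB act in the source scale Y.
  have hYW : ∀ k₀ > 0, ∀ (m : ℤ) (N : ℕ) (L : ℝ → H → H), (∀ h : Set.Ici k₀ → ℝ,
      HelmholtzSetting.CutoffFamily (fun i : Set.Ici k₀ => S i) (CGa k₀) h (fun i => R i) →
      CommBd N (fun i : Set.Ici k₀ => R i) (fun i : Set.Ici k₀ => (S i).Y (CGa k₀))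
        (fun i : Set.Ici k₀ => (S i).W (CGa k₀)) (fun _ => 1) h m 0 fun i => L i) →
      IsOrderFrom k₀ (scaleY S CGa k₀) (scaleW S CGa k₀) m (fun k => η k ^ (-N : ℤ))
        fun k u => A k (L k (B k u)) := by
    intro k₀ hk₀ m N L hL
    rcases subsingleton_or_nontrivial H with hH | hH
    · exact isOrderFrom_of_subsingleton (fun k _ => (S k).subsingleton_Y _)
        fun k hk => (hregW k₀ hk₀ k hk).zero
    · exact isOrderFrom_of_commBd (fun k hk => hR.nonneg (hk₀.trans_le hk)) (hregW k₀ hk₀)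
        (HelmholtzSetting.ordBd_incl_W _ _ _)
        (hL _ (hR.cutoffFamily (fun k hk => hR.nonneg hk) hk₀)) (hA.1 k₀ hk₀)
        (fun n => hAR.2 n k₀ hk₀) (hB.2 k₀ hk₀) fun n => hRB.1 n k₀ hk₀
  refine ⟨fun m N k₀ hk₀ => ?_, fun q N k₀ hk₀ => ?_, fun k₀ hk₀ ψ hψ => ?_⟩
  · obtain ⟨C₀, cG, hS⟩ := hfam k₀ hk₀
    exact hYW k₀ hk₀ m N _ fun h hC => hC.commBd_funCalc hS f m N
  · rcases subsingleton_or_nontrivial H with hH | hH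
    · exact isOrderFrom_of_subsingleton (fun k _ => (S k).subsingleton_W _)
        fun k _ => (hregY k₀ k).zero
    · exact isOrderFrom_of_commBd (fun k hk => hR.nonneg (hk₀.trans_le hk))
        (fun k _ => hregY k₀ k) (HelmholtzSetting.ordBd_incl_Y _ _ _)
        ((hR.cutoffFamily (fun k hk => hR.nonneg hk) hk₀).comm q N) (hA.2 k₀ hk₀)
        (fun n => hAR.1 n k₀ hk₀) (hB.1 k₀ hk₀) fun n => hRB.2 n k₀ hk₀
  · obtain ⟨C₀, cG, hS⟩ := hfam k₀ hk₀
    let g : 𝓢(ℝ, ℂ) := (hψ.compact.comp_left (g := fun x : ℝ => (x : ℂ)) rfl).toSchwartzMap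
      (Complex.ofRealCLM.contDiff.comp hψ.smooth)
    have hg : (g : ℝ → ℂ) = fun x => (ψ x : ℂ) := rfl
    obtain ⟨G, hG, hGc⟩ := hS.exists_inverse_PSharp g (fun x => congrFun hg x)
      fun i => hψ.lower i i.2
    simp only [hg] at hG
    have hb := fun i => HelmholtzSetting.bijective_PSharp (hG i)
    refine ⟨fun k hk => (hb ⟨k, hk⟩).1, fun N => hYW k₀ hk₀ (-2) N _ fun h hC => ?_⟩
    have e : (fun i : Set.Ici k₀ => (S i).PSharpInv ψ) = fun i => ⇑(G i) :=
      funext fun i => (hb i).2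
    have := hGc h _ hC N
    rw [← e] at this
    exact this
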